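/- **Setting.** ZH-diagrams are the string diagrams (finite open graphs) built from white spiders ($Z$-spiders) and H-boxes with a label $a\in\mathbb C$ and any number of legs, by placing diagrams side by side and joining wire ends; unlabelled H-boxes have $a=-1$. Derived generators: the grey spider is a white spider with an unlabelled binary H-box on each leg (and the scalar $\tfrac12$); the NOT gate is the binary grey spider whose central white spider carries one more, unlabelled unary H-box; the exponentiated H-box with label $\alpha\in\mathbb C$ is the H-box with label $e^{i\alpha}$; the white phase spider with label $\alpha$ is a white spider with an exponentiated unary H-box $\alpha$ attached. Two diagrams are *equal in the ZH-calculus* if one can be transformed into the other by topological deformations and by applying, to any part of a diagram, the rules (ZS1), (ZS2), (HS1), (HS2), (BA1), (BA2), (M), (U), (I), (A), (O) of the ZH-calculus of Backens and Kissinger (fusion of white spiders, white binary spider is a wire, fusion of H-boxes, cancellation of two H-boxes, the two bialgebra rules, multiply, unit, intro, average, ortho). As usual, nonzero scalar factors are ignored: *equal up to a scalar* means that $D$ equals $E$ together with a legless H-box of some label $\lambda\ne0$. For $\vec b,\vec c\in\mathbb B^n=\{0,1\}^n$ let $$\Omega(\vec b,\vec c)=b_1c_1\oplus\dots\oplus b_nc_n\in\{0,1\},\qquad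 \chi(\vec b,\vec c)=(-1)^{\vec b\cdot\vec c},\quad \vec b\cdot\vec c=\sum_i b_ic_i .$$ Both diagrams below have $n$ outputs and start from $n$ white spiders with one output each. * $\mathrm{NF}(\alpha)$: for every $\vec b\in\mathbb B^n$ there is one exponentiated H-box with label $\alpha_{\vec b}$ and $n$ legs, whose $i$-th leg is connected to the $i$-th white spider by a bare wire if $b_i=1$ and through a NOT gate if $b_i=0$. * $\mathrm{PG}(\widetilde\alpha)$: for every $\vec c\in\mathbb B^n$ there is one phase gadget, that is, a grey spider with $n+1$ legs, one of which is joined to a unary white phase spider with label $\widetilde\alpha_{\vec c}$; its $i$-th remaining leg is connected to the $i$-th white spider by a bare wire if $c_i=1$ and disconnected from it if $c_i=0$ (the wire is replaced by a unary white spider on the white spider's side and a unary grey spider on the grey spider's side). **Theorem.** Let $n\ge 0$ and let $(\alpha_{\vec b})_{\vec b\in\mathbb B^n}$ and $(\widetilde\alpha_{\vec c})_{\vec c\in\mathbb B^n}$ be complex numbers. Consider the relations $$\text{(1)}\quad \alpha_{\vec b}=\sum_{\vec c\in\mathbb B^n}\widetilde\alpha_{\vec c}\,\Omega(\vec b,\vec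 c)\ \text{ for all }\vec b,\qquad\qquad \text{(2)}\quad \widetilde\alpha_{\vec c}=\frac{-1}{2^{n-1}}\sum_{\vec b\in\mathbb B^n}\alpha_{\vec b}\,\chi(\vec b,\vec c)\ \text{ for all }\vec c .$$ If (1) or (2) holds, then $\mathrm{NF}(\alpha)$ and $\mathrm{PG}(\widetilde\alpha)$ are equal up to a scalar in the ZH-calculus. Moreover, the two relations are inverse to each other up to the two coefficients that only affect scalars: (1) implies $\widetilde\alpha_{\vec c}=\frac{-1}{2^{n-1}}\sum_{\vec b}\alpha_{\vec b}\,\chi(\vec b,\vec c)$ for all $\vec c\neq\vec 0$, and (2) implies $\alpha_{\vec b}=\alpha_{\vec 0}+\sum_{\vec c}\widetilde\alpha_{\vec c}\,\Omega(\vec b,\vec c)$ for all $\vec b$. -/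

import Mathlib

namespace ZHCalculus

/-- ZH-diagrams.  `ZH B` is the type of diagrams whose open wire ends (inputs and outputs) are
labelled by `B`.  Since only the topology of a diagram matters, no difference is made between
inputs and outputs: a diagram with inputs `A` and outputs `B` is a term of `ZH (A ⊕ B)`.

* `Z L` is the white spider with set of legs `L`;
* `H a L` is the H-box with label `a` and set of legs `L`;
* `strand` is a bare piece of wire, with its two ends `false` and `true`;
* `net D e` places the finitely many diagrams `D i` next to each other and joins some of their
  open ends by the wires `W`: the equivalence `e` says for each open end of each `D i` whether it
  becomes an open end of the new diagram, or one of the two ends of a wire in `W`. -/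
inductive ZH : Type → Type 1
  | Z (L : Type) [Finite L] : ZH L
  | H (a : ℂ) (L : Type) [Finite L] : ZH L
  | strand : ZH Bool
  | net {ι B W : Type} {L : ι → Type} [Finite ι] [Finite W]
      (D : (i : ι) → ZH (L i)) (e : (Σ i, L i) ≃ B ⊕ W × Bool) : ZH B

open ZH

/-! ### Composition of diagrams -/

/-- Renaming of the open ends. -/
def relabel {A B : Type} (g : A ≃ B) (D : ZH A) : ZH B :=
  net (ι := Unit) (W := Empty) (L := fun _ => A) (fun _ => D)
    ((Equiv.uniqueSigma fun _ : Unit => A).trans (g.trans (Equiv.sumEmpty B (Empty × Bool)).symm))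

/-- A family of diagrams placed side by side. -/
def sideBySide {ι : Type} {L : ι → Type} [Finite ι] (D : (i : ι) → ZH (L i)) : ZH (Σ i, L i) :=
  net (W := Empty) D (Equiv.sumEmpty (Σ i, L i) (Empty × Bool)).symm

/-- The two-element family of leg sets `A`, `B`. -/
def pairLegs (A B : Type) : Bool → Type
  | false => A
  | true => B

/-- The two-element family of diagrams `D`, `E`. -/
def pair {A B : Type} (D : ZH A) (E : ZH B) : (t : Bool) → ZH (pairLegs A B t)
  | false => D
  | true => E

/-- Two diagrams side by side. -/
def tensor {A B : Type} (D : ZH A) (E : ZH B) : ZH (A ⊕ B) :=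
  net (W := Empty) (pair D E)
    { toFun := fun
        | ⟨false, a⟩ => Sum.inl (Sum.inl a)
        | ⟨true, b⟩ => Sum.inl (Sum.inr b)
      invFun := fun
        | Sum.inl (Sum.inl a) => ⟨false, a⟩
        | Sum.inl (Sum.inr b) => ⟨true, b⟩
      left_inv := by rintro ⟨_ | _, _⟩ <;> rfl
      right_inv := by rintro ((_ | _) | ⟨⟨⟩, _⟩) <;> rfl }

/-- Stacking: the outputs `C` of `D` are joined to the inputs `C` of `E`. -/
def stack {A B C : Type} [Finite C] (D : ZH (A ⊕ C)) (E : ZH (C ⊕ B)) : ZH (A ⊕ B) :=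
  net (W := C) (pair D E)
    { toFun := fun
        | ⟨false, Sum.inl a⟩ => Sum.inl (Sum.inl a)
        | ⟨false, Sum.inr c⟩ => Sum.inr (c, false)
        | ⟨true, Sum.inl c⟩ => Sum.inr (c, true)
        | ⟨true, Sum.inr b⟩ => Sum.inl (Sum.inr b)
      invFun := fun
        | Sum.inl (Sum.inl a) => ⟨false, Sum.inl a⟩
        | Sum.inr (c, false) => ⟨false, Sum.inr c⟩
        | Sum.inr (c, true) => ⟨true, Sum.inl c⟩
        | Sum.inl (Sum.inr b) => ⟨true, Sum.inr b⟩
      left_inv := by rintro ⟨_ | _, _ | _⟩ <;> rfl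
      right_inv := by rintro ((_ | _) | ⟨_, _ | _⟩) <;> rfl }

/-- The identity diagram on one wire. -/
def idWire : ZH (Unit ⊕ Unit) :=
  relabel Equiv.boolEquivPUnitSumPUnit strand

/-- The scalar `a` placed next to `D`; the scalar `a` is the H-box with label `a` and no legs. -/
def scale {B : Type} (a : ℂ) (D : ZH B) : ZH B :=
  relabel (Equiv.sumEmpty B Empty) (tensor D (H a Empty))

/-- A type of node: a diagram for each finite set of legs. -/
abbrev Spider : Type 1 := (L : Type) → [Finite L] → ZH L

/-- The diagram given by a finite multigraph: it has nodes `ι` of the types `node`, a wire from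
`src w` to `tgt w` for each `w : W`, and the open end `b : B` is a leg of the node `bdry b`.
The legs of a node `i` are all the ends that the node `i` owns. -/
def graph {ι B W : Type} [Finite ι] [Finite B] [Finite W] (node : ι → Spider)
    (bdry : B → ι) (src tgt : W → ι) : ZH B :=
  let owner : B ⊕ W × Bool → ι := Sum.elim bdry fun p => bif p.2 then tgt p.1 else src p.1
  net (fun i => node i {p // owner p = i}) (Equiv.sigmaFiberEquiv owner)

/-! ### Generators as nodes, and derived generators -/

/-- The white spider. -/
def zSp : Spider := fun L _ => Z L

/-- The H-box with label `a`. -/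
def hSp (a : ℂ) : Spider := fun L _ => H a L

/-- The grey spider: a white spider with an unlabelled H-box on each leg, and the scalar `1/2`. -/
noncomputable def xSp : Spider := fun L _ =>
  graph (ι := L ⊕ Bool) (W := L)
    (Sum.elim (fun _ => hSp (-1)) fun t => bif t then zSp else hSp (1 / 2))
    (fun l => Sum.inl l) (fun _ => Sum.inr true) (fun l => Sum.inl l)

/-- The grey spider labelled `¬`: as the grey spider, but an additional unlabelled H-box
is attached to the white spider in the middle. With two legs this is the NOT gate. -/
noncomputable def notSp : Spider := fun L _ =>
  graph (ι := L ⊕ Fin 3) (W := Option L)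
    (Sum.elim (fun _ => hSp (-1)) ![zSp, hSp (-1), hSp (1 / 2)])
    (fun l => Sum.inl l) (fun _ => Sum.inr 0)
    (fun w => w.elim (Sum.inr 1) fun l => Sum.inl l)

/-- The NOT gate. -/
noncomputable def notGate : ZH Bool := notSp Bool

/-- The exponentiated H-box, with complex label `α`. -/
noncomputable def expH (α : ℂ) : Spider := hSp (Complex.exp (Complex.I * α))

/-- The white phase spider: a white spider with an exponentiated H-box attached. -/
noncomputable def zPhase (α : ℂ) : Spider := fun L _ =>
  graph (ι := Bool) (W := Unit) (fun t => bif t then expH α else zSp)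
    (fun _ : L => false) (fun _ => false) (fun _ => true)

/-! ### The rules of the ZH-calculus -/

/-- The rules of the ZH-calculus, with their scalars. -/
inductive Rule : {B : Type} → ZH B → ZH B → Prop
  /-- White spiders that are joined by at least one wire fuse. -/
  | ZS1 {B W : Type} [Finite B] [Finite W] [Nonempty W] (s : B → Bool) :
      Rule (graph (fun _ => zSp) s (fun _ : W => false) (fun _ : W => true)) (Z B)
  /-- A white spider with two legs is a wire. -/
  | ZS2 : Rule (Z Bool) strand
  /-- H-boxes, one of them unlabelled, that are joined through an unlabelled H-box fuse. -/
  | HS1 {B : Type} [Finite B] (a : ℂ) (s : B → Bool) :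
      Rule
        (graph (ι := Fin 3) ![hSp a, hSp (-1), hSp (-1)] (fun b => bif s b then 2 else 0)
          (![0, 1] : Fin 2 → Fin 3) ![1, 2])
        (scale 2 (H a B))
  /-- Two unlabelled binary H-boxes cancel. -/
  | HS2 :
      Rule (graph (ι := Bool) (fun _ => hSp (-1)) id (fun _ : Unit => false) (fun _ => true))
        (scale 2 strand)
  /-- The bialgebra rule for grey and white spiders. -/
  | BA1 (M N : Type) [Finite M] [Finite N] :
      Rule
        (graph (ι := Bool) (fun t => bif t then zSp else xSp)
          (Sum.elim (fun _ : M => false) (fun _ : N => true))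
          (fun _ : Unit => false) (fun _ => true))
        (graph (Sum.elim (fun _ : M => zSp) (fun _ : N => xSp)) id
          (fun p : M × N => Sum.inl p.1) (fun p => Sum.inr p.2))
  /-- The bialgebra rule for H-boxes and white spiders. -/
  | BA2 (M N : Type) [Finite M] [Finite N] :
      Rule
        (graph (ι := Bool) (fun t => bif t then xSp else hSp (-1))
          (Sum.elim (fun _ : M => false) (fun _ : N => true))
          (fun _ : Unit => false) (fun _ => true))
        (graph (Sum.elim (fun _ : M => zSp) (fun _ : N => hSp (-1))) id
          (fun p : M × N => Sum.inl p.1) (fun p => Sum.inr p.2))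
  /-- Multiply. -/
  | M (a b : ℂ) :
      Rule
        (graph (ι := Fin 3) ![zSp, hSp a, hSp b] (fun _ : Unit => 0)
          (![0, 0] : Fin 2 → Fin 3) ![1, 2])
        (H (a * b) Unit)
  /-- Unit. -/
  | U : Rule (H 1 Unit) (Z Unit)
  /-- Intro: nodes `0`, `1` are the white spiders that carry the two open ends, the H-boxes
  `2` and `3` connect them, the latter through the NOT gate `4`. -/
  | I (a : ℂ) :
      Rule
        (graph (ι := Fin 2) ![hSp a, zSp] (id : Fin 2 → Fin 2)
          (Empty.elim : Empty → Fin 2) Empty.elim)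
        (graph (ι := Fin 5) ![zSp, zSp, hSp a, hSp a, notSp] (![0, 1] : Fin 2 → Fin 5)
          (![0, 1, 0, 1, 4] : Fin 5 → Fin 5) ![2, 2, 3, 4, 3])
  /-- Average: node `0` is the white spider that carries the open end; the H-boxes `1` and `2`
  are attached to it and are joined to each other through the NOT gate `3`. -/
  | A (a b : ℂ) :
      Rule
        (graph (ι := Fin 4) ![zSp, hSp a, hSp b, notSp] (fun _ : Unit => 0)
          (![0, 0, 1, 3] : Fin 4 → Fin 4) ![1, 2, 3, 2])
        (scale 2 (H ((a + b) / 2) Unit))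
  /-- Ortho: the unlabelled H-boxes `1` and `2` carry one open end each and are attached to the
  white spider `0`, the latter through the NOT gate `3`, so that at most one of them can be active;
  hence the white spider `4` which they share can be split in two. -/
  | O :
      Rule
        (graph (ι := Fin 5) ![zSp, hSp (-1), hSp (-1), notSp, zSp] (![0, 1, 2] : Fin 3 → Fin 5)
          (![0, 0, 3, 4, 4] : Fin 5 → Fin 5) ![1, 3, 2, 1, 2])
        (scale (1 / 2)
          (graph (ι := Fin 6) ![zSp, hSp (-1), hSp (-1), notSp, zSp, zSp]
            (![0, 1, 2] : Fin 3 → Fin 6)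
            (![0, 0, 3, 4, 5] : Fin 5 → Fin 6) ![1, 3, 2, 1, 2]))

/-! ### Equality in the ZH-calculus -/

/-- Renaming of wires, where the two ends of the wire `w` are exchanged if `s w = true`. -/
def rewire {W V : Type} (ω : W ≃ V) (s : W → Bool) : W × Bool ≃ V × Bool where
  toFun p := (ω p.1, xor (s p.1) p.2)
  invFun p := (ω.symm p.1, xor (s (ω.symm p.1)) p.2)
  left_inv := by rintro ⟨w, t⟩; simp
  right_inv := by rintro ⟨v, t⟩; simp

/-- The wiring of a network of networks, regarded as one network. -/
def flattenWiring {ι B W : Type} {L V κ : ι → Type} {K : (i : ι) → κ i → Type}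
    (e : (i : ι) → (Σ j, K i j) ≃ L i ⊕ V i × Bool) (f : (Σ i, L i) ≃ B ⊕ W × Bool) :
    (Σ p : (Σ i, κ i), K p.1 p.2) ≃ B ⊕ (W ⊕ Σ i, V i) × Bool :=
  calc (Σ p : (Σ i, κ i), K p.1 p.2)
    _ ≃ Σ i, Σ j, K i j := Equiv.sigmaAssoc K
    _ ≃ Σ i, (L i ⊕ V i × Bool) := Equiv.sigmaCongrRight e
    _ ≃ (Σ i, L i) ⊕ (Σ i, V i × Bool) := Equiv.sigmaSumDistrib _ _
    _ ≃ (B ⊕ W × Bool) ⊕ (Σ i, V i) × Bool :=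
        Equiv.sumCongr f (Equiv.sigmaProdDistrib V Bool).symm
    _ ≃ B ⊕ (W × Bool ⊕ (Σ i, V i) × Bool) := Equiv.sumAssoc _ _ _
    _ ≃ B ⊕ (W ⊕ Σ i, V i) × Bool :=
        Equiv.sumCongr (Equiv.refl B) (Equiv.sumProdDistrib _ _ _).symm

/-- Equality in the ZH-calculus: two diagrams are equal when one can be transformed into the other
by topological deformations and by the rules, applied to any part of a diagram. -/
inductive ZHEq : {B : Type} → ZH B → ZH B → Prop
  | rule {B : Type} {D E : ZH B} : Rule D E → ZHEq D E
  | refl {B : Type} (D : ZH B) : ZHEq D D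
  | symm {B : Type} {D E : ZH B} : ZHEq D E → ZHEq E D
  | trans {B : Type} {D E F : ZH B} : ZHEq D E → ZHEq E F → ZHEq D F
  /-- Parts of a diagram can be replaced by equal ones. -/
  | congr {ι B W : Type} {L : ι → Type} [Finite ι] [Finite W] {D E : (i : ι) → ZH (L i)}
      (e : (Σ i, L i) ≃ B ⊕ W × Bool) : (∀ i, ZHEq (D i) (E i)) → ZHEq (net D e) (net E e)
  /-- Deformation: a network consisting of just one diagram is this diagram. -/
  | single {B : Type} (D : ZH B) : ZHEq (relabel (Equiv.refl B) D) D
  /-- Deformation: a network of networks is a network. -/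
  | flatten {ι B W : Type} {L V κ : ι → Type} {K : (i : ι) → κ i → Type} [Finite ι] [Finite W]
      [∀ i, Finite (V i)] [∀ i, Finite (κ i)] (D : (i : ι) → (j : κ i) → ZH (K i j))
      (e : (i : ι) → (Σ j, K i j) ≃ L i ⊕ V i × Bool) (f : (Σ i, L i) ≃ B ⊕ W × Bool) :
      ZHEq (net (fun i => net (D i) (e i)) f)
        (net (fun p : (Σ i, κ i) => D p.1 p.2) (flattenWiring e f))
  /-- Deformation: the names of parts and of wires, and the directions of wires, are irrelevant. -/
  | reindex {ι κ B W V : Type} {L : κ → Type} [Finite ι] [Finite κ] [Finite W] [Finite V]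
      (D : (k : κ) → ZH (L k)) (e : (Σ k, L k) ≃ B ⊕ W × Bool) (σ : ι ≃ κ) (ω : W ≃ V)
      (s : W → Bool) :
      ZHEq (net D e)
        (net (fun i => D (σ i))
          ((Equiv.sigmaCongrLeft (β := L) σ).trans
            (e.trans (Equiv.sumCongr (Equiv.refl B) (rewire ω s)))))
  /-- Deformation: the legs of a white spider can be permuted. -/
  | legsZ {L K : Type} [Finite L] [Finite K] (g : L ≃ K) : ZHEq (relabel g (Z L)) (Z K)
  /-- Deformation: the legs of an H-box can be permuted. -/
  | legsH {L K : Type} [Finite L] [Finite K] (a : ℂ) (g : L ≃ K) :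
      ZHEq (relabel g (H a L)) (H a K)
  /-- Deformation: a piece of wire can be turned around. -/
  | turn : ZHEq (relabel Equiv.boolNot strand) strand
  /-- Deformation: a piece of wire attached to an open end can be shrunk. -/
  | yank {B : Type} (D : ZH (B ⊕ Unit)) : ZHEq (stack D idWire) D

/-- Equality in the ZH-calculus, where nonzero scalar factors are ignored. -/
def ZHEqUpToScalar {B : Type} (D E : ZH B) : Prop :=
  ∃ c : ℂ, c ≠ 0 ∧ ZHEq D (scale c E)

/-! ### The two diagrams of the Fourier transform -/

/-- The expression `(D)^x`: the identity for `x = 0`, and `D` for `x = 1`. -/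
def power (D : ZH Bool) (x : Bool) : ZH Bool := bif x then D else strand

/-- The indexing box with label `b`: a NOT gate on the `i`-th wire if `b i = 0`, a bare wire
otherwise. The ends of the `i`-th wire are `⟨i, false⟩` (bottom) and `⟨i, true⟩` (top). -/
noncomputable def indexingBox {n : ℕ} (b : Fin n → Bool) : ZH (Σ _ : Fin n, Bool) :=
  sideBySide fun i => power notGate (!b i)

/-- The piece that disconnects a white spider (at the end `false`) from a grey spider
(at the end `true`): a white and a grey spider with one leg each. -/
noncomputable def disconnectPiece : ZH Bool :=
  graph (ι := Bool) (fun t => bif t then xSp else zSp) id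
    (Empty.elim : Empty → Bool) Empty.elim

/-- The grey disconnect box with label `c`: a bare wire if `c i = 1`, disconnected otherwise. -/
noncomputable def disconnectBox {n : ℕ} (c : Fin n → Bool) : ZH (Σ _ : Fin n, Bool) :=
  sideBySide fun i => power disconnectPiece (!c i)

/-- The legs of the parts of `bangBox`: `n` white spiders, each with an open leg and one leg for
each `s : S`; and for each `s : S` a box with `n` wires through it, and a diagram with `n` legs. -/
def bangLegs (n : ℕ) (S : Type) : Fin n ⊕ (S ⊕ S) → Type
  | Sum.inl _ => Option S
  | Sum.inr (Sum.inl _) => Σ _ : Fin n, Bool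
  | Sum.inr (Sum.inr _) => Fin n

/-- The wiring of `bangBox`. The wire `((s, i), false)` joins the white spider `i` to the box `s`,
and the wire `((s, i), true)` joins the box `s` to the diagram `s`. -/
def bangWiring (n : ℕ) (S : Type) :
    (Σ j, bangLegs n S j) ≃ Fin n ⊕ ((S × Fin n) × Bool) × Bool where
  toFun
    | ⟨Sum.inl i, none⟩ => Sum.inl i
    | ⟨Sum.inl i, some s⟩ => Sum.inr (((s, i), false), false)
    | ⟨Sum.inr (Sum.inl s), ⟨i, t⟩⟩ => Sum.inr (((s, i), t), true)
    | ⟨Sum.inr (Sum.inr s), i⟩ => Sum.inr (((s, i), true), false)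
  invFun
    | Sum.inl i => ⟨Sum.inl i, none⟩
    | Sum.inr (((s, i), false), false) => ⟨Sum.inl i, some s⟩
    | Sum.inr (((s, i), t), true) => ⟨Sum.inr (Sum.inl s), ⟨i, t⟩⟩
    | Sum.inr (((s, i), true), false) => ⟨Sum.inr (Sum.inr s), i⟩
  left_inv := by
    rintro ⟨_ | _ | _, x⟩
    · cases x <;> rfl
    · obtain ⟨_, _ | _⟩ := x <;> rfl
    · rfl
  right_inv := by rintro (_ | ⟨⟨⟨_, _⟩, _ | _⟩, _ | _⟩) <;> rfl

/-- The diagram with `n` outputs, consisting of `n` white spiders with one output each, and of a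
!-box indexed by the finite set `S`: for each `s : S`, the diagram `top s` is connected to the `n`
white spiders through the box `box s`. -/
def bangBox {n : ℕ} {S : Type} [Finite S] (box : S → ZH (Σ _ : Fin n, Bool))
    (top : S → ZH (Fin n)) : ZH (Fin n) :=
  net (L := bangLegs n S)
    (fun
      | Sum.inl _ => Z (Option S)
      | Sum.inr (Sum.inl s) => box s
      | Sum.inr (Sum.inr s) => top s)
    (bangWiring n S)

/-- The phase gadget with label `α`, up to its connections: a grey spider joined to
a white phase spider with label `α`. -/
noncomputable def phaseGadget (n : ℕ) (α : ℂ) : ZH (Fin n) :=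
  graph (ι := Bool) (fun t => bif t then zPhase α else xSp)
    (fun _ : Fin n => false) (fun _ : Unit => false) (fun _ => true)

/-- The ZH normal form with exponentiated H-boxes with labels `α b`, for all bit-strings `b`. -/
noncomputable def expNormalForm {n : ℕ} (α : (Fin n → Bool) → ℂ) : ZH (Fin n) :=
  bangBox indexingBox fun b => expH (α b) (Fin n)

/-- The diagram of phase gadgets with labels `β c`, for all bit-strings `c`. -/
noncomputable def gadgetForm {n : ℕ} (β : (Fin n → Bool) → ℂ) : ZH (Fin n) :=
  bangBox disconnectBox fun c => phaseGadget n (β c)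

/-! ### The coefficients -/

/-- `b₁c₁ ⊕ ⋯ ⊕ bₙcₙ` -/
def Omega {n : ℕ} (b c : Fin n → Bool) : Bool :=
  (List.ofFn fun i => b i && c i).foldr Bool.xor false

/-- `(-1)^(b·c)` -/
def chi {n : ℕ} (b c : Fin n → Bool) : ℂ :=
  (-1) ^ ∑ i, (b i).toNat * (c i).toNat

/-- `α` is given by its Fourier coefficients `β`. -/
def IsFourierExpansion {n : ℕ} (α β : (Fin n → Bool) → ℂ) : Prop :=
  ∀ b, α b = ∑ c, β c * ((Omega b c).toNat : ℂ)

/-- `β` is the family of the Fourier coefficients of `α`. -/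
def IsFourierTransform {n : ℕ} (α β : (Fin n → Bool) → ℂ) : Prop :=
  ∀ c, β c = -1 / (2 : ℂ) ^ ((n : ℤ) - 1) * ∑ b, α b * chi b c

end ZHCalculus

namespace ZHCalculus
open ZH

/-! ### Diagrams modulo the calculus -/

/-! In the quotient by the calculus, a diagram with open ends `B` can be read as a function of
Boolean variables `B`: wires are summed variables, parts are factors. This reading is derived from
the rules and never appeals to matrices. White spider fusion, (ZS2) and the deformations suffice to
set it up: every network is `sm W (∏ ...)` (`net_eq`), the product identifies legs that carry the
same variable, a two-legged white spider is a Kronecker delta `dl`, and a sum over a delta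
substitutes (`sm_mul_dl`).

A diagram that can be copied and discarded along one of its legs is the graph of a function; it is a
`Term`, and terms can be substituted for variables by `ev`. Rule (BA1) makes the grey spider a term,
exclusive or. Rule (BA2) does the same for the Hadamard transform of the unlabelled H-box,
conjunction. The Hadamard transform is an involution up to the factor 2, by (HS2), so a term `t` is
determined by its character `eps t`, the function `(-1)^(y t)` with a new variable `y`. Characters
turn sums of terms into products, and with (HS1), (BA2), (M) and (U) they show that terms form a
commutative ring in which `t + t = 0`. Rule (O) gives the missing law `t * (t + 1) = 0`
(`mul_self_add`), so the ring is Boolean.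

An H-box with label `a` on a term `t` is `hh a t`, to be thought of as `a^t`. Rule (M) multiplies
labels (`hh_mul_hh`), rule (I) gives `a^t = a^(ts) a^(t(s+1))` (`hh_split`), and `a^0 = 1` for `a ≠
0` (`hh_zero`).

In this language the normal form is the product over `b` of `hh (exp (i α_b))` of the minterm of
`b`, since NOT is `x + 1`. The gadget diagram is the product over `c` of `hh (exp (i β_c))` of the
linear form `∑ c_i x_i`. Splitting along all variables multiplies the argument of a gadget by every
minterm, and the linear form times the minterm of `b` is that minterm or `0` according to `Omega b
c`. Collecting the factors of each minterm leaves the label `exp (i ∑_c β_c Ω(b,c))`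
(`prod_hh_linear`). A constant added to all `α_b` is a scalar, because the minterms also split the
H-box on the term `1` (`equal_of_expansion`).

The relations between the coefficients follow from `Ω = (1 - χ)/2` and orthogonality of characters.
In particular (2) gives (1) up to the constant `α_0`, which is absorbed in the scalar. -/

instance zhSetoid (B : Type) : Setoid (ZH B) :=
  ⟨ZHEq, ZHEq.refl, ZHEq.symm, ZHEq.trans⟩

/-- Diagrams modulo equality in the ZH-calculus. -/
abbrev Diag (B : Type) : Type 1 := Quotient (zhSetoid B)

/-- Networks of classes of diagrams. -/
noncomputable def netQ {ι B W : Type} {L : ι → Type} [Finite ι] [Finite W]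
    (q : (i : ι) → Diag (L i)) (e : (Σ i, L i) ≃ B ⊕ W × Bool) : Diag B :=
  ⟦net (fun i => (q i).out) e⟧

/-- By congruence, the choice of representatives made by `Quotient.out` does not matter. -/
theorem netQ_mk {ι B W : Type} {L : ι → Type} [Finite ι] [Finite W]
    (D : (i : ι) → ZH (L i)) (e : (Σ i, L i) ≃ B ⊕ W × Bool) :
    netQ (fun i => ⟦D i⟧) e = ⟦net D e⟧ :=
  Quotient.sound (ZHEq.congr e fun i => Quotient.exact (s := zhSetoid _) (Quotient.out_eq (Quotient.mk (zhSetoid _) (D i))))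

theorem netQ_flatten {ι B W : Type} {L V κ : ι → Type} {K : (i : ι) → κ i → Type} [Finite ι]
    [Finite W] [∀ i, Finite (V i)] [∀ i, Finite (κ i)] (q : (i : ι) → (j : κ i) → Diag (K i j))
    (e : (i : ι) → (Σ j, K i j) ≃ L i ⊕ V i × Bool) (f : (Σ i, L i) ≃ B ⊕ W × Bool) :
    netQ (fun i => netQ (q i) (e i)) f =
      netQ (fun p : (Σ i, κ i) => q p.1 p.2) (flattenWiring e f) := by
  have h := Quotient.sound (s := zhSetoid B)
    (ZHEq.flatten (fun i j => (q i j).out) e f)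
  rw [← netQ_mk, ← netQ_mk] at h
  simpa only [netQ, Quotient.out_eq] using h

/-- How the end of a part of a part of a network is wired up. -/
def combine {A B W V : Type} (f : A → B ⊕ W × Bool) : A ⊕ V × Bool → B ⊕ (W ⊕ V) × Bool :=
  Sum.elim (fun a => Sum.map id (Prod.map Sum.inl id) (f a)) fun p => Sum.inr (Sum.inr p.1, p.2)

/-- A pointwise formula for the chain of equivalences, so that equalities of flattened wirings can
be checked end by end. -/
theorem flattenWiring_apply {ι B W : Type} {L V κ : ι → Type} {K : (i : ι) → κ i → Type}
    (e : (i : ι) → (Σ j, K i j) ≃ L i ⊕ V i × Bool) (f : (Σ i, L i) ≃ B ⊕ W × Bool)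
    (i : ι) (j : κ i) (k : K i j) :
    flattenWiring e f ⟨⟨i, j⟩, k⟩ =
      combine (fun l => f ⟨i, l⟩) (Sum.map id (Prod.map (Sigma.mk (β := V) i) id) (e i ⟨j, k⟩)) := by
  change ((Equiv.refl B).sumCongr (Equiv.sumProdDistrib W (Σ i, V i) Bool).symm)
    (Equiv.sumAssoc B (W × Bool) ((Σ i, V i) × Bool)
      ((f.sumCongr (Equiv.sigmaProdDistrib V Bool).symm)
        (Equiv.sigmaSumDistrib L (fun i => V i × Bool) ⟨i, e i ⟨j, k⟩⟩))) = _
  rcases e i ⟨j, k⟩ with l | ⟨v, t⟩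
  · rcases hf : f ⟨i, l⟩ with b | ⟨w, t⟩ <;>
      simp [Equiv.sigmaSumDistrib, hf, combine]
  · simp [Equiv.sigmaSumDistrib, Equiv.sigmaProdDistrib, combine]

theorem netQ_reindex {ι κ B W V : Type} {L : κ → Type} [Finite ι] [Finite κ] [Finite W] [Finite V]
    (q : (k : κ) → Diag (L k)) (e : (Σ k, L k) ≃ B ⊕ W × Bool) (σ : ι ≃ κ) (ω : W ≃ V)
    (s : W → Bool) :
    netQ q e = netQ (fun i => q (σ i)) ((Equiv.sigmaCongrLeft (β := L) σ).trans
            (e.trans (Equiv.sumCongr (Equiv.refl B) (rewire ω s)))) :=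
  Quotient.sound (ZHEq.reindex (fun k => (q k).out) e σ ω s)

/-- Contraction: some of the open ends of a diagram are joined by wires. -/
noncomputable def tr {A B W : Type} [Finite W] (e : A ≃ B ⊕ W × Bool) (q : Diag A) : Diag B :=
  netQ (ι := Unit) (L := fun _ => A) (fun _ => q) ((Equiv.uniqueSigma fun _ : Unit => A).trans e)

/-- Renaming of the open ends. -/
noncomputable def renm {A B : Type} (g : A ≃ B) (q : Diag A) : Diag B :=
  tr (g.trans (Equiv.sumEmpty B (Empty × Bool)).symm) q

theorem renm_mk {A B : Type} (g : A ≃ B) (D : ZH A) : renm g ⟦D⟧ = ⟦relabel g D⟧ := netQ_mk _ _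

@[simp] theorem renm_refl {A : Type} (q : Diag A) : renm (Equiv.refl A) q = q := by
  induction q using Quotient.inductionOn with
  | h D => rw [renm_mk]; exact Quotient.sound (ZHEq.single D)

/-- Isomorphic networks are equal. Beyond `netQ_reindex`, the legs of the parts may be renamed by
`τ`: a renamed part is itself a network with one part, which flattening absorbs. -/
theorem netQ_iso {ι κ B W V : Type} {L : κ → Type} {M : ι → Type} [Finite ι] [Finite κ] [Finite W]
    [Finite V] {q : (k : κ) → Diag (L k)} {r : (i : ι) → Diag (M i)} {e : (Σ k, L k) ≃ B ⊕ W × Bool}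
    {f : (Σ i, M i) ≃ B ⊕ V × Bool} (σ : ι ≃ κ) (τ : (i : ι) → L (σ i) ≃ M i) (ω : W ≃ V)
    (s : W → Bool) (hq : ∀ i, r i = renm (τ i) (q (σ i)))
    (h : ∀ i l, f ⟨i, τ i l⟩ = Sum.map id (rewire ω s) (e ⟨σ i, l⟩)) : netQ q e = netQ r f := by
  obtain rfl : r = fun i => renm (τ i) (q (σ i)) := funext hq
  rw [netQ_reindex q e σ ω s]
  simp only [renm, tr]
  have : IsEmpty (Σ _ : ι, Empty) := ⟨fun p => p.2.elim⟩
  rw [netQ_flatten]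
  refine Eq.trans ?_ (netQ_reindex (L := fun p : (Σ _ : ι, Unit) => L (σ p.1))
    (fun p => q (σ p.1)) _ (Equiv.sigmaPUnit ι).symm (Equiv.sumEmpty V (Σ _ : ι, Empty))
    fun _ => false).symm
  congr 1
  ext ⟨i, l⟩ : 1
  change ((Equiv.refl B).sumCongr (rewire ω s)) (e ⟨σ i, l⟩) =
    ((Equiv.refl B).sumCongr (rewire (Equiv.sumEmpty V (Σ _ : ι, Empty)) fun _ => false))
      (flattenWiring (fun i => (Equiv.uniqueSigma fun _ : Unit => L (σ i)).trans
        ((τ i).trans (Equiv.sumEmpty (M i) (Empty × Bool)).symm)) f ⟨⟨i, ()⟩, l⟩)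
  have h' := h i l
  rw [flattenWiring_apply]
  simp only [Equiv.trans_apply, Equiv.uniqueSigma_apply, combine,
    Equiv.sumEmpty_symm_apply, Sum.map_inl, Sum.elim_inl, id, h']
  rcases e ⟨σ i, l⟩ with b | ⟨w, t⟩ <;> simp [rewire]

/-! ### Contraction and juxtaposition -/

/-- Diagrams placed side by side. -/
noncomputable def bigten {ι : Type} {L : ι → Type} [Finite ι] (q : (i : ι) → Diag (L i)) :
    Diag (Σ i, L i) :=
  netQ (W := Empty) q (Equiv.sumEmpty (Σ i, L i) (Empty × Bool)).symm

theorem bigten_mk {ι : Type} {L : ι → Type} [Finite ι] (D : (i : ι) → ZH (L i)) :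
    bigten (fun i => ⟦D i⟧) = ⟦sideBySide D⟧ := netQ_mk _ _

/-- Networks reduce to two operations, juxtaposition and contraction, which can then be studied
separately. -/
theorem netQ_eq_tr {ι B W : Type} {L : ι → Type} [Finite ι] [Finite W]
    (q : (i : ι) → Diag (L i)) (e : (Σ i, L i) ≃ B ⊕ W × Bool) : netQ q e = tr e (bigten q) := by
  rw [tr, bigten, netQ_flatten]
  have : IsEmpty (Σ _ : Unit, Empty) := ⟨fun p => p.2.elim⟩
  refine netQ_iso (Equiv.uniqueSigma fun _ : Unit => ι) (fun i => Equiv.refl (L i.2))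
    (Equiv.sumEmpty W (Σ _ : Unit, Empty)).symm (fun _ => false) (fun i => (renm_refl _).symm) ?_
  rintro ⟨⟨⟩, i⟩ l
  erw [flattenWiring_apply]
  change Sum.map id (Prod.map Sum.inl id) (e ⟨i, l⟩) = Sum.map id _ (e ⟨i, l⟩)
  rcases e ⟨i, l⟩ with b | ⟨w, t⟩ <;> simp [rewire]

/-- Successive contractions form one contraction. The resulting wiring `g` is left free up to
renaming and reversing wires, so that it can be given in whatever form is convenient. -/
theorem tr_tr {A B C W V U : Type} [Finite W] [Finite V] [Finite U] {e : B ≃ C ⊕ W × Bool}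
    {f : A ≃ B ⊕ V × Bool} {g : A ≃ C ⊕ U × Bool} (q : Diag A) (ω : W ⊕ V ≃ U) (s : W ⊕ V → Bool)
    (h : ∀ a, g a = Sum.map id (rewire ω s) (combine e (f a))) : tr e (tr f q) = tr g q := by
  rw [tr, tr, netQ_flatten]
  refine netQ_iso (Equiv.uniqueSigma fun _ : Unit => Unit).symm (fun i => Equiv.refl _)
    ((Equiv.sumCongr (Equiv.refl W) (Equiv.uniqueSigma fun _ : Unit => V)).trans ω)
    (fun x => s ((Equiv.sumCongr (Equiv.refl W) (Equiv.uniqueSigma fun _ : Unit => V)) x))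
    (fun i => (renm_refl _).symm) ?_
  rintro ⟨⟩ a
  have h' := h a
  erw [flattenWiring_apply]
  simp only [Equiv.trans_apply, Equiv.uniqueSigma_apply, combine] at h' ⊢
  change g a = _
  rw [h']
  rcases f a with b | ⟨w, t⟩
  · simp only [Sum.elim_inl, Sum.map_inl, id]
    rcases e b with b | ⟨w, t⟩ <;> simp [rewire]
  · have hw : (Equiv.uniqueSigma fun _ : Unit => V) ⟨(), w⟩ = w := rfl
    simp [rewire, hw]

theorem tr_congr {A B W V : Type} [Finite W] [Finite V] {e : A ≃ B ⊕ W × Bool}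
    {f : A ≃ B ⊕ V × Bool} (q : Diag A) (ω : W ≃ V) (s : W → Bool)
    (h : ∀ a, f a = Sum.map id (rewire ω s) (e a)) : tr e q = tr f q :=
  netQ_iso (Equiv.refl Unit) (fun _ => Equiv.refl A) ω s (fun _ => (renm_refl _).symm)
    fun _ a => h a

theorem tr_renm {A A' B W : Type} [Finite W] (e : A' ≃ B ⊕ W × Bool) (g : A ≃ A') (q : Diag A) :
    tr e (renm g q) = tr (g.trans e) q := by
  refine tr_tr q (Equiv.sumEmpty W Empty) (fun _ => false) fun a => ?_
  simp only [Equiv.trans_apply, combine, Equiv.sumEmpty_symm_apply, Sum.elim_inl]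
  rcases e (g a) with b | ⟨w, t⟩ <;> simp [rewire]

theorem renm_tr {A B C W : Type} [Finite W] (e : A ≃ B ⊕ W × Bool) (g : B ≃ C) (q : Diag A) :
    renm g (tr e q) = tr (e.trans (Equiv.sumCongr g (Equiv.refl _))) q := by
  refine tr_tr q (Equiv.emptySum Empty W) (fun _ => false) fun a => ?_
  simp only [Equiv.trans_apply, combine]
  rcases e a with b | ⟨w, t⟩ <;> simp [rewire]

theorem renm_renm {A B C : Type} (g : A ≃ B) (h : B ≃ C) (q : Diag A) :
    renm h (renm g q) = renm (g.trans h) q := tr_renm _ _ _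

theorem bigten_iso {ι κ : Type} {L : κ → Type} {M : ι → Type} [Finite ι] [Finite κ]
    {q : (k : κ) → Diag (L k)} {r : (i : ι) → Diag (M i)} (σ : ι ≃ κ)
    (τ : (i : ι) → L (σ i) ≃ M i) (E : (Σ k, L k) ≃ Σ i, M i)
    (hq : ∀ i, r i = renm (τ i) (q (σ i))) (h : ∀ i l, E ⟨σ i, l⟩ = ⟨i, τ i l⟩) :
    renm E (bigten q) = bigten r := by
  rw [renm, ← netQ_eq_tr]
  exact netQ_iso σ τ (Equiv.refl _) (fun _ => false) hq fun i l => by simp [h]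

theorem bigten_bigten {ι : Type} {κ : ι → Type} {K : (i : ι) → κ i → Type} [Finite ι]
    [∀ i, Finite (κ i)] (q : (i : ι) → (j : κ i) → Diag (K i j)) :
    bigten (fun i => bigten (q i)) =
      renm (Equiv.sigmaAssoc K) (bigten fun p : (Σ i, κ i) => q p.1 p.2) := by
  rw [renm, ← netQ_eq_tr]
  simp only [bigten]
  rw [netQ_flatten]
  have : IsEmpty (Σ _ : ι, Empty) := ⟨fun p => p.2.elim⟩
  refine netQ_iso (Equiv.refl _) (fun _ => Equiv.refl _) (Equiv.sumEmpty Empty (Σ _ : ι, Empty))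
    (fun _ => false) (fun i => (renm_refl _).symm) ?_
  exact fun _ _ => rfl

theorem bigten_tr {ι : Type} {A B W : ι → Type} [Finite ι] [∀ i, Finite (W i)]
    (e : (i : ι) → A i ≃ B i ⊕ W i × Bool) (q : (i : ι) → Diag (A i))
    (f : (Σ i, A i) ≃ (Σ i, B i) ⊕ (Σ i, W i) × Bool)
    (h : ∀ i a, f ⟨i, a⟩ = Sum.map (Sigma.mk i) (Prod.map (Sigma.mk i) id) (e i a)) :
    bigten (fun i => tr (e i) (q i)) = tr f (bigten q) := by
  rw [← netQ_eq_tr]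
  simp only [bigten, tr]
  rw [netQ_flatten]
  refine netQ_iso (Equiv.sigmaPUnit ι).symm (fun _ => Equiv.refl _) (Equiv.emptySum Empty _)
    (fun _ => false) (fun i => (renm_refl _).symm) ?_
  rintro i (l : A i)
  have h' := h i l
  change f ⟨i, l⟩ = Sum.map id _
    (flattenWiring (fun i => (Equiv.uniqueSigma fun _ : Unit => A i).trans (e i))
      (Equiv.sumEmpty (Σ i, B i) (Empty × Bool)).symm ⟨⟨i, ()⟩, l⟩)
  rw [flattenWiring_apply]
  simp only [Equiv.trans_apply, Equiv.uniqueSigma_apply, h', combine]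
  rcases e i l with b | ⟨w, t⟩ <;> simp [rewire]

theorem bigten_renm {ι : Type} {A B : ι → Type} [Finite ι]
    (e : (i : ι) → A i ≃ B i) (q : (i : ι) → Diag (A i)) :
    bigten (fun i => renm (e i) (q i)) = renm (Equiv.sigmaCongrRight e) (bigten q) :=
  (bigten_iso (Equiv.refl ι) e _ (fun _ => rfl) fun _ _ => rfl).symm

/-- The two-element family of classes of diagrams `q`, `r`. -/
def pairQ {A B : Type} (q : Diag A) (r : Diag B) : (t : Bool) → Diag (pairLegs A B t)
  | false => q
  | true => r

/-- The legs of a pair of diagrams. -/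
def pairE (A B : Type) : (Σ t, pairLegs A B t) ≃ A ⊕ B where
  toFun := fun
    | ⟨false, a⟩ => Sum.inl a
    | ⟨true, b⟩ => Sum.inr b
  invFun := fun
    | Sum.inl a => ⟨false, a⟩
    | Sum.inr b => ⟨true, b⟩
  left_inv := by rintro ⟨_ | _, _⟩ <;> rfl
  right_inv := by rintro (_ | _) <;> rfl

/-- Two diagrams side by side. -/
noncomputable def ten {A B : Type} (q : Diag A) (r : Diag B) : Diag (A ⊕ B) :=
  renm (pairE A B) (bigten (pairQ q r))

theorem pairQ_mk {A B : Type} (D : ZH A) (E : ZH B) :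
    pairQ ⟦D⟧ ⟦E⟧ = fun t => (⟦pair D E t⟧ : Diag _) := by
  funext t; cases t <;> rfl

theorem ten_mk {A B : Type} (D : ZH A) (E : ZH B) : ten ⟦D⟧ ⟦E⟧ = ⟦tensor D E⟧ := by
  rw [ten, pairQ_mk, renm, ← netQ_eq_tr, tensor, ← netQ_mk]
  refine netQ_iso (Equiv.refl _) (fun _ => Equiv.refl _) (Equiv.refl _) (fun _ => false)
    (fun i => (renm_refl _).symm) ?_
  rintro (_ | _) l <;> rfl

/-- The wiring of two diagrams side by side. -/
def shuffle (A V B W : Type) : (A ⊕ V × Bool) ⊕ (B ⊕ W × Bool) ≃ (A ⊕ B) ⊕ (V ⊕ W) × Bool where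
  toFun := fun
    | Sum.inl (Sum.inl a) => Sum.inl (Sum.inl a)
    | Sum.inl (Sum.inr (v, t)) => Sum.inr (Sum.inl v, t)
    | Sum.inr (Sum.inl b) => Sum.inl (Sum.inr b)
    | Sum.inr (Sum.inr (w, t)) => Sum.inr (Sum.inr w, t)
  invFun := fun
    | Sum.inl (Sum.inl a) => Sum.inl (Sum.inl a)
    | Sum.inr (Sum.inl v, t) => Sum.inl (Sum.inr (v, t))
    | Sum.inl (Sum.inr b) => Sum.inr (Sum.inl b)
    | Sum.inr (Sum.inr w, t) => Sum.inr (Sum.inr (w, t))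
  left_inv := by rintro ((_ | _) | (_ | _)) <;> rfl
  right_inv := by rintro ((_ | _) | ⟨_ | _, _⟩) <;> rfl

/-- The wiring of a network with one part, whose wiring is `e`. -/
def combineE {A B W : Type} (V : Type) (e : A ≃ B ⊕ W × Bool) :
    A ⊕ V × Bool ≃ B ⊕ (W ⊕ V) × Bool :=
  (Equiv.sumCongr e (Equiv.refl _)).trans
    ((Equiv.sumAssoc _ _ _).trans (Equiv.sumCongr (Equiv.refl _) (Equiv.sumProdDistrib _ _ _).symm))

theorem combineE_apply {A B W V : Type} (e : A ≃ B ⊕ W × Bool) (x : A ⊕ V × Bool) :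
    combineE V e x = combine e x := by
  rcases x with a | ⟨v, t⟩
  · rcases h : e a with b | ⟨w, t⟩ <;> simp [combineE, combine, h]
  · simp [combineE, combine]

theorem tr_tr' {A B C W V : Type} [Finite W] [Finite V] (e : B ≃ C ⊕ W × Bool)
    (f : A ≃ B ⊕ V × Bool) (q : Diag A) : tr e (tr f q) = tr (f.trans (combineE V e)) q :=
  tr_tr q (Equiv.refl _) (fun _ => false) fun a => by
    simp only [Equiv.trans_apply, combineE_apply]
    rcases combine e (f a) with b | ⟨w, t⟩ <;> simp [rewire]

instance {V W : Type} [Finite V] [Finite W] (t : Bool) : Finite (pairLegs V W t) := by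
  cases t <;> assumption

theorem ten_tr {A A' B B' V W : Type} [Finite V] [Finite W] (e : A ≃ A' ⊕ V × Bool)
    (f : B ≃ B' ⊕ W × Bool) (q : Diag A) (r : Diag B) :
    ten (tr e q) (tr f r) = tr ((Equiv.sumCongr e f).trans (shuffle _ _ _ _)) (ten q r) := by
  let E : (t : Bool) → pairLegs A B t ≃ pairLegs A' B' t ⊕ pairLegs V W t × Bool := fun
    | false => e
    | true => f
  have h : pairQ (tr e q) (tr f r) = fun t => tr (E t) (pairQ q r t) := by
    funext t; cases t <;> rfl
  rw [ten, h, bigten_tr E (pairQ q r) ((pairE A B).trans (((Equiv.sumCongr e f).trans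
    (shuffle _ _ _ _)).trans (Equiv.sumCongr (pairE A' B').symm
      (Equiv.prodCongr (pairE V W).symm (Equiv.refl _)))))]
  · rw [ten, renm_tr, tr_renm]
    refine tr_congr _ (pairE V W) (fun _ => false) ?_
    rintro ⟨_ | _, x⟩
    · change _ = Sum.map id _ (Sum.map (pairE A' B') id _)
      change shuffle _ _ _ _ (Sum.inl (e x)) = Sum.map id _ (Sum.map (pairE A' B') id
        (Sum.map (pairE A' B').symm (Prod.map (pairE V W).symm id)
          (shuffle _ _ _ _ (Sum.inl (e x)))))
      rcases e x with b | ⟨w, t⟩ <;> simp [shuffle, rewire]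
    · change shuffle _ _ _ _ (Sum.inr (f x)) = Sum.map id _ (Sum.map (pairE A' B') id
        (Sum.map (pairE A' B').symm (Prod.map (pairE V W).symm id)
          (shuffle _ _ _ _ (Sum.inr (f x)))))
      rcases f x with b | ⟨w, t⟩ <;> simp [shuffle, rewire]
  · rintro (_ | _) x
    · change (Sum.map (pairE A' B').symm (Prod.map (pairE V W).symm id)
          (shuffle _ _ _ _ (Sum.inl (e x)))) = Sum.map _ _ (e x)
      rcases e x with b | ⟨w, t⟩ <;> rfl
    · change (Sum.map (pairE A' B').symm (Prod.map (pairE V W).symm id)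
          (shuffle _ _ _ _ (Sum.inr (f x)))) = Sum.map _ _ (f x)
      rcases f x with b | ⟨w, t⟩ <;> rfl

theorem ten_renm {A A' B B' : Type} (e : A ≃ A') (f : B ≃ B') (q : Diag A) (r : Diag B) :
    ten (renm e q) (renm f r) = renm (Equiv.sumCongr e f) (ten q r) := by
  rw [renm, renm, ten_tr, renm]
  refine tr_congr _ (Equiv.sumEmpty Empty Empty) (fun _ => false) ?_
  rintro (_ | _) <;> simp [shuffle]

theorem ten_tr_left {A A' B V : Type} [Finite V] (e : A ≃ A' ⊕ V × Bool)
    (q : Diag A) (r : Diag B) :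
    ten (tr e q) r = tr ((Equiv.sumCongr e (Equiv.refl B)).trans
      ((Equiv.sumAssoc _ _ _).trans ((Equiv.sumCongr (Equiv.refl _) (Equiv.sumComm _ _)).trans
        (Equiv.sumAssoc _ _ _).symm))) (ten q r) := by
  conv_lhs => rw [← renm_refl r]
  rw [renm, ten_tr]
  refine tr_congr _ (Equiv.sumEmpty V Empty) (fun _ => false) ?_
  rintro (a | b)
  · rcases h : e a with x | ⟨w, t⟩ <;> simp [shuffle, rewire, h]
  · simp [shuffle]

theorem ten_tr_right {A B B' V : Type} [Finite V] (e : B ≃ B' ⊕ V × Bool)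
    (q : Diag A) (r : Diag B) :
    ten q (tr e r) = tr ((Equiv.sumCongr (Equiv.refl A) e).trans (Equiv.sumAssoc _ _ _).symm)
      (ten q r) := by
  conv_lhs => rw [← renm_refl q]
  rw [renm, ten_tr]
  refine tr_congr _ (Equiv.emptySum Empty V) (fun _ => false) ?_
  rintro (a | b)
  · simp [shuffle]
  · rcases h : e b with x | ⟨w, t⟩ <;> simp [shuffle, rewire, h]

/-- The disjoint union of two families of diagrams. -/
def sumFam {ι κ : Type} {L : ι → Type} {M : κ → Type} (q : (i : ι) → Diag (L i))
    (r : (j : κ) → Diag (M j)) : (x : ι ⊕ κ) → Diag (Sum.elim L M x)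
  | Sum.inl i => q i
  | Sum.inr j => r j

/-- The legs of the disjoint union of two families of diagrams. -/
def sumFamE {ι κ : Type} (L : ι → Type) (M : κ → Type) :
    (Σ x, Sum.elim L M x) ≃ (Σ i, L i) ⊕ Σ j, M j :=
  Equiv.sumSigmaDistrib (Sum.elim L M)

theorem ten_bigten {ι κ : Type} {L : ι → Type} {M : κ → Type} [Finite ι] [Finite κ]
    (q : (i : ι) → Diag (L i)) (r : (j : κ) → Diag (M j)) :
    ten (bigten q) (bigten r) =
      renm (sumFamE L M) (bigten (sumFam q r)) := by
  let K : (t : Bool) → pairLegs ι κ t → Type := fun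
    | false => L
    | true => M
  let F : (t : Bool) → (j : pairLegs ι κ t) → Diag (K t j) := fun
    | false => q
    | true => r
  let E : (Σ t, Σ j, K t j) ≃ Σ t, pairLegs (Σ i, L i) (Σ j, M j) t :=
    Equiv.sigmaCongrRight fun
      | false => Equiv.refl _
      | true => Equiv.refl _
  have h : renm E (bigten (fun t => bigten (F t))) = bigten (pairQ (bigten q) (bigten r)) :=
    bigten_iso (Equiv.refl _) (fun
      | false => Equiv.refl _
      | true => Equiv.refl _) _
      (by rintro (_ | _) <;> exact (renm_refl _).symm) (by rintro (_ | _) _ <;> rfl)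
  rw [ten, ← h, bigten_bigten, renm_renm, renm_renm]
  have h2 : renm (((Equiv.sigmaAssoc K).trans (E.trans (pairE _ _))).trans
      (sumFamE L M).symm)
      (bigten fun p : (Σ t, pairLegs ι κ t) => F p.1 p.2) = bigten (sumFam q r) :=
    bigten_iso (pairE ι κ).symm (fun
      | Sum.inl i => Equiv.refl (L i)
      | Sum.inr j => Equiv.refl (M j)) _
      (by rintro (_ | _) <;> exact (renm_refl _).symm) (by rintro (_ | _) _ <;> rfl)
  rw [← h2, renm_renm]
  congr 1
  ext x : 1
  simp only [Equiv.trans_apply, Equiv.apply_symm_apply]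

theorem bigten_unit {A : Type} (q : Diag A) :
    bigten (fun _ : Unit => q) = renm (Equiv.uniqueSigma fun _ : Unit => A).symm q := by
  rw [renm, tr]
  rfl

theorem ten_renm_left {A A' B : Type} (e : A ≃ A') (q : Diag A) (r : Diag B) :
    ten (renm e q) r = renm (Equiv.sumCongr e (Equiv.refl B)) (ten q r) := by
  conv_lhs => rw [← renm_refl r]
  exact ten_renm _ _ _ _

theorem ten_renm_right {A B B' : Type} (e : B ≃ B') (q : Diag A) (r : Diag B) :
    ten q (renm e r) = renm (Equiv.sumCongr (Equiv.refl A) e) (ten q r) := by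
  conv_lhs => rw [← renm_refl q]
  exact ten_renm _ _ _ _

theorem renm_inj {A B : Type} (e : A ≃ B) {q r : Diag A} (h : renm e q = renm e r) : q = r := by
  simpa [renm_renm] using congrArg (renm e.symm) h

theorem bigten_assoc {ι κ μ : Type} {L : ι → Type} {M : κ → Type} {N : μ → Type} [Finite ι]
    [Finite κ] [Finite μ] (q : (i : ι) → Diag (L i)) (r : (j : κ) → Diag (M j))
    (s : (k : μ) → Diag (N k)) :
    renm (Equiv.sumAssoc _ _ _) (ten (ten (bigten q) (bigten r)) (bigten s)) =
      ten (bigten q) (ten (bigten r) (bigten s)) := by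
  rw [ten_bigten, ten_bigten, ten_renm_left, ten_renm_right, ten_bigten, ten_bigten]
  simp only [renm_renm]
  refine renm_inj ((sumFamE L (Sum.elim M N)).trans (Equiv.sumCongr (Equiv.refl _)
    (sumFamE M N))).symm ?_
  rw [renm_renm, renm_renm, Equiv.self_trans_symm, renm_refl]
  refine bigten_iso (Equiv.sumAssoc ι κ μ).symm (fun
    | Sum.inl i => Equiv.refl (L i)
    | Sum.inr (Sum.inl j) => Equiv.refl (M j)
    | Sum.inr (Sum.inr k) => Equiv.refl (N k)) _ ?_ ?_
  · rintro (_ | _ | _) <;> exact (renm_refl _).symm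
  · rintro (_ | _ | _) _ <;> rfl

theorem ten_assoc {A B C : Type} (q : Diag A) (r : Diag B) (s : Diag C) :
    renm (Equiv.sumAssoc A B C) (ten (ten q r) s) = ten q (ten r s) := by
  have h := bigten_assoc (fun _ : Unit => q) (fun _ : Unit => r) (fun _ : Unit => s)
  simp only [bigten_unit, ten_renm, renm_renm] at h
  refine renm_inj (Equiv.sumCongr (Equiv.uniqueSigma fun _ : Unit => A)
    (Equiv.sumCongr (Equiv.uniqueSigma fun _ : Unit => B)
      (Equiv.uniqueSigma fun _ : Unit => C))).symm ?_
  rw [renm_renm]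
  refine Eq.trans ?_ (h.trans ?_) <;> congr 1 <;> ext x : 1
  rcases x with (_ | _) | _ <;> rfl

theorem ten_comm {A B : Type} (q : Diag A) (r : Diag B) :
    renm (Equiv.sumComm A B) (ten q r) = ten r q := by
  rw [ten, renm_renm]
  refine renm_inj (pairE B A).symm ?_
  rw [ten, renm_renm, renm_renm, Equiv.self_trans_symm, renm_refl]
  refine bigten_iso Equiv.boolNot (fun
    | false => Equiv.refl B
    | true => Equiv.refl A) _ ?_ ?_
  · rintro (_ | _) <;> exact (renm_refl _).symm
  · rintro (_ | _) _ <;> rfl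

/-- The empty diagram. -/
noncomputable def nil : Diag Empty :=
  renm (Equiv.equivEmpty _) (bigten (ι := Empty) (L := fun _ => Empty) fun i => i.elim)

theorem ten_nil {A : Type} (q : Diag A) : ten q nil = renm (Equiv.sumEmpty A Empty).symm q := by
  let r : (i : Empty) → Diag Empty := fun i => i.elim
  have h := ten_bigten (fun _ : Unit => q) r
  rw [bigten_unit, ten_renm_left] at h
  let E : A ⊕ Empty ≃ Σ x : Unit ⊕ Empty, Sum.elim (fun _ => A) (fun _ => Empty) x :=
    (Equiv.sumCongr (Equiv.uniqueSigma fun _ : Unit => A).symm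
      (Equiv.equivEmpty (Σ _ : Empty, Empty)).symm).trans
      (sumFamE (fun _ : Unit => A) (fun _ : Empty => Empty)).symm
  have h2 : renm (((Equiv.uniqueSigma fun _ : Unit => A).trans (Equiv.sumEmpty A Empty).symm).trans E)
      (bigten fun _ : Unit => q) = bigten (sumFam (fun _ : Unit => q) r) :=
    bigten_iso (Equiv.sumEmpty Unit Empty) (fun
      | Sum.inl _ => Equiv.refl A) _ (by rintro (_ | ⟨⟨⟩⟩); exact (renm_refl _).symm)
      (by rintro (_ | ⟨⟨⟩⟩) _; rfl)
  refine renm_inj E ?_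
  rw [nil, ten_renm_right, renm_renm, renm_renm]
  rw [bigten_unit, renm_renm] at h2
  refine Eq.trans ?_ (h2.symm.trans ?_)
  · refine renm_inj (sumFamE (fun _ : Unit => A) (fun _ : Empty => Empty)) ?_
    rw [← h, renm_renm]
    congr 1
    ext x : 1
    rcases x with _ | ⟨⟨⟩, _⟩
    rfl
  · congr 1

theorem bigten_ten {ι : Type} {L M : ι → Type} [Finite ι] (q : (i : ι) → Diag (L i))
    (r : (i : ι) → Diag (M i)) :
    bigten (fun i => ten (q i) (r i)) =
      renm (Equiv.sigmaSumDistrib L M).symm (ten (bigten q) (bigten r)) := by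
  simp only [ten]
  rw [bigten_renm, bigten_bigten]
  have h := ten_bigten q r
  rw [ten] at h
  rw [h, renm_renm, renm_renm]
  refine renm_inj ((sumFamE L M).trans (Equiv.sigmaSumDistrib L M).symm).symm ?_
  rw [renm_renm, renm_renm, Equiv.self_trans_symm, renm_refl]
  refine bigten_iso ((Equiv.boolProdEquivSum ι).symm.trans
    ((Equiv.prodComm _ _).trans (Equiv.sigmaEquivProd ι Bool).symm))
    (fun
    | Sum.inl i => Equiv.refl (L i)
    | Sum.inr j => Equiv.refl (M j)) _ ?_ ?_
  · rintro (_ | _) <;> exact (renm_refl _).symm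
  · rintro (_ | _) _ <;> rfl

/-! ### Families of white spiders -/

/-- The family of white spiders `V`, where the leg `p` belongs to the spider `g p`. -/
noncomputable def zfam {P V : Type} [Finite P] [Finite V] (g : P → V) : Diag P :=
  renm (Equiv.sigmaFiberEquiv g) (bigten fun v => ⟦Z {p // g p = v}⟧)

theorem renm_Z {L K : Type} [Finite L] [Finite K] (g : L ≃ K) :
    renm g (⟦Z L⟧ : Diag L) = ⟦Z K⟧ := by
  rw [renm_mk]; exact Quotient.sound (ZHEq.legsZ g)

theorem renm_H {L K : Type} [Finite L] [Finite K] (a : ℂ) (g : L ≃ K) :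
    renm g (⟦H a L⟧ : Diag L) = ⟦H a K⟧ := by
  rw [renm_mk]; exact Quotient.sound (ZHEq.legsH a g)

section
variable {P P' Q V V' U A B W : Type} [Finite P] [Finite P'] [Finite V] [Finite V'] [Finite U]
  [Finite Q] [Finite W]

theorem zfam_eq {M : V' → Type} [∀ v, Finite (M v)] (g : P → V) (σ : V ≃ V') (E : (Σ v, M v) ≃ P)
    (h : ∀ v m, σ (g (E ⟨v, m⟩)) = v) :
    renm E (bigten fun v => (⟦Z (M v)⟧ : Diag (M v))) = zfam g := by
  refine renm_inj (Equiv.sigmaFiberEquiv g).symm ?_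
  rw [zfam, renm_renm, renm_renm, Equiv.self_trans_symm, renm_refl]
  refine bigten_iso σ (fun v =>
    { toFun := fun m => ⟨E ⟨σ v, m⟩, σ.injective (h _ m)⟩
      -- By `h`, an end lies in the fibre over `v` exactly when its index under `E` is `σ v`; the
      -- cast moves it to that index.
      invFun := fun p => cast (by
        have := h (E.symm p.1).1 (E.symm p.1).2
        rw [Sigma.eta, E.apply_symm_apply, p.2] at this
        rw [this]) (E.symm p.1).2
      left_inv := fun m => by
        apply eq_of_heq
        exact (cast_heq _ _).trans (Sigma.ext_iff.1 (E.symm_apply_apply ⟨σ v, m⟩)).2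
      right_inv := fun p => by
        apply Subtype.ext
        have := h (E.symm p.1).1 (E.symm p.1).2
        rw [Sigma.eta, E.apply_symm_apply, p.2] at this
        apply E.symm.injective
        rw [Equiv.symm_apply_apply]
        refine Sigma.ext this (cast_heq _ _) }) _ (fun v => (renm_Z _).symm) ?_
  intro v m
  rw [Equiv.trans_apply, Equiv.symm_apply_eq]
  rfl

theorem zfam_renm {g : P → V} {g' : P' → V} (τ : P ≃ P') (h : ∀ p, g' (τ p) = g p) :
    renm τ (zfam g) = zfam g' := by
  rw [zfam, renm_renm]
  refine zfam_eq g' (Equiv.refl _) _ ?_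
  rintro v ⟨p, hp⟩
  exact (h p).trans hp

theorem zfam_equiv (g : P → V) (σ : V ≃ V') : zfam (fun p => σ (g p)) = zfam g := by
  refine zfam_eq g σ _ ?_
  rintro v ⟨p, hp⟩
  exact hp

theorem zfam_bigten {ι : Type} {P V : ι → Type} [Finite ι] [∀ i, Finite (P i)]
    [∀ i, Finite (V i)] (g : (i : ι) → P i → V i) :
    bigten (fun i => zfam (g i)) = zfam (fun p : Σ i, P i => (⟨p.1, g p.1 p.2⟩ : Σ i, V i)) := by
  simp only [zfam]
  rw [bigten_renm, bigten_bigten, renm_renm]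
  refine zfam_eq (V := Σ i, V i) (V' := Σ i, V i)
    (fun p : Σ i, P i => (⟨p.1, g p.1 p.2⟩ : Σ i, V i)) (Equiv.refl _) _ ?_
  rintro ⟨i, v⟩ ⟨p, hp⟩
  exact Sigma.ext rfl (heq_of_eq hp)

theorem zfam_ten (g : P → V) (g' : P' → V') : ten (zfam g) (zfam g') = zfam (Sum.map g g') := by
  let G : (t : Bool) → pairLegs P P' t → pairLegs V V' t := fun
    | false => g
    | true => g'
  have h : pairQ (zfam g) (zfam g') = fun t => zfam (G t) := by
    funext t; cases t <;> rfl
  rw [ten, h, zfam_bigten, ← zfam_equiv _ (pairE V V')]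
  refine zfam_renm _ ?_
  rintro ⟨_ | _, p⟩ <;> rfl

theorem zfam_unique [Unique V] (g : P → V) : zfam g = ⟦Z P⟧ := by
  rw [← zfam_eq (M := fun _ : Unit => P) g (Equiv.ofUnique V Unit)
    (Equiv.uniqueSigma fun _ : Unit => P) (fun _ _ => rfl), bigten_unit, renm_renm,
    Equiv.symm_trans_self, renm_refl]

/-- When every wire stays within a fibre of `f`, the network is a juxtaposition of its fibres, so it
is enough to fuse each fibre to one spider. -/
theorem zfam_fuse_local (f : V → V') (g : P ⊕ U × Bool → V)
    (hU : ∀ u, f (g (Sum.inr (u, true))) = f (g (Sum.inr (u, false))))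
    (hl : ∀ v', tr (Equiv.refl _) (zfam (P := {p // f (g (Sum.inl p)) = v'} ⊕
        {u // f (g (Sum.inr (u, false))) = v'} × Bool) (V := {v // f v = v'})
      (Sum.elim (fun p => ⟨g (Sum.inl p), p.2⟩)
        fun u => ⟨g (Sum.inr (u.1, u.2)), by
          obtain ⟨⟨u, hu⟩, _ | _⟩ := u
          · exact hu
          · exact (hU u).trans hu⟩)) = ⟦Z _⟧) :
    tr (Equiv.refl _) (zfam g) = zfam fun p => f (g (Sum.inl p)) := by
  conv_rhs => rw [zfam]
  simp only [← hl]
  let F : (Σ v', {p // f (g (Sum.inl p)) = v'} ⊕ {u // f (g (Sum.inr (u, false))) = v'} × Bool) ≃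
      (Σ v', {p // f (g (Sum.inl p)) = v'}) ⊕
        (Σ v', {u // f (g (Sum.inr (u, false))) = v'}) × Bool :=
    (Equiv.sigmaSumDistrib _ _).trans (Equiv.sumCongr (Equiv.refl _)
      (Equiv.sigmaProdDistrib _ _).symm)
  rw [bigten_tr _ _ F, renm_tr, zfam_bigten, ← zfam_equiv _ (Equiv.sigmaFiberEquiv f)]
  · rw [← zfam_renm (g := g) (F.trans (Equiv.sumCongr (Equiv.sigmaFiberEquiv _)
      (Equiv.prodCongr (Equiv.sigmaFiberEquiv _) (Equiv.refl _)))).symm, tr_renm]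
    · refine tr_congr _ (Equiv.sigmaFiberEquiv _).symm (fun _ => false) ?_
      rintro (p | ⟨u, _ | _⟩) <;> rfl
    · intro p
      obtain ⟨x, rfl⟩ := (F.trans (Equiv.sumCongr (Equiv.sigmaFiberEquiv _)
        (Equiv.prodCongr (Equiv.sigmaFiberEquiv _) (Equiv.refl _)))).surjective p
      rw [Equiv.symm_apply_apply]
      obtain ⟨v', x | ⟨u, t⟩⟩ := x <;> rfl
  · rintro v' (p | ⟨u, t⟩) <;> rfl

theorem ZS1_eq [Nonempty W] (s : P → Bool) :
    tr (Equiv.refl _) (zfam (Sum.elim s fun p : W × Bool => p.2)) = ⟦Z P⟧ := by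
  have h := Quotient.sound (s := zhSetoid P) (ZHEq.rule (Rule.ZS1 (W := W) s))
  rw [← h, graph, ← netQ_mk, netQ_eq_tr, zfam, tr_renm]
  have : (Sum.elim s fun p : W × Bool => p.2) =
      Sum.elim s fun p : W × Bool => bif p.2 then true else false := by
    funext x; rcases x with _ | ⟨_, _ | _⟩ <;> rfl
  rw [this]
  rfl

theorem zfam_fuse_one (c : V') (g : P ⊕ Unit × Bool → Option V')
    (h0 : g (Sum.inr ((), false)) = none) (h1 : g (Sum.inr ((), true)) = some c) :
    tr (Equiv.refl _) (zfam g) = zfam fun p => (g (Sum.inl p)).getD c := by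
  refine zfam_fuse_local (fun x => x.getD c) g (by rintro ⟨⟩; simp [h0, h1]) ?_
  intro v'
  -- The fibre over `c` consists of two spiders and the wire between them, to which (ZS1) applies;
  -- every other fibre is a single spider without wires.
  by_cases hv : v' = c
  · subst hv
    let σ : {v : Option V' // v.getD v' = v'} ≃ Bool :=
      { toFun := fun v => v.1.isSome
        invFun := fun t => if t then ⟨some v', rfl⟩ else ⟨none, rfl⟩
        left_inv := by 
          rintro ⟨_ | v, hv⟩
          · rfl
          · obtain rfl : v = v' := hv
            rfl
        right_inv := by rintro (_ | _) <;> rfl }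
    have : Nonempty {u : Unit // (g (Sum.inr (u, false))).getD v' = v'} := ⟨⟨(), by simp [h0]⟩⟩
    rw [← zfam_equiv _ σ, ← ZS1_eq (W := {u : Unit // (g (Sum.inr (u, false))).getD v' = v'})
      fun p : {p // (g (Sum.inl p)).getD v' = v'} => σ ⟨g (Sum.inl p.1), p.2⟩]
    congr 2
    funext x
    rcases x with x | ⟨⟨⟨⟩, _⟩, _ | _⟩
    · rfl
    · simp [σ, h0]
    · simp [σ, h1]
  · have : IsEmpty {u : Unit // (g (Sum.inr (u, false))).getD c = v'} :=
      ⟨fun u => hv (by simpa [h0] using u.2.symm)⟩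
    let _ : Unique {v : Option V' // v.getD c = v'} :=
      { default := ⟨some v', rfl⟩
        uniq := by
          rintro ⟨_ | v, h⟩
          · exact absurd h.symm hv
          · exact Subtype.ext (congrArg some h) }
    rw [zfam_unique, ← renm_Z (Equiv.sumEmpty {p // (g (Sum.inl p)).getD c = v'}
      ({u : Unit // (g (Sum.inr (u, false))).getD c = v'} × Bool)), renm]
    refine tr_congr _ (Equiv.equivEmpty _) (fun _ => false) ?_
    rintro (x | ⟨u, _⟩)
    · rfl
    · exact isEmptyElim u

/-- The spiders `U` hang by one wire each on the spiders `V'`, so there are no loops and they can be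
absorbed one at a time, by induction on `U`. -/
theorem zfam_star (h : U → V') (g : P ⊕ U × Bool → V' ⊕ U)
    (h0 : ∀ u, g (Sum.inr (u, false)) = Sum.inr u)
    (h1 : ∀ u, g (Sum.inr (u, true)) = Sum.inl (h u)) :
    tr (Equiv.refl _) (zfam g) = zfam fun p => Sum.elim id h (g (Sum.inl p)) := by
  revert P
  revert h
  refine Finite.induction_empty_option (P := fun U => ∀ [Finite U] (h : U → V') {P : Type} [Finite P]
    (g : P ⊕ U × Bool → V' ⊕ U) (_ : ∀ u, g (Sum.inr (u, false)) = Sum.inr u)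
    (_ : ∀ u, g (Sum.inr (u, true)) = Sum.inl (h u)),
    tr (Equiv.refl _) (zfam g) = zfam fun p => Sum.elim id h (g (Sum.inl p))) ?_ ?_ ?_ U
  · intro U₁ U₂ k ih _ h P _ g h0 h1
    have : Finite U₁ := Finite.of_equiv _ k.symm
    have := ih (fun u => h (k u)) (fun x => Sum.map id k.symm (g (Sum.map id (Prod.map k id) x)))
      (by simp [h0]) (by simp [h1])
    simp only [Sum.map_inl, id] at this
    have h2 : (fun p => Sum.elim id h (g (Sum.inl p))) =
        fun p => Sum.elim id (fun u => h (k u)) (Sum.map id k.symm (g (Sum.inl p))) := by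
      funext p
      rcases g (Sum.inl p) with x | x <;> simp
    rw [h2, ← this, ← zfam_equiv g (Equiv.sumCongr (Equiv.refl _) k.symm),
      ← zfam_renm (Equiv.sumCongr (Equiv.refl P) (Equiv.prodCongr k (Equiv.refl Bool)))
        (fun _ => rfl), tr_renm]
    refine tr_congr _ k.symm (fun _ => false) ?_
    rintro (p | ⟨u, t⟩) <;> simp [rewire]
  · intro _ h P _ g _ _
    have h2 : g = fun p => Sum.inl (Sum.elim id h (g p)) := by
      funext p
      rcases g p with x | ⟨⟨⟩⟩
      rfl
    rw [← zfam_equiv (fun p => Sum.elim id h (g (Sum.inl p))) (Equiv.sumEmpty V' PEmpty).symm,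
      ← zfam_renm (g := g) (Equiv.sumEmpty P (PEmpty × Bool)), renm]
    · refine tr_congr _ (Equiv.equivEmpty PEmpty) (fun _ => false) ?_
      rintro (x | ⟨⟨⟩, _⟩)
      rfl
    · rintro (x | ⟨⟨⟩, _⟩)
      conv_rhs => rw [h2]
      rfl
  · intro U _ ih _ h P _ g h0 h1
    let σ : V' ⊕ Option U ≃ Option (V' ⊕ U) :=
      { toFun := Sum.elim (fun v => some (Sum.inl v)) fun u => u.map Sum.inr
        invFun := fun x => x.elim (Sum.inr none) (Sum.map id some)
        left_inv := by rintro (_ | _ | _) <;> rfl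
        right_inv := by rintro (_ | _ | _) <;> rfl }
    let E : P ⊕ Option U × Bool ≃ (P ⊕ U × Bool) ⊕ Unit × Bool :=
      { toFun := fun
          | Sum.inl p => Sum.inl (Sum.inl p)
          | Sum.inr (some u, t) => Sum.inl (Sum.inr (u, t))
          | Sum.inr (none, t) => Sum.inr ((), t)
        invFun := fun
          | Sum.inl (Sum.inl p) => Sum.inl p
          | Sum.inl (Sum.inr (u, t)) => Sum.inr (some u, t)
          | Sum.inr ((), t) => Sum.inr (none, t)
        left_inv := by rintro (_ | ⟨_ | _, _⟩) <;> rfl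
        right_inv := by rintro ((_ | _) | _) <;> rfl }
    have hone := zfam_fuse_one (Sum.inl (h none)) (fun x => σ (g (E.symm x)))
      (by simp [E, h0, σ]) (by simp [E, h1, σ])
    have hrec := ih (fun u => h (some u)) (fun x => (σ (g (E.symm (Sum.inl x)))).getD (Sum.inl (h none)))
      (by simp [E, h0, σ]) (by simp [E, h1, σ])
    have h2 : (fun p => Sum.elim id h (g (Sum.inl p))) = fun p => Sum.elim id (fun u => h (some u))
        ((σ (g (E.symm (Sum.inl (Sum.inl p))))).getD (Sum.inl (h none))) := by
      funext p
      change _ = Sum.elim id (fun u => h (some u)) ((σ (g (Sum.inl p))).getD (Sum.inl (h none)))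
      rcases g (Sum.inl p) with x | _ | x <;> rfl
    rw [h2, ← hrec, ← hone, zfam_equiv, ← zfam_renm (g := g) E (by simp), tr_renm, tr_tr']
    refine tr_congr _ ((Equiv.optionEquivSumPUnit U)) (fun _ => false) ?_
    rintro (p | ⟨_ | u, _ | _⟩) <;> rfl

end

/-! ### Contractions of a diagram with white spiders -/

/-- The diagram `r` next to a family of white spiders, with some of the ends joined by wires. -/
noncomputable def TZ {A P V B W : Type} [Finite P] [Finite V] [Finite W] (r : Diag A) (g : P → V)
    (e : A ⊕ P ≃ B ⊕ W × Bool) : Diag B :=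
  tr e (ten r (zfam g))

section
variable {A A' B C P P' V V' U W W' : Type} [Finite P] [Finite P'] [Finite V] [Finite V']
  [Finite U] [Finite W] [Finite W']

theorem TZ_iso {r : Diag A} {g : P → V} {g' : P' → V'} {e : A ⊕ P ≃ B ⊕ W × Bool}
    {e' : A ⊕ P' ≃ B ⊕ W' × Bool} (τ : P ≃ P') (σ : V ≃ V') (ω : W ≃ W') (s : W → Bool)
    (hg : ∀ p, g' (τ p) = σ (g p))
    (he : ∀ x, e' (Sum.map id τ x) = Sum.map id (rewire ω s) (e x)) :
    TZ r g e = TZ r g' e' := by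
  rw [TZ, TZ, ← zfam_renm τ hg, zfam_equiv, ten_renm_right, tr_renm]
  exact tr_congr _ ω s he

theorem renm_TZ (r : Diag A) (g : P → V) (e : A ⊕ P ≃ B ⊕ W × Bool) (k : B ≃ C) :
    renm k (TZ r g e) = TZ r g (e.trans (Equiv.sumCongr k (Equiv.refl _))) :=
  renm_tr _ _ _

theorem TZ_renm (k : A ≃ A') (r : Diag A) (g : P → V) (e : A' ⊕ P ≃ B ⊕ W × Bool) :
    TZ (renm k r) g e = TZ r g ((Equiv.sumCongr k (Equiv.refl P)).trans e) := by
  rw [TZ, TZ, ten_renm_left, tr_renm]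

theorem tr_TZ (r : Diag A) (g : P → V) (e : A ⊕ P ≃ B ⊕ W × Bool) (e' : B ≃ C ⊕ W' × Bool) :
    tr e' (TZ r g e) = TZ r g (e.trans (combineE W e')) :=
  tr_tr' _ _ _

theorem TZ_zfam (r : Diag A) (k : P' → V') (g : P → V) (e : (A ⊕ P') ⊕ P ≃ B ⊕ W × Bool) :
    TZ (ten r (zfam k)) g e = TZ r (Sum.map k g) ((Equiv.sumAssoc A P' P).symm.trans e) := by
  rw [TZ, TZ, ← zfam_ten, ← ten_assoc, tr_renm]
  congr 1
  ext x : 1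
  simp

theorem TZ_TZ (r : Diag A) (g : P → V) (e : A ⊕ P ≃ B ⊕ W × Bool) (g' : P' → V')
    (e' : B ⊕ P' ≃ C ⊕ W' × Bool) :
    TZ (TZ r g e) g' e' = TZ r (Sum.map g g')
      ((Equiv.sumAssoc A P P').symm.trans (((Equiv.sumCongr e (Equiv.refl P')).trans
      ((Equiv.sumAssoc _ _ _).trans ((Equiv.sumCongr (Equiv.refl _) (Equiv.sumComm _ _)).trans
        (Equiv.sumAssoc _ _ _).symm))).trans (combineE W e'))) := by
  rw [TZ, TZ, ten_tr_left, tr_tr', TZ, ← zfam_ten, ← ten_assoc, tr_renm]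
  congr 1
  ext x : 1
  simp

/-- The form in which fusion is applied below. `τ`, `σ` and `ω` single out the wires `U` to be
contracted and the spiders `U` to be absorbed; what remains is bookkeeping by cases. -/
theorem TZ_star {Q Vb Wb : Type} [Finite Q] [Finite Vb] [Finite Wb] {r : Diag A} {G : Q → Vb}
    {E : A ⊕ Q ≃ B ⊕ Wb × Bool} {G' : P → V'} {e : A ⊕ P ≃ B ⊕ W × Bool} (τ : Q ≃ P ⊕ U × Bool)
    (σ : Vb ≃ V' ⊕ U) (ω : Wb ≃ W ⊕ U) (s : Wb → Bool) (h : U → V')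
    (h0 : ∀ u, σ (G (τ.symm (Sum.inr (u, false)))) = Sum.inr u)
    (h1 : ∀ u, σ (G (τ.symm (Sum.inr (u, true)))) = Sum.inl (h u))
    (hG : ∀ p, G' p = Sum.elim id h (σ (G (τ.symm (Sum.inl p)))))
    (he : ∀ x, combineE U e ((Equiv.sumAssoc A P (U × Bool)).symm (Sum.map id τ x)) =
      Sum.map id (rewire ω s) (E x)) :
    TZ r G E = TZ r G' e := by
  have h2 : TZ r G E = TZ r (fun x => σ (G (τ.symm x)))
      ((Equiv.sumAssoc A P (U × Bool)).symm.trans (combineE U e)) :=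
    TZ_iso τ σ ω s (by simp) he
  rw [h2, show G' = _ from funext hG, TZ, TZ,
    ← zfam_star h (fun x => σ (G (τ.symm x))) h0 h1, ten_tr_right, tr_tr']
  congr 1
  ext x : 1
  simp

theorem tr_zfam_star {Q Vb Wb : Type} [Finite Q] [Finite Vb] [Finite Wb] {G : Q → Vb}
    {E : Q ≃ B ⊕ Wb × Bool} {G' : P → V'} {e : P ≃ B ⊕ W × Bool} (τ : Q ≃ P ⊕ U × Bool)
    (σ : Vb ≃ V' ⊕ U) (ω : Wb ≃ W ⊕ U) (s : Wb → Bool) (h : U → V')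
    (h0 : ∀ u, σ (G (τ.symm (Sum.inr (u, false)))) = Sum.inr u)
    (h1 : ∀ u, σ (G (τ.symm (Sum.inr (u, true)))) = Sum.inl (h u))
    (hG : ∀ p, G' p = Sum.elim id h (σ (G (τ.symm (Sum.inl p)))))
    (he : ∀ x, combineE U e (τ x) = Sum.map id (rewire ω s) (E x)) :
    tr E (zfam G) = tr e (zfam G') := by
  rw [show G' = _ from funext hG, ← zfam_star h (fun x => σ (G (τ.symm x))) h0 h1, tr_tr',
    ← zfam_equiv G σ, ← zfam_renm (g := fun p => σ (G p)) τ (by simp), tr_renm]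
  exact tr_congr _ ω s he

/-- The wiring of `Pc`. -/
def pcE (A B : Type) : A ⊕ (B ⊕ A) ≃ B ⊕ A × Bool where
  toFun := fun
    | Sum.inl a => Sum.inr (a, false)
    | Sum.inr (Sum.inl b) => Sum.inl b
    | Sum.inr (Sum.inr a) => Sum.inr (a, true)
  invFun := fun
    | Sum.inr (a, false) => Sum.inl a
    | Sum.inl b => Sum.inr (Sum.inl b)
    | Sum.inr (a, true) => Sum.inr (Sum.inr a)
  left_inv := by rintro (_ | _ | _) <;> rfl
  right_inv := by rintro (_ | ⟨_, _ | _⟩) <;> rfl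

/-- The diagram which has a white spider for each `x : X`, with the leg `a` of `r` attached to the
spider `att a`, and an open end `b` at the spider `bd b`. -/
noncomputable def Pc {A B X : Type} [Finite A] [Finite B] [Finite X] (bd : B → X) (att : A → X)
    (r : Diag A) : Diag B :=
  TZ r (Sum.elim bd att) (pcE A B)

end

/-! ### Diagrams with their legs attached to white spiders. -/

section
variable {A A' B B' K X X' : Type} [Finite A] [Finite A'] [Finite B] [Finite B'] [Finite K]
  [Finite X] [Finite X']

theorem Pc_equiv (σ : X ≃ X') (bd : B → X) (att : A → X) (r : Diag A) :
    Pc (fun b => σ (bd b)) (fun a => σ (att a)) r = Pc bd att r :=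
  (TZ_iso (Equiv.refl _) σ (Equiv.refl _) (fun _ => false)
    (by rintro (_ | _) <;> rfl) (by rintro (_ | _ | _) <;> rfl)).symm

theorem Pc_renm (k : A ≃ A') (bd : B → X) (att : A' → X) (r : Diag A) :
    Pc bd att (renm k r) = Pc bd (fun a => att (k a)) r := by
  rw [Pc, TZ_renm]
  exact TZ_iso (Equiv.sumCongr (Equiv.refl _) k.symm) (Equiv.refl _) k.symm (fun _ => false)
    (by rintro (_ | _) <;> simp) (by rintro (_ | _ | _) <;> simp [rewire, pcE])

theorem renm_Pc (k : B ≃ B') (bd : B → X) (att : A → X) (r : Diag A) :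
    renm k (Pc bd att r) = Pc (fun b => bd (k.symm b)) att r := by
  rw [Pc, renm_TZ]
  exact TZ_iso (Equiv.sumCongr k (Equiv.refl _)) (Equiv.refl _) (Equiv.refl _) (fun _ => false)
    (by rintro (_ | _) <;> simp) (by rintro (_ | _ | _) <;> simp [rewire, pcE])

/-- The inner spider of each `a` carries one open end and is absorbed by the outer spider `att a`.
The inner spiders `K` have no open end and survive. -/
theorem Pc_nest (bd : B → X) (att : A → X) (att' : A' → A ⊕ K) (r : Diag A') :
    Pc bd att (Pc Sum.inl att' r) =
      Pc (fun b => (Sum.inl (bd b) : X ⊕ K)) (fun a => Sum.map att id (att' a)) r := by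
  rw [Pc, Pc, TZ_TZ]
  let τ : (A ⊕ A') ⊕ (B ⊕ A) ≃ (B ⊕ A') ⊕ A × Bool :=
    { toFun := fun
        | Sum.inl (Sum.inl a) => Sum.inr (a, false)
        | Sum.inl (Sum.inr a) => Sum.inl (Sum.inr a)
        | Sum.inr (Sum.inl b) => Sum.inl (Sum.inl b)
        | Sum.inr (Sum.inr a) => Sum.inr (a, true)
      invFun := fun
        | Sum.inr (a, false) => Sum.inl (Sum.inl a)
        | Sum.inl (Sum.inr a) => Sum.inl (Sum.inr a)
        | Sum.inl (Sum.inl b) => Sum.inr (Sum.inl b)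
        | Sum.inr (a, true) => Sum.inr (Sum.inr a)
      left_inv := by rintro ((_ | _) | (_ | _)) <;> rfl
      right_inv := by rintro ((_ | _) | ⟨_, _ | _⟩) <;> rfl }
  let σ : (A ⊕ K) ⊕ X ≃ (X ⊕ K) ⊕ A :=
    { toFun := fun
        | Sum.inl (Sum.inl a) => Sum.inr a
        | Sum.inl (Sum.inr k) => Sum.inl (Sum.inr k)
        | Sum.inr x => Sum.inl (Sum.inl x)
      invFun := fun
        | Sum.inr a => Sum.inl (Sum.inl a)
        | Sum.inl (Sum.inr k) => Sum.inl (Sum.inr k)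
        | Sum.inl (Sum.inl x) => Sum.inr x
      left_inv := by rintro ((_ | _) | _) <;> rfl
      right_inv := by rintro ((_ | _) | _) <;> rfl }
  refine TZ_star τ σ (Equiv.sumComm A A') (fun _ => false) (fun a => Sum.inl (att a))
    (fun _ => rfl) (fun _ => rfl) ?_ ?_
  · rintro (b | a)
    · rfl
    · change Sum.map att id (att' a) = Sum.elim id _ (σ (Sum.inl (att' a)))
      rcases att' a with x | x <;> rfl
  · rintro (_ | (_ | _) | (_ | _)) <;> rfl

/-- Here fusion goes the other way: the outer spider `a` holds just the one inner end `a`, so it is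
absorbed by the inner spider `bd' a`. -/
theorem Pc_id_Pc (bd : B → A) (bd' : A → X) (att' : A' → X) (r : Diag A') :
    Pc bd id (Pc bd' att' r) = Pc (fun b => bd' (bd b)) att' r := by
  rw [Pc, Pc, TZ_TZ]
  let τ : (A ⊕ A') ⊕ (B ⊕ A) ≃ (B ⊕ A') ⊕ A × Bool :=
    { toFun := fun
        | Sum.inl (Sum.inl a) => Sum.inr (a, true)
        | Sum.inl (Sum.inr a) => Sum.inl (Sum.inr a)
        | Sum.inr (Sum.inl b) => Sum.inl (Sum.inl b)
        | Sum.inr (Sum.inr a) => Sum.inr (a, false)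
      invFun := fun
        | Sum.inr (a, true) => Sum.inl (Sum.inl a)
        | Sum.inl (Sum.inr a) => Sum.inl (Sum.inr a)
        | Sum.inl (Sum.inl b) => Sum.inr (Sum.inl b)
        | Sum.inr (a, false) => Sum.inr (Sum.inr a)
      left_inv := by rintro ((_ | _) | (_ | _)) <;> rfl
      right_inv := by rintro ((_ | _) | ⟨_, _ | _⟩) <;> rfl }
  refine TZ_star τ (Equiv.refl _) (Equiv.sumComm A A') (Sum.elim (fun _ => true) fun _ => false) bd'
    (fun _ => rfl) (fun _ => rfl) ?_ ?_
  · rintro (b | a) <;> rfl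
  · rintro (_ | (_ | _) | (_ | _)) <;> rfl

theorem Pc_ten_zfam (k : A → X) (q : Diag A) :
    Pc id (Sum.elim id id) (ten q (zfam k)) = Pc k k q := by
  rw [Pc, TZ_zfam]
  let τ : A ⊕ (A ⊕ (A ⊕ A)) ≃ (A ⊕ A) ⊕ A × Bool :=
    { toFun := fun
        | Sum.inl a => Sum.inr (a, true)
        | Sum.inr (Sum.inl a) => Sum.inl (Sum.inl a)
        | Sum.inr (Sum.inr (Sum.inl a)) => Sum.inl (Sum.inr a)
        | Sum.inr (Sum.inr (Sum.inr a)) => Sum.inr (a, false)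
      invFun := fun
        | Sum.inr (a, true) => Sum.inl a
        | Sum.inl (Sum.inl a) => Sum.inr (Sum.inl a)
        | Sum.inl (Sum.inr a) => Sum.inr (Sum.inr (Sum.inl a))
        | Sum.inr (a, false) => Sum.inr (Sum.inr (Sum.inr a))
      left_inv := by rintro (_ | _ | _ | _) <;> rfl
      right_inv := by rintro ((_ | _) | ⟨_, _ | _⟩) <;> rfl }
  refine TZ_star τ (Equiv.refl _) (Equiv.refl _)
    (Sum.elim (fun _ => false) fun _ => true) k (fun _ => rfl) (fun _ => rfl) ?_ ?_
  · rintro (b | a) <;> rfl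
  · rintro (_ | _ | _ | _ | _) <;> rfl

theorem zfam_single : (zfam (fun _ : Unit ⊕ Unit => ()) : Diag (Unit ⊕ Unit)) = ⟦idWire⟧ := by
  have h : (⟦Z Bool⟧ : Diag Bool) = ⟦strand⟧ := Quotient.sound (ZHEq.rule Rule.ZS2)
  rw [idWire, ← renm_mk, ← h, renm_Z, zfam_unique]

theorem zfam_empty (g : Empty → Empty) : zfam g = nil := by
  have h : (fun i : Empty => (i.elim : Diag Empty)) = fun _ => ⟦Z Empty⟧ := funext fun i => i.elim
  rw [nil, h]
  exact (zfam_eq (M := fun _ => Empty) g (Equiv.refl _) _ fun v => v.elim).symm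

/-- The wiring of a diagram with a family of wires. -/
def padE (B C : Type) : (B ⊕ C) ⊕ (C ⊕ C) ≃ (B ⊕ C) ⊕ C × Bool where
  toFun := fun
    | Sum.inl (Sum.inl b) => Sum.inl (Sum.inl b)
    | Sum.inl (Sum.inr c) => Sum.inr (c, false)
    | Sum.inr (Sum.inl c) => Sum.inr (c, true)
    | Sum.inr (Sum.inr c) => Sum.inl (Sum.inr c)
  invFun := fun
    | Sum.inl (Sum.inl b) => Sum.inl (Sum.inl b)
    | Sum.inr (c, false) => Sum.inl (Sum.inr c)
    | Sum.inr (c, true) => Sum.inr (Sum.inl c)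
    | Sum.inl (Sum.inr c) => Sum.inr (Sum.inr c)
  left_inv := by rintro ((_ | _) | (_ | _)) <;> rfl
  right_inv := by rintro ((_ | _) | ⟨_, _ | _⟩) <;> rfl

theorem TZ_yank {B : Type} (q : Diag (B ⊕ Unit)) :
    TZ q (Sum.elim id id) (padE B Unit) = q := by
  induction q using Quotient.inductionOn with
  | h D =>
    have h := Quotient.sound (s := zhSetoid _) (ZHEq.yank D)
    conv_rhs => rw [← h, stack, ← netQ_mk, ← pairQ_mk, netQ_eq_tr, ← zfam_single]
    rw [TZ, ten, tr_renm]
    have : (Sum.elim id id : Unit ⊕ Unit → Unit) = fun _ => () := rfl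
    rw [this]
    refine tr_congr _ (Equiv.refl _) (fun _ => false) ?_
    rintro ⟨_ | _, _ | _⟩ <;> rfl

/-- Two-legged white spiders are wires, and yanking removes a wire at one open end; induction on `C`
treats the ends one after the other. -/
theorem TZ_pad {B : Type} (C : Type) [Finite C] (q : Diag (B ⊕ C)) :
    TZ q (Sum.elim id id) (padE B C) = q := by
  revert B
  refine Finite.induction_empty_option (P := fun C => ∀ [Finite C] {B : Type} (q : Diag (B ⊕ C)),
    TZ q (Sum.elim id id) (padE B C) = q) ?_ ?_ ?_ C
  · intro C₁ C₂ k ih _ B q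
    have : Finite C₁ := Finite.of_equiv _ k.symm
    have h := ih (renm (Equiv.sumCongr (Equiv.refl B) k.symm) q)
    rw [TZ_renm] at h
    apply renm_inj (Equiv.sumCongr (Equiv.refl B) k.symm)
    refine Eq.trans ?_ h
    rw [renm_TZ]
    refine TZ_iso (Equiv.sumCongr k.symm k.symm) k.symm k.symm (fun _ => false) ?_ ?_
    · rintro (_ | _) <;> rfl
    · rintro ((_ | _) | (_ | _)) <;> simp [rewire, padE]
  · intro _ B q
    have h : zfam (Sum.elim id id : PEmpty ⊕ PEmpty → PEmpty) =
        renm (Equiv.equivEmpty (PEmpty ⊕ PEmpty)).symm nil := by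
      rw [← zfam_empty id, zfam_renm (g' := fun x => (Equiv.equivEmpty PEmpty)
        ((Sum.elim id id : PEmpty ⊕ PEmpty → PEmpty) x)) (Equiv.equivEmpty (PEmpty ⊕ PEmpty)).symm
        (fun x => x.elim), zfam_equiv]
    rw [TZ, h, ten_renm_right, ten_nil, renm_renm, tr_renm]
    conv_rhs => rw [← renm_refl q]
    refine tr_congr _ (Equiv.equivEmpty PEmpty) (fun _ => false) ?_
    rintro (x | ⟨⟨⟩⟩)
    rfl
  · intro C _ ih _ B q
    let k : B ⊕ Option C ≃ (B ⊕ C) ⊕ Unit :=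
      (Equiv.sumCongr (Equiv.refl B) (Equiv.optionEquivSumPUnit C)).trans (Equiv.sumAssoc _ _ _).symm
    let k' : (B ⊕ C) ⊕ Unit ≃ (B ⊕ Unit) ⊕ C :=
      (Equiv.sumAssoc _ _ _).trans ((Equiv.sumCongr (Equiv.refl _) (Equiv.sumComm _ _)).trans
        (Equiv.sumAssoc _ _ _).symm)
    have h1 := TZ_yank (renm k q)
    have h2 := ih (renm k' (renm k q))
    have h3 : TZ (renm k' (TZ (renm k q) (Sum.elim id id) (padE (B ⊕ C) Unit)))
        (Sum.elim id id) (padE (B ⊕ Unit) C) = renm k' (renm k q) := by rw [h1, h2]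
    apply renm_inj (k.trans k')
    rw [← renm_renm k k' q, ← h3, renm_TZ, renm_TZ, TZ_TZ, TZ_renm]
    let τ : Option C ⊕ Option C ≃ (Unit ⊕ Unit) ⊕ (C ⊕ C) :=
      { toFun := fun
          | Sum.inl none => Sum.inl (Sum.inl ())
          | Sum.inr none => Sum.inl (Sum.inr ())
          | Sum.inl (some c) => Sum.inr (Sum.inl c)
          | Sum.inr (some c) => Sum.inr (Sum.inr c)
        invFun := fun
          | Sum.inl (Sum.inl ()) => Sum.inl none
          | Sum.inl (Sum.inr ()) => Sum.inr none
          | Sum.inr (Sum.inl c) => Sum.inl (some c)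
          | Sum.inr (Sum.inr c) => Sum.inr (some c)
        left_inv := by rintro ((_ | _) | (_ | _)) <;> rfl
        right_inv := by rintro ((_ | _) | (_ | _)) <;> rfl }
    refine TZ_iso τ ((Equiv.optionEquivSumPUnit C).trans (Equiv.sumComm _ _))
      (Equiv.optionEquivSumPUnit C) (fun _ => false) ?_ ?_
    · rintro ((_ | _) | (_ | _)) <;> rfl
    · rintro ((_ | _ | _) | ((_ | _) | (_ | _))) <;> rfl

theorem Pc_id_id (q : Diag A) : Pc id id q = q := by
  have h := TZ_pad A (renm (Equiv.emptySum Empty A).symm q)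
  rw [TZ_renm] at h
  apply renm_inj (Equiv.emptySum Empty A).symm
  rw [← h, Pc, renm_TZ]
  exact TZ_iso (Equiv.sumComm A A) (Equiv.refl A) (Equiv.refl A) (fun _ => false)
    (by rintro (_ | _) <;> rfl) (by rintro (_ | _ | _) <;> rfl)

/-- After a white spider has been put on every end of `q`, the two spiders at the ends of each wire
fuse: a wire becomes a bound variable. -/
theorem tr_eq_Pc (e : A ≃ B ⊕ K × Bool) (q : Diag A) :
    tr e q = Pc (Sum.inl : B → B ⊕ K) (fun a => Sum.map id Prod.fst (e a)) q := by
  conv_lhs => rw [← Pc_id_id q]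
  rw [Pc, tr_TZ]
  let τ : A ⊕ A ≃ (B ⊕ A) ⊕ K × Bool :=
    (Equiv.sumCongr e (Equiv.refl A)).trans ((Equiv.sumAssoc _ _ _).trans
      ((Equiv.sumCongr (Equiv.refl _) (Equiv.sumComm _ _)).trans (Equiv.sumAssoc _ _ _).symm))
  let σ : B ⊕ K × Bool ≃ (B ⊕ K) ⊕ K :=
    { toFun := fun
        | Sum.inl b => Sum.inl (Sum.inl b)
        | Sum.inr (k, false) => Sum.inr k
        | Sum.inr (k, true) => Sum.inl (Sum.inr k)
      invFun := fun
        | Sum.inl (Sum.inl b) => Sum.inl b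
        | Sum.inr k => Sum.inr (k, false)
        | Sum.inl (Sum.inr k) => Sum.inr (k, true)
      left_inv := by rintro (_ | ⟨_, _ | _⟩) <;> rfl
      right_inv := by rintro ((_ | _) | _) <;> rfl }
  refine TZ_star τ (e.trans σ) (Equiv.sumComm K A) (fun _ => false) Sum.inr ?_ ?_ ?_ ?_
  · intro u; simp [τ, σ]
  · intro u; simp [τ, σ]
  · rintro (b | a)
    · simp [τ, σ]
    · change Sum.map id Prod.fst (e a) = Sum.elim id _ (σ (e a))
      rcases e a with b | ⟨k, _ | _⟩ <;> rfl
  · rintro (a | a | a)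
    · rfl
    · rcases h : e a with b | ⟨k, t⟩ <;> simp [τ, pcE, rewire, h, combine, combineE_apply]
    · rfl

theorem Pc_bigten {ι : Type} {A B X : ι → Type} [Finite ι] [∀ i, Finite (A i)] [∀ i, Finite (B i)]
    [∀ i, Finite (X i)] (bd : (i : ι) → B i → X i) (att : (i : ι) → A i → X i)
    (r : (i : ι) → Diag (A i)) :
    bigten (fun i => Pc (bd i) (att i) (r i)) =
      Pc (fun p : Σ i, B i => (⟨p.1, bd p.1 p.2⟩ : Σ i, X i)) (fun p => ⟨p.1, att p.1 p.2⟩)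
        (bigten r) := by
  let F : (Σ i, A i ⊕ (B i ⊕ A i)) ≃ (Σ i, B i) ⊕ (Σ i, A i) × Bool :=
    { toFun := fun
        | ⟨i, Sum.inl a⟩ => Sum.inr (⟨i, a⟩, false)
        | ⟨i, Sum.inr (Sum.inl b)⟩ => Sum.inl ⟨i, b⟩
        | ⟨i, Sum.inr (Sum.inr a)⟩ => Sum.inr (⟨i, a⟩, true)
      invFun := fun
        | Sum.inr (⟨i, a⟩, false) => ⟨i, Sum.inl a⟩
        | Sum.inl ⟨i, b⟩ => ⟨i, Sum.inr (Sum.inl b)⟩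
        | Sum.inr (⟨i, a⟩, true) => ⟨i, Sum.inr (Sum.inr a)⟩
      left_inv := by rintro ⟨_, _ | _ | _⟩ <;> rfl
      right_inv := by rintro (_ | ⟨_, _ | _⟩) <;> rfl }
  simp only [Pc, TZ]
  rw [bigten_tr (fun i => pcE (A i) (B i)) _ F, bigten_ten, zfam_bigten, tr_renm]
  · change TZ _ _ _ = TZ _ _ _
    refine TZ_iso (Equiv.sigmaSumDistrib B A) (Equiv.refl _) (Equiv.refl _) (fun _ => false) ?_ ?_
    · rintro ⟨i, _ | _⟩ <;> rfl
    · rintro (_ | ⟨_, _ | _⟩) <;> rfl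
  · rintro i (_ | _ | _) <;> rfl

theorem Pc_ten {A₁ A₂ B₁ B₂ X₁ X₂ : Type} [Finite A₁] [Finite A₂] [Finite B₁] [Finite B₂]
    [Finite X₁] [Finite X₂] (bd₁ : B₁ → X₁) (bd₂ : B₂ → X₂) (att₁ : A₁ → X₁) (att₂ : A₂ → X₂)
    (q : Diag A₁) (r : Diag A₂) :
    ten (Pc bd₁ att₁ q) (Pc bd₂ att₂ r) = Pc (Sum.map bd₁ bd₂) (Sum.map att₁ att₂) (ten q r) := by
  let bd : (t : Bool) → pairLegs B₁ B₂ t → pairLegs X₁ X₂ t := fun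
    | false => bd₁
    | true => bd₂
  let att : (t : Bool) → pairLegs A₁ A₂ t → pairLegs X₁ X₂ t := fun
    | false => att₁
    | true => att₂
  have h : pairQ (Pc bd₁ att₁ q) (Pc bd₂ att₂ r) = fun t => Pc (bd t) (att t) (pairQ q r t) := by
    funext t; cases t <;> rfl
  rw [ten, h, Pc_bigten, ten, Pc_renm, renm_Pc, ← Pc_equiv (pairE X₁ X₂)]
  congr 1
  · funext x; rcases x with _ | _ <;> rfl
  · funext x; rcases x with ⟨_ | _, _⟩ <;> rfl

/-- Two rounds of fusion: each two-legged spider is first absorbed by the spider of its variable in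
`K`, and that one then by the spider of `h k`. -/
theorem Pc_zfam_pairs (h : K → B) :
    Pc id (Sum.elim (Sum.inl ∘ h) Sum.inr : K ⊕ K → B ⊕ K) (zfam (Sum.elim id id : K ⊕ K → K)) =
      zfam (Sum.elim id h) := by
  let τ₁ : (K ⊕ K) ⊕ ((B ⊕ K) ⊕ (K ⊕ K)) ≃ (K ⊕ ((B ⊕ K) ⊕ K)) ⊕ K × Bool :=
    { toFun := fun
        | Sum.inl (Sum.inl k) => Sum.inl (Sum.inl k)
        | Sum.inl (Sum.inr k) => Sum.inr (k, true)
        | Sum.inr (Sum.inl x) => Sum.inl (Sum.inr (Sum.inl x))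
        | Sum.inr (Sum.inr (Sum.inl k)) => Sum.inl (Sum.inr (Sum.inr k))
        | Sum.inr (Sum.inr (Sum.inr k)) => Sum.inr (k, false)
      invFun := fun
        | Sum.inl (Sum.inl k) => Sum.inl (Sum.inl k)
        | Sum.inr (k, true) => Sum.inl (Sum.inr k)
        | Sum.inl (Sum.inr (Sum.inl x)) => Sum.inr (Sum.inl x)
        | Sum.inl (Sum.inr (Sum.inr k)) => Sum.inr (Sum.inr (Sum.inl k))
        | Sum.inr (k, false) => Sum.inr (Sum.inr (Sum.inr k))
      left_inv := by rintro ((_ | _) | _ | _ | _) <;> rfl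
      right_inv := by rintro ((_ | _ | _) | ⟨_, _ | _⟩) <;> rfl }
  let G₁ : K ⊕ ((B ⊕ K) ⊕ K) → K ⊕ B :=
    Sum.elim Sum.inl (Sum.elim (Sum.elim Sum.inr Sum.inl) fun k => Sum.inr (h k))
  have h₁ : Pc id (Sum.elim (Sum.inl ∘ h) Sum.inr : K ⊕ K → B ⊕ K)
      (zfam (Sum.elim id id : K ⊕ K → K)) = tr (pcE K (B ⊕ K)) (zfam G₁) := by
    rw [Pc, TZ, zfam_ten]
    refine tr_zfam_star τ₁ (Equiv.sumAssoc K B K).symm (Equiv.refl _)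
      (Sum.elim (fun _ => false) fun _ => true) Sum.inl (fun _ => rfl) (fun _ => rfl) ?_ ?_
    · rintro (_ | (_ | _) | _) <;> rfl
    · rintro ((_ | _) | _ | _ | _) <;> rfl
  let τ₂ : K ⊕ ((B ⊕ K) ⊕ K) ≃ (B ⊕ K) ⊕ K × Bool := pcE K (B ⊕ K)
  rw [h₁]
  conv_rhs => rw [← renm_refl (zfam (Sum.elim id h))]
  refine tr_zfam_star τ₂ (Equiv.sumComm K B) (Equiv.emptySum Empty K).symm (fun _ => false) h
    (fun _ => rfl) (fun _ => rfl) ?_ ?_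
  · rintro (_ | _) <;> rfl
  · rintro (_ | (_ | _) | _) <;> rfl

end

/-! ### Substitution, products and sums -/

section
variable {A A' B B' C K K' X X' : Type} [Finite A] [Finite A'] [Finite B] [Finite B'] [Finite C]
  [Finite K] [Finite K'] [Finite X] [Finite X']

/-- The diagram `q` with its leg `a` attached to the variable `g a`. -/
noncomputable def sub (g : A → B) (q : Diag A) : Diag B := Pc id g q

/-- The sum of a diagram over the variables in `K`. -/
noncomputable def sm (K : Type) [Finite K] (q : Diag (B ⊕ K)) : Diag B := Pc Sum.inl id q

/-- Attaching legs to spiders is substitution of variables followed by summation over those spiders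
that are not open. -/
theorem Pc_eq_sm_sub (att : A → B ⊕ K) (q : Diag A) : Pc Sum.inl att q = sm K (sub att q) := by
  rw [sm, sub, Pc_id_Pc]; rfl

theorem Pc_sub (bd : B → X) (att : A → X) (f : A' → A) (q : Diag A') :
    Pc bd att (sub f q) = Pc bd (fun a => att (f a)) q := by
  have h1 : sub f q = Pc (Sum.inl : A → A ⊕ Empty) (fun a => Sum.inl (f a)) q :=
    (Pc_equiv (Equiv.sumEmpty A Empty).symm id f q).symm
  have h2 : Pc bd (fun a => att (f a)) q =
      Pc (fun b => (Sum.inl (bd b) : X ⊕ Empty)) (fun a => Sum.inl (att (f a))) q :=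
    (Pc_equiv (Equiv.sumEmpty X Empty).symm bd (fun a => att (f a)) q).symm
  rw [h1, h2]
  exact Pc_nest bd att _ q

theorem Pc_sm (bd : B → X) (att : A → X) (q : Diag (A ⊕ K)) :
    Pc bd att (sm K q) = Pc (fun b => Sum.inl (bd b)) (Sum.map att (id : K → K)) q :=
  Pc_nest bd att id q

theorem sub_sub (g : B → C) (f : A → B) (q : Diag A) :
    sub g (sub f q) = sub (fun a => g (f a)) q := Pc_sub _ _ _ _

@[simp] theorem sub_id (q : Diag A) : sub id q = q := Pc_id_id q

@[simp] theorem sub_id' (q : Diag A) : sub (fun a => a) q = q := Pc_id_id q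

theorem renm_eq_sub (g : A ≃ B) (q : Diag A) : renm g q = sub g q := by
  conv_lhs => rw [← Pc_id_id q, renm_Pc, ← Pc_equiv g]
  simp [sub]
  rfl

theorem sub_sm (g : B → C) (q : Diag (B ⊕ K)) : sub g (sm K q) = sm K (sub (Sum.map g id) q) := by
  rw [← Pc_eq_sm_sub]; exact Pc_sm id g q

theorem sm_sm (q : Diag ((B ⊕ K) ⊕ K')) :
    sm K (sm K' q) = sm (K ⊕ K') (sub (Equiv.sumAssoc B K K') q) := by
  rw [← Pc_eq_sm_sub]
  conv_lhs => rw [sm, sm, Pc_id_Pc, ← Pc_equiv (Equiv.sumAssoc B K K')]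
  rfl

theorem sm_equiv (e : K ≃ K') (q : Diag (B ⊕ K)) : sm K' (sub (Sum.map id e) q) = sm K q := by
  rw [← Pc_eq_sm_sub, sm, ← Pc_equiv (Equiv.sumCongr (Equiv.refl B) e)]
  rfl

theorem ten_sub (f : A → B) (g : A' → B') (q : Diag A) (r : Diag A') :
    ten (sub f q) (sub g r) = sub (Sum.map f g) (ten q r) := by
  rw [sub, sub, Pc_ten, Sum.map_id_id]; rfl

/-- The pointwise product of functions: legs carrying the same variable meet in a white spider. The
laws come from those of juxtaposition. -/
noncomputable instance : CommMonoid (Diag B) where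
  mul q r := sub (Sum.elim id id) (ten q r)
  one := sub Empty.elim nil
  mul_assoc q r s := by
    change sub _ (ten (sub _ (ten q r)) s) = sub _ (ten q (sub _ (ten r s)))
    conv_lhs => rw [← sub_id s]
    conv_rhs => rw [← sub_id q]
    rw [ten_sub, ten_sub, sub_sub, sub_sub, ← ten_assoc, renm_eq_sub, sub_sub]
    congr 1
    funext x
    rcases x with (_ | _) | _ <;> rfl
  mul_comm q r := by
    change sub _ (ten q r) = sub _ (ten r q)
    rw [← ten_comm q r, renm_eq_sub, sub_sub]
    congr 1
    funext x
    rcases x with _ | _ <;> rfl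
  mul_one q := by
    change sub _ (ten q (sub _ nil)) = q
    conv_lhs => rw [← sub_id q]
    rw [ten_sub, sub_sub, ten_nil, renm_eq_sub, sub_sub]
    exact sub_id q
  one_mul q := by
    change sub _ (ten (sub _ nil) q) = q
    rw [← ten_comm, renm_eq_sub, sub_sub]
    conv_lhs => rw [← sub_id q]
    rw [ten_sub, sub_sub, ten_nil, renm_eq_sub, sub_sub]
    exact sub_id q

theorem mul_def (q r : Diag B) : q * r = sub (Sum.elim id id) (ten q r) := rfl

theorem one_def : (1 : Diag B) = sub Empty.elim nil := rfl

theorem sub_mul (g : A → B) (q r : Diag A) : sub g (q * r) = sub g q * sub g r := by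
  rw [mul_def, mul_def, ten_sub, sub_sub, sub_sub]
  congr 1
  funext x
  rcases x with _ | _ <;> rfl

theorem sub_one (g : A → B) : sub g (1 : Diag A) = 1 := by
  rw [one_def, one_def, sub_sub]
  congr 1
  funext x
  exact x.elim

/-- Substitution of variables, as a homomorphism. -/
noncomputable def subHom (g : A → B) : Diag A →* Diag B where
  toFun := sub g
  map_one' := sub_one g
  map_mul' := sub_mul g

theorem sub_prod {ι : Type} [Fintype ι] (g : A → B) (q : ι → Diag A) :
    sub g (∏ i, q i) = ∏ i, sub g (q i) :=
  map_prod (subHom g) _ _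

theorem sm_mul (q : Diag (B ⊕ K)) (r : Diag B) : sm K q * r = sm K (q * sub Sum.inl r) := by
  have h : ten (sm K q) r = Pc (Sum.map Sum.inl id : B ⊕ B → (B ⊕ K) ⊕ B) id (ten q r) := by
    conv_lhs => rw [← Pc_id_id r]
    rw [sm, Pc_ten, Sum.map_id_id]
  let E : (B ⊕ K) ⊕ B ≃ (B ⊕ B) ⊕ K :=
    { toFun := fun
        | Sum.inl (Sum.inl b) => Sum.inl (Sum.inl b)
        | Sum.inl (Sum.inr k) => Sum.inr k
        | Sum.inr b => Sum.inl (Sum.inr b)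
      invFun := fun
        | Sum.inl (Sum.inl b) => Sum.inl (Sum.inl b)
        | Sum.inr k => Sum.inl (Sum.inr k)
        | Sum.inl (Sum.inr b) => Sum.inr b
      left_inv := by rintro ((_ | _) | _) <;> rfl
      right_inv := by rintro ((_ | _) | _) <;> rfl }
  have h2 : ten (sm K q) r = sm K (sub E (ten q r)) := by
    rw [h, ← Pc_equiv E, ← Pc_eq_sm_sub]
    congr 1
    funext x
    rcases x with _ | _ <;> rfl
  rw [mul_def, h2, sub_sm, sub_sub, mul_def]
  conv_rhs => rw [← sub_id q]
  rw [ten_sub, sub_sub]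
  congr 2
  funext x
  rcases x with (_ | _) | _ <;> rfl

theorem prod_sub {ι : Type} [Fintype ι] {L : ι → Type} [∀ i, Finite (L i)] (g : (i : ι) → L i → B)
    (q : (i : ι) → Diag (L i)) :
    ∏ i, sub (g i) (q i) = sub (fun p : Σ i, L i => g p.1 p.2) (bigten q) := by
  revert L
  refine Fintype.induction_empty_option (P := fun ι _ => ∀ {L : ι → Type} [∀ i, Finite (L i)]
    (g : (i : ι) → L i → B) (q : (i : ι) → Diag (L i)),
    ∏ i, sub (g i) (q i) = sub (fun p : Σ i, L i => g p.1 p.2) (bigten q)) ?_ ?_ ?_ ι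
  · intro ι κ _ e ih L _ g q
    let _ : Fintype ι := Fintype.ofEquiv κ e.symm
    rw [← Equiv.prod_comp e]
    have h := ih (fun i => g (e i)) (fun i => q (e i))
    have hb := bigten_iso (q := q) (r := fun i => q (e i)) e (fun _ => Equiv.refl _)
      (Equiv.sigmaCongrLeft (β := L) e).symm (fun _ => (renm_refl _).symm)
      (fun i l => (Equiv.symm_apply_eq _).2 rfl)
    rw [← hb, renm_eq_sub, sub_sub] at h
    refine h.trans ?_
    congr 1
    funext p
    obtain ⟨p, rfl⟩ := (Equiv.sigmaCongrLeft (β := L) e).surjective p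
    exact congrArg (fun x : Σ i, L (e i) => g (e x.1) x.2) (Equiv.symm_apply_apply _ p)
  · intro L _ g q
    simp only [Finset.univ_eq_empty, Finset.prod_empty]
    have h : (q : (i : PEmpty) → _) = fun i => i.elim := funext fun i => i.elim
    rw [one_def, nil, renm_eq_sub, sub_sub]
    rw [← bigten_iso (q := q) (r := fun i : Empty => (i.elim : Diag Empty)) (Equiv.equivPEmpty Empty)
      (fun i => i.elim) ((Equiv.equivEmpty (Σ i, L i)).trans (Equiv.equivEmpty _).symm)
      (fun i => i.elim) (fun i => i.elim), renm_eq_sub, sub_sub]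
    congr 1
    funext x
    exact x.1.elim
  · intro ι _ ih L _ g q
    rw [Fintype.prod_option, ih (fun i => g (some i)) (fun i => q (some i)), mul_def]
    have h := ten_bigten (fun _ : Unit => q none) (fun i => q (some i))
    rw [bigten_unit, ten_renm_left] at h
    let F : (Σ i, L i) ≃ Σ x : Unit ⊕ ι, Sum.elim (fun _ => L none) (fun i => L (some i)) x :=
      { toFun := fun
          | ⟨none, l⟩ => ⟨Sum.inl (), l⟩
          | ⟨some i, l⟩ => ⟨Sum.inr i, l⟩
        invFun := fun
          | ⟨Sum.inl (), l⟩ => ⟨none, l⟩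
          | ⟨Sum.inr i, l⟩ => ⟨some i, l⟩
        left_inv := by rintro ⟨_ | _, _⟩ <;> rfl
        right_inv := by rintro ⟨_ | _, _⟩ <;> rfl }
    have hb : renm F (bigten q) = bigten (sumFam (fun _ : Unit => q none) fun i => q (some i)) :=
      bigten_iso ((Equiv.sumComm _ _).trans (Equiv.optionEquivSumPUnit ι).symm) (fun
        | Sum.inl _ => Equiv.refl (L none)
        | Sum.inr i => Equiv.refl (L (some i))) _
        (by rintro (_ | _) <;> exact (renm_refl _).symm) (by rintro (_ | _) _ <;> rfl)
    rw [← hb, renm_renm] at h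
    have h3 := congrArg (renm (Equiv.sumCongr (Equiv.uniqueSigma fun _ : Unit => L none)
      (Equiv.refl (Σ i, L (some i))))) h
    rw [renm_renm, renm_renm, renm_eq_sub, renm_eq_sub] at h3
    rw [ten_sub, sub_sub]
    refine Eq.trans ?_ ((congrArg (sub (Sum.elim (g none) fun p => g (some p.1) p.2)) h3).trans ?_)
    · rw [sub_sub]
      congr 1
      funext x
      rcases x with _ | _ <;> rfl
    · rw [sub_sub]
      congr 1
      funext x
      rcases x with ⟨_ | _, _⟩ <;> rfl

/-- The bound variables of different factors are kept apart by the sigma type. -/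
theorem prod_sm {ι : Type} [Fintype ι] {K : ι → Type} [∀ i, Finite (K i)]
    (q : (i : ι) → Diag (B ⊕ K i)) :
    ∏ i, sm (K i) (q i) = sm (Σ i, K i) (∏ i, sub (Sum.map id (Sigma.mk i)) (q i)) := by
  have h : ∏ i, sm (K i) (q i) = sub (fun p : Σ _ : ι, B => p.2) (bigten fun i => sm (K i) (q i)) := by
    have h := prod_sub (fun (_ : ι) (b : B) => b) fun i => sm (K i) (q i)
    simpa only [sub_id'] using h
  rw [h, prod_sub]
  simp only [sm]
  rw [Pc_bigten, ← Pc_equiv (Equiv.sigmaSumDistrib (fun _ : ι => B) K)]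
  change sub _ (Pc Sum.inl _ _) = _
  rw [Pc_eq_sm_sub, sub_sm, sub_sub]
  change sm _ _ = sm _ _
  congr 2
  funext x
  obtain ⟨i, b | k⟩ := x <;> rfl

/-! ### Equality of variables -/

/-- The constraint that two variables are equal. -/
noncomputable def dl (a b : B) : Diag B := sub (fun t => bif t then b else a) ⟦strand⟧

theorem sub_dl (g : B → C) (a b : B) : sub g (dl a b) = dl (g a) (g b) := by
  rw [dl, sub_sub, dl]
  congr 1
  funext t
  cases t <;> rfl

theorem strand_eq : (⟦strand⟧ : Diag Bool) = ⟦Z Bool⟧ :=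
  (Quotient.sound (ZHEq.rule Rule.ZS2)).symm

theorem dl_comm (a b : B) : dl a b = dl b a := by
  rw [dl, strand_eq, ← renm_Z Equiv.boolNot, renm_eq_sub, sub_sub, dl, strand_eq]
  congr 1
  funext t
  cases t <;> rfl

theorem prod_dl [Fintype K] (h : K → B) :
    ∏ k, dl (Sum.inl (h k)) (Sum.inr k) = zfam (Sum.elim id h : B ⊕ K → B) := by
  simp only [dl]
  rw [prod_sub (fun (k : K) (t : Bool) => bif t then (Sum.inr k : B ⊕ K) else Sum.inl (h k)),
    ← Pc_zfam_pairs]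
  simp only [strand_eq]
  have h2 : zfam (Sum.elim id id : K ⊕ K → K) =
      renm ((Equiv.sigmaEquivProd K Bool).trans ((Equiv.prodComm _ _).trans
        (Equiv.boolProdEquivSum K))) (bigten fun _ : K => ⟦Z Bool⟧) := by
    refine (zfam_eq (M := fun _ => Bool) _ (Equiv.refl _) _ ?_).symm
    rintro k (_ | _) <;> rfl
  rw [h2, renm_eq_sub]
  change _ = sub _ _
  rw [sub_sub]
  congr 1
  funext x
  obtain ⟨k, _ | _⟩ := x <;> rfl

/-- The basic elimination law, a form of spider fusion: a sum over a variable that a delta equates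
with `h k` is a substitution. -/
theorem sm_mul_dl [Fintype K] (h : K → B) (q : Diag (B ⊕ K)) :
    sm K (q * ∏ k, dl (Sum.inl (h k)) (Sum.inr k)) = sub (Sum.elim id h) q := by
  rw [prod_dl, sm, mul_def, sub, Pc_ten_zfam, Pc_id_Pc]
  rfl

theorem mul_zfam (k : A → X) (q : Diag A) : q * zfam k = Pc k k q := Pc_ten_zfam k q

theorem zfam_eq_Pc (k : A → X) : zfam k = Pc k Empty.elim nil := by
  rw [← one_mul (zfam k), mul_zfam, one_def, Pc_sub]
  congr 1
  funext x
  exact x.elim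

theorem sm_zfam (k : B ⊕ K → X) : sm K (zfam k) = zfam fun b => k (Sum.inl b) := by
  rw [zfam_eq_Pc, zfam_eq_Pc, sm, Pc_id_Pc]

theorem Z_eq (L : Type) [Fintype L] :
    (⟦Z L⟧ : Diag L) = sm Unit (∏ l, dl (Sum.inr ()) (Sum.inl l)) := by
  have h := congrArg (renm (Equiv.sumComm Unit L)) (prod_dl fun _ : L => ())
  rw [renm_eq_sub, sub_prod] at h
  simp only [sub_dl] at h
  change ∏ l, dl (Sum.inr ()) (Sum.inl l) = _ at h
  rw [h, zfam_renm (g' := fun _ : L ⊕ Unit => ()) _ (fun _ => rfl), sm_zfam, zfam_unique]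

/-- The bridge from diagrams to formulas: wires become bound variables and parts become factors. -/
theorem net_eq {ι W : Type} {L : ι → Type} [Fintype ι] [∀ i, Finite (L i)] [Finite W]
    (D : (i : ι) → ZH (L i)) (e : (Σ i, L i) ≃ B ⊕ W × Bool) :
    (⟦net D e⟧ : Diag B) =
      sm W (∏ i, sub (fun l => Sum.map id Prod.fst (e ⟨i, l⟩)) (⟦D i⟧ : Diag (L i))) := by
  rw [← netQ_mk, netQ_eq_tr, prod_sub, ← Pc_eq_sm_sub]
  exact tr_eq_Pc e _

theorem graph_eq {ι W : Type} [Fintype ι] [Finite W] (node : ι → Spider)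
    (bdry : B → ι) (src tgt : W → ι) :
    (⟦graph node bdry src tgt⟧ : Diag B) =
      sm W (∏ i, sub (fun l : {p // Sum.elim bdry (fun p : W × Bool =>
        bif p.2 then tgt p.1 else src p.1) p = i} => Sum.map id Prod.fst l.1)
        (⟦node i _⟧ : Diag _)) := by
  rw [graph, net_eq]
  rfl
end

section
variable {A A' B C K K' V X : Type} [Fintype A] [Fintype A'] [Fintype C]
  [Fintype K] [Fintype K'] [Finite V] [Finite X] [Finite B]

theorem dl_self (a : X) : dl a a = 1 := by
  have h : sub (fun _ => ()) (⟦Z Bool⟧ : Diag Bool) = (1 : Diag Unit) := by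
    have h1 : (1 : Diag Unit) = ⟦Z Unit⟧ := by
      have h := sm_mul_dl (B := Unit) (fun _ : Unit => ()) 1
      rw [one_mul, prod_dl, sm_zfam, sub_one, zfam_unique] at h
      exact h.symm
    -- Both legs of one spider meet in a second spider. Here (ZS1) is needed for two parallel wires,
    -- which fusion along trees does not cover.
    rw [h1, sub, ← zfam_unique (V := Unit) (fun _ => ()), Pc, TZ, zfam_ten,
      ← ZS1_eq (W := Bool) fun _ => true]
    rw [← zfam_equiv _ (Equiv.boolEquivPUnitSumPUnit).symm,
      ← zfam_renm (g := fun p => (Equiv.boolEquivPUnitSumPUnit).symm (Sum.map (fun _ => ())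
        (Sum.elim id fun _ => ()) p)) (pcE Bool Unit), tr_renm]
    · rfl
    · rintro (_ | _ | _) <;> rfl
  have h2 := congrArg (sub fun _ => a) h
  rw [sub_sub, sub_one] at h2
  rw [dl, strand_eq, ← h2]
  congr 1
  funext t
  cases t <;> rfl

theorem sub_Z_three (f : Unit ⊕ Bool → X) : sub f (⟦Z (Unit ⊕ Bool)⟧ : Diag _) =
    dl (f (Sum.inl ())) (f (Sum.inr false)) * dl (f (Sum.inl ())) (f (Sum.inr true)) := by
  have h := prod_dl fun _ : Bool => ()
  rw [zfam_unique, Fintype.prod_bool] at h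
  rw [← h, sub_mul, sub_dl, sub_dl, mul_comm]

/-- Both sides are the white spider with three legs, with a different leg playing the role of the
centre. -/
theorem dl_trans (a b c : X) : dl a b * dl b c = dl a b * dl a c := by
  let E : Unit ⊕ Bool ≃ Unit ⊕ Bool := Equiv.swap (Sum.inl ()) (Sum.inr false)
  have h := sub_Z_three fun x => Sum.elim (fun _ => a) (fun t => bif t then c else b) (E x)
  have h2 := congrArg (sub (Sum.elim (fun _ => a) (fun t => bif t then c else b))) (renm_Z E)
  rw [renm_eq_sub, sub_sub, h, sub_Z_three] at h2
  have e1 : E (Sum.inl ()) = Sum.inr false := by simp [E]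
  have e2 : E (Sum.inr false) = Sum.inl () := by simp [E]
  have e3 : E (Sum.inr true) = Sum.inr true := by simp [E, Equiv.swap_apply_of_ne_of_ne]
  rw [e1, e2, e3] at h2
  simpa [dl_comm b a] using h2

theorem sm_comm (q : Diag ((B ⊕ K) ⊕ K')) :
    sm K (sm K' q) = sm K' (sm K (sub (Sum.elim (Sum.map Sum.inl id) fun k => Sum.inl (Sum.inr k))
      q)) := by
  rw [sm_sm, sm_sm, ← sm_equiv (Equiv.sumComm K K'), sub_sub, sub_sub]
  congr 2
  funext x
  rcases x with (_ | _) | _ <;> rfl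

theorem sm_sum (q : Diag (B ⊕ (C ⊕ K))) :
    sm (C ⊕ K) q = sm C (sm K (sub (Equiv.sumAssoc B C K).symm q)) := by
  rw [sm_sm, sub_sub]
  simp

theorem sm_dl (b : B) : sm Unit (dl (Sum.inl b) (Sum.inr ())) = 1 := by
  have h := sm_mul_dl (K := Unit) (fun _ => b) 1
  simpa [sub_one] using h

/-! ### Terms -/

variable (V) in
/-- A term: a diagram that expresses one variable as a function of the variables in `V`. -/
structure Term where
  val : Diag (V ⊕ Unit)
  copy : sub (Sum.map id fun _ => false) val * sub (Sum.map id fun _ => true) val =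
    sub (Sum.map id fun _ => false) val * dl (Sum.inr false : V ⊕ Bool) (Sum.inr true)
  discard : sm Unit val = 1

/-- The constraint that the variable `y` is given by the term `t`. -/
noncomputable def Term.at (t : Term V) (f : V → X) (y : X) : Diag X := sub (Sum.elim f fun _ => y) t.val

theorem Term.ext' {t s : Term V} (h : t.val = s.val) : t = s := by
  cases t; cases s; cases h; rfl

theorem Term.at_self (t : Term V) : t.at Sum.inl (Sum.inr ()) = t.val := by
  rw [Term.at]
  conv_rhs => rw [← sub_id t.val]
  congr 1
  funext x
  rcases x with _ | _ <;> rfl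

theorem sub_at (t : Term V) (f : V → X) (y : X) (g : X → B) :
    sub g (t.at f y) = t.at (fun v => g (f v)) (g y) := by
  rw [Term.at, sub_sub, Term.at]
  congr 1
  funext x
  rcases x with _ | _ <;> rfl

theorem Term.at_mul_at (t : Term V) (f : V → X) (y z : X) :
    t.at f y * t.at f z = t.at f y * dl y z := by
  have h := congrArg (sub (Sum.elim f fun t => bif t then z else y)) t.copy
  rw [sub_mul, sub_mul, sub_sub, sub_sub, sub_dl] at h
  have e : ∀ b : Bool, sub (fun a => Sum.elim f (fun t => bif t then z else y)
      (Sum.map id (fun _ : Unit => b) a)) t.val = t.at f (bif b then z else y) := by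
    intro b
    rw [Term.at]
    congr 1
    funext x
    rcases x with _ | _ <;> rfl
  rw [e, e] at h
  exact h

theorem Term.sm_at (t : Term V) (f : V → X) :
    sm Unit (t.at (fun v => Sum.inl (f v)) (Sum.inr ())) = 1 := by
  have h := congrArg (sub f) t.discard
  rw [sub_sm, sub_one] at h
  rw [← h, Term.at]
  congr 2

/-- A variable, as a term. -/
noncomputable def var (v : V) : Term V where
  val := dl (Sum.inl v) (Sum.inr ())
  copy := by
    rw [sub_dl, sub_dl]
    exact (dl_trans _ _ _).symm
  discard := sm_dl v

theorem var_at (v : V) (f : V → X) (y : X) : (var v).at f y = dl (f v) y := sub_dl _ _ _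

/-- Renaming the variables in a term. -/
noncomputable def Term.map (g : V → X) (t : Term V) : Term X where
  val := t.at (fun v => Sum.inl (g v)) (Sum.inr ())
  copy := by
    rw [sub_at, sub_at]
    exact t.at_mul_at _ _ _
  discard := t.sm_at g

theorem map_at (t : Term V) (g : V → X) (f : X → B) (y : B) :
    (t.map g).at f y = t.at (fun v => f (g v)) y := sub_at _ _ _ _

theorem map_var (g : V → X) (v : V) : (var v).map g = var (g v) :=
  Term.ext' (var_at _ _ _)

theorem map_map (t : Term V) (g : V → X) (f : X → B) : (t.map g).map f = t.map fun v => f (g v) :=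
  Term.ext' (map_at _ _ _ _)

/-- The constraints that the variables in `A` are given by the terms `t`. -/
noncomputable def ats (t : A → Term V) : Diag (V ⊕ A) := ∏ a, (t a).at Sum.inl (Sum.inr a)

theorem sub_ats (t : A → Term V) (g : V ⊕ A → X) :
    sub g (ats t) = ∏ a, (t a).at (fun v => g (Sum.inl v)) (g (Sum.inr a)) := by
  rw [ats, sub_prod]
  simp only [sub_at]

theorem sm_ats (t : A → Term V) : sm A (ats t) = 1 := by
  have h := prod_sm fun a => (t a).val
  simp only [Term.discard, Finset.prod_const_one] at h
  rw [h, ← sm_equiv (Equiv.sigmaPUnit A), sub_prod, ats]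
  simp only [sub_sub, Term.at]
  congr 1
  refine Finset.prod_congr rfl fun a _ => ?_
  congr 1
  funext x
  rcases x with _ | _ <;> rfl

/-- The diagram `q` with the terms `t` substituted for its variables. -/
noncomputable def ev (q : Diag A) (t : A → Term V) : Diag V := sm A (sub Sum.inr q * ats t)

/-- Substitution commutes with products exactly because terms can be copied. -/
theorem ev_mul (q r : Diag A) (t : A → Term V) : ev (q * r) t = ev q t * ev r t := by
  rw [ev, ev, sm_mul, ev, sub_sm, mul_comm _ (sm _ _), sm_mul, sub_mul, sub_mul Sum.inl,
    sub_mul (Sum.map Sum.inl id), sub_ats, sub_sub, sub_ats, sub_sub, mul_comm (_ * _) (_ * _)]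
  -- Two sets of bound variables are given by the same terms, so the second set is equal to the
  -- first and can be eliminated.
  have h : (∏ a, (t a).at (fun v => (Sum.inl (Sum.inl v) : (V ⊕ A) ⊕ A)) (Sum.inl (Sum.inr a))) *
      (∏ a, (t a).at (fun v => (Sum.inl (Sum.inl v) : (V ⊕ A) ⊕ A)) (Sum.inr a)) =
      (∏ a, (t a).at (fun v => (Sum.inl (Sum.inl v) : (V ⊕ A) ⊕ A)) (Sum.inl (Sum.inr a))) *
        ∏ a, dl (Sum.inl (Sum.inr a)) (Sum.inr a) := by
    rw [← Finset.prod_mul_distrib, ← Finset.prod_mul_distrib]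
    exact Finset.prod_congr rfl fun a _ => Term.at_mul_at _ _ _ _
  have h2 : ∀ x y z w : Diag ((V ⊕ A) ⊕ A), x * y * (z * w) = x * z * (y * w) :=
    mul_mul_mul_comm
  simp only [Sum.map_inl, Sum.map_inr, id]
  rw [h2, h, ← mul_assoc, sm_mul_dl, sub_mul, sub_mul, sub_sub, sub_sub, sub_prod]
  simp only [sub_at, id, Sum.elim_inl, Sum.elim_inr]
  rfl

theorem ev_one (t : A → Term V) : ev 1 t = 1 := by
  rw [ev, sub_one, one_mul, sm_ats]

theorem ev_var (q : Diag A) (g : A → V) : ev q (fun a => var (g a)) = sub g q := by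
  rw [ev, ats]
  simp only [var_at]
  rw [sm_mul_dl, sub_sub]
  rfl

theorem sub_ev (g : V → X) (q : Diag A) (t : A → Term V) :
    sub g (ev q t) = ev q fun a => (t a).map g := by
  rw [ev, sub_sm, sub_mul, sub_sub, sub_ats, ev, ats]
  simp only [map_at]
  rfl

theorem ev_sub (g : A' → A) (q : Diag A') (t : A → Term V) :
    ev (sub g q) t = ev q fun a => t (g a) := by
  have h1 : sub (Sum.inr : A → V ⊕ A) (sub g q) =
      sm A' (sub Sum.inr q * ∏ a, dl (Sum.inl (Sum.inr (g a))) (Sum.inr a)) := by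
    rw [sm_mul_dl, sub_sub, sub_sub]
    rfl
  have h2 : (∏ a, dl (Sum.inl (Sum.inr (g a)) : (V ⊕ A) ⊕ A') (Sum.inr a)) * sub Sum.inl (ats t) =
      (∏ a, (t (g a)).at (fun v => Sum.inl (Sum.inl v)) (Sum.inr a)) * sub Sum.inl (ats t) := by
    rw [sub_ats]
    -- Next to the constraint for the variable `g a`, a delta to it is worth another copy of that
    -- constraint. As `g` may repeat values, the original constraints are kept throughout.
    have : ∀ s : Finset A', (∏ a ∈ s, dl (Sum.inl (Sum.inr (g a)) : (V ⊕ A) ⊕ A') (Sum.inr a)) *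
        (∏ a, (t a).at (fun v => Sum.inl (Sum.inl v)) (Sum.inl (Sum.inr a))) =
      (∏ a ∈ s, (t (g a)).at (fun v => Sum.inl (Sum.inl v)) (Sum.inr a)) *
        (∏ a, (t a).at (fun v => Sum.inl (Sum.inl v)) (Sum.inl (Sum.inr a))) := by
      classical
      intro s
      induction s using Finset.induction_on with
      | empty => simp
      | insert a s ha ih =>
        rw [Finset.prod_insert ha, Finset.prod_insert ha, mul_assoc, ih, mul_left_comm, mul_assoc]
        conv_rhs => rw [mul_left_comm]
        congr 1
        rw [← Finset.mul_prod_erase _ _ (Finset.mem_univ (g a)), ← mul_assoc, ← mul_assoc]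
        congr 1
        rw [mul_comm, ← Term.at_mul_at, mul_comm]
    exact this Finset.univ
  rw [ev, h1, sm_mul, mul_assoc, h2, sub_ats, sm_comm, ev]
  rw [sub_mul, sub_mul, sub_sub, sub_prod, sub_prod]
  simp only [sub_at]
  have h3 : sub (Sum.map Sum.inl id) (ats t) = ∏ a, (t a).at
      (fun v => (Sum.inl (Sum.inl v) : (V ⊕ A') ⊕ A)) (Sum.inr a) := sub_ats _ _
  -- The original variables `A` now occur only in their defining constraints, so the terms are
  -- discarded.
  have h4 : ∀ q r : Diag (V ⊕ A'), sm A (sub Sum.inl q * (sub Sum.inl r *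
      sub (Sum.map Sum.inl id) (ats t))) = q * r := by
    intro q r
    rw [← mul_assoc, ← sub_mul, mul_comm, ← sm_mul, ← sub_sm, sm_ats, sub_one, one_mul]
  rw [← h4, h3, sub_sub, sub_ats]
  rfl

/-- The context extended by the variables in `K`. -/
noncomputable def ext {K : Type} [Finite K] (t : C → Term V) : C ⊕ K → Term (V ⊕ K) :=
  Sum.elim (fun c => (t c).map Sum.inl) fun k => var (Sum.inr k)

theorem ev_ext (q : Diag (C ⊕ K)) (t : C → Term V) :
    ev q (ext t) = sm C (sub (Sum.elim Sum.inr fun k => Sum.inl (Sum.inr k)) q *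
      sub (Sum.map Sum.inl id) (ats t)) := by
  have h : ats (ext (K := K) t) = (∏ c, (t c).at (fun v => Sum.inl (Sum.inl v)) (Sum.inr (Sum.inl c))) *
      ∏ k, dl (Sum.inl (Sum.inr k) : (V ⊕ K) ⊕ (C ⊕ K)) (Sum.inr (Sum.inr k)) := by
    rw [ats, Fintype.prod_sum_type]
    simp only [ext, Sum.elim_inl, Sum.elim_inr, map_at, var_at]
  rw [ev, h, sm_sum, ← mul_assoc, sub_mul, sub_prod]
  simp only [sub_dl]
  refine (congrArg (sm C) (sm_mul_dl (fun k : K => (Sum.inl (Sum.inr k) : (V ⊕ K) ⊕ C)) _)).trans ?_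
  rw [sub_sub, sub_mul, sub_sub, sub_prod, sub_ats]
  simp only [sub_at]
  congr 3
  funext x
  rcases x with _ | _ <;> rfl

theorem ev_elim (q : Diag (C ⊕ K)) (t : C → Term V) (s : K → Term V) :
    ev q (Sum.elim t s) = sm K (ev q (ext t) * ats s) := by
  have h : ats (Sum.elim t s) = (∏ c, (t c).at Sum.inl (Sum.inr (Sum.inl c))) *
      ∏ k, (s k).at Sum.inl (Sum.inr (Sum.inr k)) := by
    rw [ats, Fintype.prod_sum_type]
    simp only [Sum.elim_inl, Sum.elim_inr]
  rw [ev, h, sm_sum, sm_comm, ev_ext]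
  simp only [sm_mul, sub_ats, sub_mul, sub_prod, sub_at, sub_sub, mul_assoc]
  congr 3
  congr 1
  funext x
  rcases x with _ | _ <;> rfl

theorem ev_sm (q : Diag (C ⊕ K)) (t : C → Term V) : ev (sm K q) t = sm K (ev q (ext t)) := by
  simp only [ev_ext]
  rw [ev, sub_sm, sm_mul, sm_comm]
  simp only [sub_ats, sub_mul, sub_prod, sub_at, sub_sub]
  congr 4
  funext x
  rcases x with _ | _ <;> rfl

theorem ext_var : ext (K := K) (var : V → Term V) = var := by
  funext x
  rcases x with _ | _
  · exact map_var _ _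
  · rfl

/-- The analogue of `sm_mul_dl` for terms: a bound variable defined by a term is eliminated by
substitution. -/
theorem sm_mul_ats [Fintype V] (q : Diag (V ⊕ K)) (s : K → Term V) :
    sm K (q * ats s) = ev q (Sum.elim var s) := by
  rw [ev_elim, ext_var]
  congr 2
  exact (sub_id q).symm.trans (ev_var q id).symm

theorem ev_at (f : Term A) (t : A → Term V) (g : V → X) (y : X) :
    sub (Sum.elim g fun _ => y) (ev f.val (ext t)) =
      ev f.val (Sum.elim (fun a => (t a).map g) fun _ => var y) := by
  rw [sub_ev]
  congr 1
  funext x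
  rcases x with a | _
  · exact map_map _ _ _
  · exact map_var _ _

/-- Substitution of terms in a term. -/
noncomputable def Term.comp (f : Term A) (t : A → Term V) : Term V where
  val := ev f.val (ext t)
  copy := by
    have h : ∀ b : Bool, sub (Sum.map id fun _ => b) (ev f.val (ext t)) =
        ev (sub (Sum.map id fun _ => b) f.val) (ext t) := by
      intro b
      have e : (Sum.map id fun _ : Unit => b) = Sum.elim (Sum.inl : V → V ⊕ Bool) fun _ => Sum.inr b := by
        funext x; rcases x with _ | _ <;> rfl
      rw [e, ev_at, ev_sub]
      congr 1
      funext x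
      rcases x with _ | _ <;> rfl
    have hd : dl (Sum.inr false : V ⊕ Bool) (Sum.inr true) =
        ev (dl (Sum.inr false : A ⊕ Bool) (Sum.inr true)) (ext t) := by
      rw [dl, dl, ev_sub, ← ev_var]
      congr 1
      funext x
      cases x <;> rfl
    rw [h, h, ← ev_mul, f.copy, ev_mul, hd]
  discard := by rw [← ev_sm, f.discard, ev_one]

theorem comp_at (f : Term A) (t : A → Term V) (g : V → X) (y : X) :
    (f.comp t).at g y = ev f.val (Sum.elim (fun a => (t a).map g) fun _ => var y) :=
  ev_at f t g y

/-- Substitution of a compound term. -/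
theorem ev_elim_comp (q : Diag (C ⊕ Unit)) (s : C → Term V) (f : Term A) (t : A → Term V) :
    ev q (Sum.elim s fun _ => f.comp t) =
      ev (sm Unit (sub (Sum.map Sum.inl id) q * sub (Sum.map Sum.inr id) f.val)) (Sum.elim s t) := by
  have h : ats (fun _ : Unit => f.comp t) = ev f.val (ext t) := by
    rw [ats, Fintype.prod_unique]
    exact Term.at_self _
  rw [ev_elim, h, ev_sm, ev_mul, ev_sub, ev_sub]
  congr 3 <;> (funext x; rcases x with _ | _ <;> rfl)
end

/-! ### The generators as diagrams with variables -/

section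
variable {B C K L L' M T W X : Type} [Finite C] [Finite K] [Finite L] [Finite L'] [Finite M] [Finite T]
  [Finite W] [Finite X] [Finite B]

/-- The H-box with label `a`, whose legs carry the variables `f`. -/
noncomputable def hb (a : ℂ) (f : L → X) : Diag X := sub f ⟦H a L⟧

/-- The scalar `a`. -/
noncomputable def sc (a : ℂ) : Diag X := hb a (Empty.elim : Empty → X)

/-- The unlabelled binary H-box. -/
noncomputable def ed (x y : X) : Diag X := hb (-1) fun t => bif t then y else x

theorem sub_congr {f g : L → X} (h : ∀ l, f l = g l) (q : Diag L) : sub f q = sub g q := by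
  rw [funext h]

theorem hb_congr (a : ℂ) {f g : L → X} (h : ∀ l, f l = g l) : hb a f = hb a g := by
  rw [funext h]

theorem sub_hb (a : ℂ) (f : L → X) (g : X → B) : sub g (hb a f) = hb a fun l => g (f l) :=
  sub_sub _ _ _

theorem hb_equiv (a : ℂ) (e : L ≃ L') (f : L' → X) : hb a (fun l => f (e l)) = hb a f := by
  rw [hb, hb, ← renm_H a e, renm_eq_sub, sub_sub]

theorem sc_eq [IsEmpty L] (a : ℂ) (f : L → X) : hb a f = sc a := by
  rw [sc, ← hb_equiv a (Equiv.equivEmpty L)]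
  congr 1
  funext l
  exact isEmptyElim l

theorem sub_sc (a : ℂ) (g : X → B) : sub g (sc a) = sc a := by
  rw [sc, sub_hb, sc_eq]

theorem sub_ed (x y : X) (g : X → B) : sub g (ed x y) = ed (g x) (g y) := by
  rw [ed, sub_hb, ed]
  congr 1
  funext t
  cases t <;> rfl

theorem ed_comm (x y : X) : ed x y = ed y x := by
  rw [ed, ed, ← hb_equiv _ Equiv.boolNot]
  congr 1
  funext t
  cases t <;> rfl

theorem mk_scale (a : ℂ) (D : ZH B) : (⟦scale a D⟧ : Diag B) = ⟦D⟧ * sc a := by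
  rw [scale, ← renm_mk, ← ten_mk, renm_eq_sub, mul_def, sc, hb, ← sub_id (⟦D⟧ : Diag B), ten_sub,
    sub_sub, sub_id]
  congr 1
  funext x
  rcases x with _ | x
  · rfl
  · exact x.elim

theorem mk_rule {B : Type} {D E : ZH B} (h : Rule D E) : (⟦D⟧ : Diag B) = ⟦E⟧ :=
  Quotient.sound (ZHEq.rule h)

/-- The white spider, whose legs carry the variables `f`. -/
theorem sub_Z_none [Fintype M] (f : Option M → X) :
    sub f (⟦Z (Option M)⟧ : Diag _) = ∏ m, dl (f none) (f (some m)) := by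
  have h := Z_eq (Option M)
  rw [Fintype.prod_option, mul_comm] at h
  have h2 := sm_mul_dl (fun _ : Unit => (none : Option M))
    (∏ m : M, dl (Sum.inr () : Option M ⊕ Unit) (Sum.inl (some m)))
  rw [Fintype.prod_unique (ι := Unit), dl_comm] at h2
  rw [h, h2, sub_sub, sub_prod]
  simp only [sub_dl]
  rfl

/-- The legs of a node of a graph: `j` enumerates the elements that satisfy `P`. -/
noncomputable def fiberEquiv {P : T → Prop} (j : M → T) (hj : Function.Injective j)
    (hP : ∀ t, P t ↔ ∃ m, j m = t) : M ≃ {t // P t} :=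
  Equiv.ofBijective (fun m => ⟨j m, (hP _).2 ⟨m, rfl⟩⟩)
    ⟨fun _ _ h => hj (congrArg Subtype.val h),
      fun t => ((hP _).1 t.2).imp fun _ h => Subtype.ext h⟩

theorem node_H (a : ℂ) {P : T → Prop} (f : T → X) (j : M → T) (hj : Function.Injective j)
    (hP : ∀ t, P t ↔ ∃ m, j m = t) :
    sub (fun l : {t // P t} => f l.1) ⟦H a {t // P t}⟧ = hb a fun m => f (j m) :=
  (hb_equiv a (fiberEquiv j hj hP) fun l => f l.1).symm

theorem node_Z' {P : T → Prop} (f : T → X) (j : M → T) (hj : Function.Injective j)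
    (hP : ∀ t, P t ↔ ∃ m, j m = t) :
    sub (fun l : {t // P t} => f l.1) ⟦Z {t // P t}⟧ = sub (fun m => f (j m)) ⟦Z M⟧ := by
  rw [← renm_Z (fiberEquiv j hj hP), renm_eq_sub, sub_sub]
  rfl

/-- Singling out one leg `t₀` lets the spider be written as deltas without a bound variable of its
own. -/
theorem node_Z [Fintype M] {P : T → Prop} (f : T → X) (t₀ : T) (j : M → T)
    (hj : Function.Injective j) (h₀ : ∀ m, j m ≠ t₀) (hP : ∀ t, P t ↔ t = t₀ ∨ ∃ m, j m = t) :
    sub (fun l : {t // P t} => f l.1) ⟦Z {t // P t}⟧ = ∏ m, dl (f t₀) (f (j m)) := by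
  rw [node_Z' f (fun m : Option M => m.elim t₀ j), sub_Z_none]
  · rfl
  · rintro (_ | m) (_ | m') h
    · rfl
    · exact (h₀ _ h.symm).elim
    · exact (h₀ _ h).elim
    · exact congrArg _ (hj h)
  · intro t
    rw [hP]
    constructor
    · rintro (rfl | ⟨m, rfl⟩)
      · exact ⟨none, rfl⟩
      · exact ⟨some m, rfl⟩
    · rintro ⟨_ | m, rfl⟩
      · exact Or.inl rfl
      · exact Or.inr ⟨m, rfl⟩

theorem mk_graph {ι : Type} [Fintype ι] {node : ι → Spider} {bdry : B → ι} {src tgt : W → ι}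
    (q : ι → Diag (B ⊕ W))
    (h : ∀ i, sub (fun l : {p // Sum.elim bdry (fun p : W × Bool =>
        bif p.2 then tgt p.1 else src p.1) p = i} => Sum.map id Prod.fst l.1)
        (⟦node i _⟧ : Diag _) = q i) :
    (⟦graph node bdry src tgt⟧ : Diag B) = sm W (∏ i, q i) := by
  rw [graph_eq]
  simp only [h]

/-- Removes several wires of a graph at once: the white nodes equate the wires `K` with open ends or
with the remaining wires `C`. -/
theorem sm_subst [Fintype K] (σ : W ≃ C ⊕ K) (h : K → B ⊕ C) (q : Diag (B ⊕ W)) :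
    sm W (q * ∏ k, dl (Sum.map id (fun c => σ.symm (Sum.inl c)) (h k))
      (Sum.inr (σ.symm (Sum.inr k)))) =
    sm C (sub (Sum.elim Sum.inl fun w => Sum.elim Sum.inr h (σ w)) q) := by
  have : Fintype C := Fintype.ofFinite C
  rw [← sm_equiv σ, sm_sum, sub_mul, sub_mul, sub_prod, sub_prod]
  simp only [sub_dl]
  have e : ∀ k, (Equiv.sumAssoc B C K).symm (Sum.map id σ (Sum.map id (fun c => σ.symm (Sum.inl c))
      (h k))) = Sum.inl (h k) := by
    intro k
    rcases h k with _ | _ <;> simp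
  simp only [e, Sum.map_inr, Equiv.apply_symm_apply, Equiv.sumAssoc_symm_apply_inr_inr]
  rw [sm_mul_dl, sub_sub, sub_sub]
  congr 2
  funext x
  rcases x with _ | w
  · rfl
  · simp only [Sum.map_inr, Sum.elim_inr]
    rcases σ w with _ | _ <;> rfl

/-- The grey spider, whose legs carry the variables `f`. -/
noncomputable def xb {L : Type} [Fintype L] (f : L → X) : Diag X :=
  sc (1 / 2) * sm Unit (∏ l, ed (Sum.inr ()) (Sum.inl (f l)))

theorem sub_xb {L : Type} [Fintype L] (f : L → X) (g : X → B) : sub g (xb f) = xb fun l => g (f l) := by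
  rw [xb, sub_mul, sub_sc, sub_sm, sub_prod, xb]
  simp only [sub_ed]
  rfl

theorem xb_equiv {L L' : Type} [Fintype L] [Fintype L'] (e : L ≃ L') (f : L' → X) :
    xb (fun l => f (e l)) = xb f := by
  rw [xb, Equiv.prod_comp e fun l => ed (Sum.inr ()) (Sum.inl (f l)), xb]

theorem mk_xSp (L : Type) [Fintype L] : (⟦xSp L⟧ : Diag L) = xb id := by
  rw [xSp, mk_graph (Sum.elim (fun l => ed (Sum.inl l) (Sum.inr l))
    fun t => bif t then sub Sum.inr ⟦Z L⟧ else sc (1 / 2))]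
  · rw [Fintype.prod_sum_type, Fintype.prod_bool, xb, mul_comm, mul_assoc, mul_comm]
    simp only [Sum.elim_inl, Sum.elim_inr, cond_true, cond_false]
    rw [mul_assoc, mul_comm, ← sub_sc (X := L) _ Sum.inl, ← sm_mul, mul_comm]
    congr 1
    rw [Z_eq, sub_sm, sub_prod, mul_comm, sm_mul, sm_comm, sub_mul, sub_prod, sub_prod, sub_prod]
    simp only [sub_dl, sub_ed, Sum.map_inr, Sum.map_inl]
    rw [mul_comm]
    refine (congrArg (sm Unit) (sm_mul_dl (fun _ => Sum.inr ()) _)).trans ?_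
    rw [sub_prod]
    simp only [sub_ed]
    rw [Finset.prod_congr rfl fun l _ => ed_comm _ _]
    rfl
  · rintro (l | _ | _)
    · refine (node_H (-1) _ (fun t : Bool => bif t then Sum.inr (l, true) else Sum.inl l) ?_ ?_).trans ?_
      · rintro (_ | _) (_ | _) h <;> first | rfl | cases h
      · rintro (l' | ⟨l', _ | _⟩) <;> simp [eq_comm]
      · congr 1
        funext t
        cases t <;> rfl
    · refine (node_H (1 / 2) _ (Empty.elim : Empty → _) ?_ ?_).trans (sc_eq _ _)
      · intro x
        exact x.elim
      · rintro (l' | ⟨l', _ | _⟩) <;> simp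
    · refine node_Z' _ (fun l => Sum.inr (l, false)) ?_ ?_
      · intro l l' h
        simpa using h
      · rintro (l' | ⟨l', _ | _⟩) <;> simp

theorem node_X {M : Type} [Fintype M] {P : T → Prop} (f : T → X) (j : M → T) (hj : Function.Injective j)
    (hP : ∀ t, P t ↔ ∃ m, j m = t) :
    sub (fun l : {t // P t} => f l.1) ⟦xSp {t // P t}⟧ = xb fun m => f (j m) := by
  have : Fintype {t // P t} := Fintype.ofFinite _
  rw [mk_xSp, sub_xb, ← xb_equiv (fiberEquiv j hj hP)]
  rfl

theorem mk_notSp (L : Type) [Fintype L] : (⟦notSp L⟧ : Diag L) =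
    sc (1 / 2) * sm Unit (hb (-1) Sum.inr * ∏ l, ed (Sum.inr ()) (Sum.inl l)) := by
  rw [notSp, mk_graph (Sum.elim (fun l => ed (Sum.inl l) (Sum.inr (some l)))
    ![∏ l, dl (Sum.inr none) (Sum.inr (some l)), hb (-1) fun _ : Unit => Sum.inr none, sc (1 / 2)])]
  · rw [Fintype.prod_sum_type, Fin.prod_univ_three]
    simp only [Sum.elim_inl, Sum.elim_inr, Matrix.cons_val]
    rw [mul_comm, mul_assoc, mul_assoc, mul_comm]
    have h := sm_subst (B := L) ((Equiv.optionEquivSumPUnit L).trans (Equiv.sumComm L Unit))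
      (fun _ => Sum.inr ()) (hb (-1) (fun _ : Unit => Sum.inr none) *
        (sc (1 / 2) * ∏ l, ed (Sum.inl l) (Sum.inr (some l))))
    simp only [Equiv.symm_trans_apply, Equiv.sumComm_symm, Equiv.sumComm_apply,
      Sum.map_inr, Sum.swap_inl, Sum.swap_inr, Equiv.optionEquivSumPUnit_symm_inl,
      Equiv.optionEquivSumPUnit_symm_inr] at h
    rw [h, sub_mul, sub_mul, sub_sc, sub_hb, sub_prod]
    simp only [sub_ed]
    rw [mul_left_comm, ← sub_sc (X := L) (1 / 2) Sum.inl, mul_comm, ← sm_mul, mul_comm]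
    simp only [ed_comm]
    rfl
  · rintro (l | i)
    · refine (node_H (-1) _ (fun t : Bool => bif t then Sum.inr (some l, true) else Sum.inl l)
        ?_ ?_).trans ?_
      · rintro (_ | _) (_ | _) h <;> first | rfl | cases h
      · rintro (l' | ⟨_ | l', _ | _⟩) <;> simp [eq_comm]
      · congr 1
        funext t
        cases t <;> rfl
    · fin_cases i
      · refine node_Z _ (Sum.inr (none, false)) (fun l => Sum.inr (some l, false)) ?_ ?_ ?_
        · intro l l' h
          simpa using h
        · simp
        · rintro (l' | ⟨_ | l', _ | _⟩) <;> simp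
      · refine node_H (-1) _ (fun _ : Unit => Sum.inr (none, true)) ?_ ?_
        · intro _ _ _
          rfl
        · rintro (l' | ⟨_ | l', _ | _⟩) <;> simp
      · refine (node_H (1 / 2) _ (Empty.elim : Empty → _) ?_ ?_).trans (sc_eq _ _)
        · intro x
          exact x.elim
        · rintro (l' | ⟨_ | l', _ | _⟩) <;> simp
end

/-! ### The rules as equations -/

section
variable {B M N X : Type} [Finite B] [Finite X]

/-- The grey spider reads as the parity of the variables `M`, and its value may be handed to `N`
recipients. The case `N = Bool` gives copying, `N = Empty` gives discarding. -/
theorem bialg_grey [Fintype M] [Fintype N] :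
    sm Unit (xb (Sum.elim (fun m : M => (Sum.inl (Sum.inl m) : (M ⊕ N) ⊕ Unit)) fun _ : Unit => Sum.inr ()) *
      ∏ n, dl (Sum.inr ()) (Sum.inl (Sum.inr n))) =
    ∏ n : N, xb (Sum.elim (fun m : M => Sum.inl m) fun _ : Unit => Sum.inr n) := by
  have h := mk_rule (Rule.BA1 M N)
  rw [mk_graph fun t => bif t then ∏ n, dl (Sum.inr ()) (Sum.inl (Sum.inr n)) else
      xb (Sum.elim (fun m : M => (Sum.inl (Sum.inl m) : (M ⊕ N) ⊕ Unit)) fun _ : Unit => Sum.inr ()),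
    mk_graph (Sum.elim (fun m => ∏ n, dl (Sum.inl (Sum.inl m)) (Sum.inr (m, n)))
      fun n => xb (Sum.elim (fun m : M => Sum.inr (m, n)) fun _ : Unit => Sum.inl (Sum.inr n))),
    Fintype.prod_bool, Fintype.prod_sum_type] at h
  · simp only [cond_true, cond_false, Sum.elim_inl, Sum.elim_inr] at h
    rw [mul_comm, h, ← Fintype.prod_prod_type', mul_comm]
    refine (sm_mul_dl (fun p : M × N => (Sum.inl p.1 : M ⊕ N)) _).trans ?_
    rw [sub_prod]
    refine Finset.prod_congr rfl fun n _ => ?_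
    rw [sub_xb]
    congr 1
    funext x
    rcases x with _ | _ <;> rfl
  · rintro (m | n)
    · refine node_Z _ (Sum.inl (Sum.inl m)) (fun n => Sum.inr ((m, n), false)) ?_ ?_ ?_
      · intro n n' h
        simpa using h
      · simp
      · rintro ((m' | n') | ⟨⟨m', n'⟩, _ | _⟩) <;> simp [eq_comm]
    · refine (node_X _ (Sum.elim (fun m => Sum.inr ((m, n), true)) fun _ : Unit => Sum.inl (Sum.inr n))
        ?_ ?_).trans ?_
      · rintro (_ | _) (_ | _) h <;> simp at h <;> simp [h]
      · rintro ((m' | n') | ⟨⟨m', n'⟩, _ | _⟩) <;> simp [eq_comm]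
      · congr 1
        funext x
        rcases x with _ | _ <;> rfl
  · rintro (_ | _)
    · refine (node_X _ (Sum.elim (fun m : M => Sum.inl (Sum.inl m)) fun _ : Unit => Sum.inr ((), false))
        ?_ ?_).trans ?_
      · rintro (_ | _) (_ | _) h <;> simp at h <;> simp [h]
      · rintro ((m' | n') | ⟨_, _ | _⟩) <;> simp
      · congr 1
        funext x
        rcases x with _ | _ <;> rfl
    · refine node_Z _ (Sum.inr ((), true)) (fun n => Sum.inl (Sum.inr n)) ?_ ?_ ?_
      · intro n n' h
        simpa using h
      · simp
      · rintro ((m' | n') | ⟨_, _ | _⟩) <;> simp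

theorem bialg_H [Fintype M] [Fintype N] :
    sm Unit (hb (-1) (Sum.elim (fun m : M => (Sum.inl (Sum.inl m) : (M ⊕ N) ⊕ Unit)) fun _ : Unit => Sum.inr ()) *
      xb (Sum.elim (fun n : N => Sum.inl (Sum.inr n)) fun _ : Unit => Sum.inr ())) =
    ∏ n : N, hb (-1) (Sum.elim (fun m : M => Sum.inl m) fun _ : Unit => Sum.inr n) := by
  have h := mk_rule (Rule.BA2 M N)
  rw [mk_graph fun t => bif t then
        xb (Sum.elim (fun n : N => Sum.inl (Sum.inr n)) fun _ : Unit => Sum.inr ()) else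
      hb (-1) (Sum.elim (fun m : M => (Sum.inl (Sum.inl m) : (M ⊕ N) ⊕ Unit)) fun _ : Unit => Sum.inr ()),
    mk_graph (Sum.elim (fun m => ∏ n, dl (Sum.inl (Sum.inl m)) (Sum.inr (m, n)))
      fun n => hb (-1) (Sum.elim (fun m : M => Sum.inr (m, n)) fun _ : Unit => Sum.inl (Sum.inr n))),
    Fintype.prod_bool, Fintype.prod_sum_type] at h
  · simp only [cond_true, cond_false, Sum.elim_inl, Sum.elim_inr] at h
    rw [mul_comm, h, ← Fintype.prod_prod_type', mul_comm]
    refine (sm_mul_dl (fun p : M × N => (Sum.inl p.1 : M ⊕ N)) _).trans ?_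
    rw [sub_prod]
    refine Finset.prod_congr rfl fun n _ => ?_
    rw [sub_hb]
    congr 1
    funext x
    rcases x with _ | _ <;> rfl
  · rintro (m | n)
    · refine node_Z _ (Sum.inl (Sum.inl m)) (fun n => Sum.inr ((m, n), false)) ?_ ?_ ?_
      · intro n n' h
        simpa using h
      · simp
      · rintro ((m' | n') | ⟨⟨m', n'⟩, _ | _⟩) <;> simp [eq_comm]
    · refine (node_H (-1) _ (Sum.elim (fun m => Sum.inr ((m, n), true)) fun _ : Unit => Sum.inl (Sum.inr n))
        ?_ ?_).trans ?_
      · rintro (_ | _) (_ | _) h <;> simp at h <;> simp [h]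
      · rintro ((m' | n') | ⟨⟨m', n'⟩, _ | _⟩) <;> simp [eq_comm]
      · congr 1
        funext x
        rcases x with _ | _ <;> rfl
  · rintro (_ | _)
    · refine (node_H (-1) _ (Sum.elim (fun m : M => Sum.inl (Sum.inl m)) fun _ : Unit => Sum.inr ((), false))
        ?_ ?_).trans ?_
      · rintro (_ | _) (_ | _) h <;> simp at h <;> simp [h]
      · rintro ((m' | n') | ⟨_, _ | _⟩) <;> simp
      · congr 1
        funext x
        rcases x with _ | _ <;> rfl
    · refine (node_X _ (Sum.elim (fun n : N => Sum.inl (Sum.inr n)) fun _ : Unit => Sum.inr ((), true))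
        ?_ ?_).trans ?_
      · rintro (_ | _) (_ | _) h <;> simp at h <;> simp [h]
      · rintro ((m' | n') | ⟨_, _ | _⟩) <;> simp
      · congr 1
        funext x
        rcases x with _ | _ <;> rfl

theorem fuse_H (a : ℂ) [Finite M] [Finite N] :
    sm Bool (hb a (Sum.elim (fun m : M => (Sum.inl (Sum.inl m) : (M ⊕ N) ⊕ Bool)) fun _ : Unit => Sum.inr false) *
      ed (Sum.inr false) (Sum.inr true) *
      hb (-1) (Sum.elim (fun n : N => (Sum.inl (Sum.inr n) : (M ⊕ N) ⊕ Bool)) fun _ : Unit => Sum.inr true)) =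
    hb a (id : M ⊕ N → M ⊕ N) * sc 2 := by
  have h := mk_rule (Rule.HS1 (B := M ⊕ N) a (Sum.elim (fun _ => false) fun _ => true))
  rw [mk_scale, mk_graph ![hb a (Sum.elim (fun m : M => (Sum.inl (Sum.inl m) : (M ⊕ N) ⊕ Fin 2)) fun _ : Unit => Sum.inr 0),
    ed (Sum.inr 0) (Sum.inr 1), hb (-1) (Sum.elim (fun n : N => (Sum.inl (Sum.inr n) : (M ⊕ N) ⊕ Fin 2)) fun _ : Unit => Sum.inr 1)],
    Fin.prod_univ_three, ← sm_equiv finTwoEquiv] at h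
  · simp only [Matrix.cons_val, sub_mul, sub_hb, sub_ed] at h
    have h2 : hb a (id : M ⊕ N → M ⊕ N) = ⟦H a (M ⊕ N)⟧ := sub_id _
    rw [h2, ← h]
    congr 2
    · congr 2
      funext x
      rcases x with _ | _ <;> rfl
    · congr 1
      funext x
      rcases x with _ | _ <;> rfl
  · intro i
    fin_cases i
    · refine (node_H a _ (Sum.elim (fun m : M => Sum.inl (Sum.inl m)) fun _ : Unit => Sum.inr (0, false))
        ?_ ?_).trans ?_
      · rintro (_ | _) (_ | _) h <;> simp at h <;> simp [h]
      · rintro ((m' | n') | ⟨i, _ | _⟩) <;> try fin_cases i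
        all_goals simp
      · congr 1
        funext x
        rcases x with _ | _ <;> rfl
    · refine (node_H (-1) _ (fun t : Bool => bif t then Sum.inr (1, false) else Sum.inr (0, true))
        ?_ ?_).trans ?_
      · rintro (_ | _) (_ | _) h <;> simp at h <;> simp
      · rintro ((m' | n') | ⟨i, _ | _⟩) <;> try fin_cases i
        all_goals simp
      · congr 1
        funext x
        cases x <;> rfl
    · refine (node_H (-1) _ (Sum.elim (fun n : N => Sum.inl (Sum.inr n)) fun _ : Unit => Sum.inr (1, true))
        ?_ ?_).trans ?_
      · rintro (_ | _) (_ | _) h <;> simp at h <;> simp [h]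
      · rintro ((m' | n') | ⟨i, _ | _⟩) <;> try fin_cases i
        all_goals simp
      · congr 1
        funext x
        rcases x with _ | _ <;> rfl

theorem sm_ed_ed (x y : X) : sm Unit (ed (Sum.inl x) (Sum.inr ()) * ed (Sum.inr ()) (Sum.inl y)) =
    dl x y * sc 2 := by
  have h := mk_rule Rule.HS2
  rw [mk_scale, mk_graph fun t => bif t then ed (Sum.inr ()) (Sum.inl true) else ed (Sum.inl false) (Sum.inr ()),
    Fintype.prod_bool, mul_comm] at h
  · have h2 := congrArg (sub fun t : Bool => bif t then y else x) h
    rw [sub_sm, sub_mul, sub_mul, sub_sc] at h2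
    simp only [cond_true, cond_false, sub_ed] at h2
    exact h2
  · rintro (_ | _)
    · refine (node_H (-1) _ (fun t : Bool => bif t then Sum.inr ((), false) else Sum.inl false)
        ?_ ?_).trans ?_
      · rintro (_ | _) (_ | _) h <;> simp at h <;> simp
      · rintro ((_ | _) | ⟨i, _ | _⟩) <;> simp
      · congr 1
        funext x
        cases x <;> rfl
    · refine (node_H (-1) _ (fun t : Bool => bif t then Sum.inl true else Sum.inr ((), true))
        ?_ ?_).trans ?_
      · rintro (_ | _) (_ | _) h <;> simp at h <;> simp
      · rintro ((_ | _) | ⟨i, _ | _⟩) <;> simp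
      · congr 1
        funext x
        cases x <;> rfl

theorem hb_mul (a b : ℂ) (f : Unit → X) : hb a f * hb b f = hb (a * b) f := by
  have h := mk_rule (Rule.M a b)
  rw [mk_graph ![∏ i : Fin 2, dl (Sum.inl ()) (Sum.inr i), hb a fun _ : Unit => Sum.inr 0,
      hb b fun _ : Unit => Sum.inr 1], Fin.prod_univ_three, mul_assoc, mul_comm] at h
  · have h2 := (sm_mul_dl (fun _ : Fin 2 => ())
      (hb a (fun _ : Unit => Sum.inr 0) * hb b fun _ : Unit => Sum.inr 1)).symm.trans h
    have h3 := congrArg (sub f) h2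
    rw [sub_mul, sub_mul] at h3
    simp only [sub_hb] at h3
    exact h3
  · intro i
    fin_cases i
    · refine node_Z _ (Sum.inl ()) (fun i => Sum.inr (i, false)) ?_ ?_ ?_
      · intro i j h
        simpa using h
      · simp
      · rintro (_ | ⟨i, _ | _⟩) <;> try fin_cases i
        all_goals simp
    · refine node_H a _ (fun _ : Unit => Sum.inr (0, true)) ?_ ?_
      · intro _ _ _
        rfl
      · rintro (_ | ⟨i, _ | _⟩) <;> try fin_cases i
        all_goals simp
    · refine node_H b _ (fun _ : Unit => Sum.inr (1, true)) ?_ ?_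
      · intro _ _ _
        rfl
      · rintro (_ | ⟨i, _ | _⟩) <;> try fin_cases i
        all_goals simp

theorem hb_one (f : Unit → X) : hb 1 f = 1 := by
  have h := Z_eq Unit
  rw [Fintype.prod_unique, dl_comm] at h
  rw [hb, mk_rule Rule.U, h, sm_dl (), sub_one]

end

/-! ### The NOT gate and the rules intro and ortho. -/

section
variable {M T X : Type} [Finite T] [Finite X]

/-- The NOT gate between two variables. -/
noncomputable def nt (x y : X) : Diag X := sub (fun t => bif t then y else x) ⟦notSp Bool⟧

theorem nt_eq (x y : X) : nt x y =
    sc (1 / 2) * sm Unit (hb (-1) Sum.inr * (ed (Sum.inr ()) (Sum.inl x) * ed (Sum.inr ()) (Sum.inl y))) := by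
  rw [nt, mk_notSp, sub_mul, sub_sc, sub_sm, sub_mul, sub_hb, sub_prod]
  simp only [sub_ed]
  rw [Fintype.prod_bool, mul_comm (ed _ _) (ed _ _)]
  rfl

theorem sub_nt {Y : Type} [Finite Y] (x y : X) (g : X → Y) : sub g (nt x y) = nt (g x) (g y) := by
  rw [nt, sub_sub, nt]
  congr 1
  funext t
  cases t <;> rfl

theorem node_not {P : T → Prop} (f : T → X) (j : Bool → T) (hj : Function.Injective j)
    (hP : ∀ t, P t ↔ ∃ m, j m = t) :
    sub (fun l : {t // P t} => f l.1) ⟦notSp {t // P t}⟧ = nt (f (j false)) (f (j true)) := by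
  have : Fintype {t // P t} := Fintype.ofFinite _
  rw [mk_notSp, nt, mk_notSp, sub_mul, sub_mul, sub_sc, sub_sc, sub_sm, sub_sm, sub_mul, sub_mul,
    sub_hb, sub_hb, sub_prod, sub_prod, ← Equiv.prod_comp (fiberEquiv j hj hP)]
  simp only [sub_ed, Fintype.prod_bool]
  rfl

/-- In exponents, `a^x = a^(xy) a^(x¬y)`: the bound variable is the negation of `y`. -/
theorem intro_H (a : ℂ) (x y : X) :
    hb a (fun _ : Unit => x) = hb a (fun t : Bool => bif t then y else x) *
      sm Unit (hb a (fun t : Bool => bif t then Sum.inr () else Sum.inl x) * nt (Sum.inl y) (Sum.inr ())) := by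
  have h := mk_rule (Rule.I a)
  let σ : Fin 5 ≃ Unit ⊕ Fin 4 :=
    { toFun := ![Sum.inr 0, Sum.inr 1, Sum.inr 2, Sum.inr 3, Sum.inl ()]
      invFun := Sum.elim (fun _ => 4) ![0, 1, 2, 3]
      left_inv := by intro i; fin_cases i <;> rfl
      right_inv := by rintro (_ | i) <;> [rfl; (fin_cases i <;> rfl)] }
  rw [mk_graph ![hb a fun _ : Unit => Sum.inl 0, 1],
    mk_graph ![dl (Sum.inl 0) (Sum.inr 0) * dl (Sum.inl 0) (Sum.inr 2),
      dl (Sum.inl 1) (Sum.inr 1) * dl (Sum.inl 1) (Sum.inr 3),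
      hb a fun t : Bool => bif t then Sum.inr 1 else Sum.inr 0,
      hb a fun t : Bool => bif t then Sum.inr 4 else Sum.inr 2, nt (Sum.inr 3) (Sum.inr 4)],
    Fin.prod_univ_two, Fin.prod_univ_five] at h
  · have h2 := sm_subst σ ![Sum.inl 0, Sum.inl 1, Sum.inl 0, Sum.inl 1]
      ((hb a fun t : Bool => bif t then Sum.inr 1 else Sum.inr 0) *
      ((hb a fun t : Bool => bif t then Sum.inr 4 else Sum.inr 2) * nt (Sum.inr 3) (Sum.inr 4)) :
        Diag (Fin 2 ⊕ Fin 5))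
    have h3 : sm Empty (hb a (fun _ : Unit => Sum.inl (0 : Fin 2))) = hb a fun _ : Unit => (0 : Fin 2) := by
      have := sm_mul_dl (Empty.elim : Empty → Fin 2) (hb a (fun _ : Unit => Sum.inl (0 : Fin 2)))
      simpa [sub_hb] using this
    simp only [Matrix.cons_val, mul_one] at h
    rw [h3] at h
    have h4 : ∀ p q r s t u v : Diag (Fin 2 ⊕ Fin 5), p * q * (r * s) * t * u * v =
        t * (u * v) * (p * r * q * s) := by
      intro p q r s t u v
      ac_rfl
    rw [h4] at h
    rw [Fin.prod_univ_four] at h2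
    have h5 := h.trans h2
    rw [sub_mul, sub_mul, sub_hb, sub_hb, sub_nt] at h5
    have h6 : (fun l : Bool => Sum.elim (Sum.inl : Fin 2 → Fin 2 ⊕ Unit)
        (fun w => Sum.elim Sum.inr ![Sum.inl 0, Sum.inl 1, Sum.inl 0, Sum.inl 1] (σ w))
        (bif l then (Sum.inr 1 : Fin 2 ⊕ Fin 5) else Sum.inr 0)) = fun l => Sum.inl (bif l then 1 else 0) := by
      funext l
      cases l <;> rfl
    rw [h6, ← sub_hb a (fun l : Bool => bif l then (1 : Fin 2) else 0) Sum.inl, mul_comm, ← sm_mul,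
      mul_comm] at h5
    have h7 := congrArg (sub ![x, y]) h5
    rw [sub_hb, sub_mul, sub_hb, sub_sm, sub_mul, sub_hb, sub_nt] at h7
    refine h7.trans ?_
    congr 2
    · funext l
      cases l <;> rfl
    · congr 2
      funext l
      cases l <;> rfl
  · intro i
    fin_cases i
    · refine (node_Z _ (Sum.inl 0) (![Sum.inr (0, false), Sum.inr (2, false)]) ?_ ?_ ?_).trans
        (Fin.prod_univ_two _)
      · decide
      · decide
      · decide
    · refine (node_Z _ (Sum.inl 1) (![Sum.inr (1, false), Sum.inr (3, false)]) ?_ ?_ ?_).trans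
        (Fin.prod_univ_two _)
      · decide
      · decide
      · decide
    · refine (node_H a _ (fun t : Bool => bif t then Sum.inr (1, true) else Sum.inr (0, true)) ?_ ?_).trans ?_
      · decide
      · decide
      · congr 1
        funext t
        cases t <;> rfl
    · refine (node_H a _ (fun t : Bool => bif t then Sum.inr (4, true) else Sum.inr (2, true)) ?_ ?_).trans ?_
      · decide
      · decide
      · congr 1
        funext t
        cases t <;> rfl
    · refine node_not _ (fun t : Bool => bif t then Sum.inr (4, false) else Sum.inr (3, true)) ?_ ?_
      · decide
      · decide
  · intro i
    fin_cases i
    · refine node_H a _ (fun _ : Unit => Sum.inl 0) ?_ ?_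
      · decide
      · rintro (i | i)
        · fin_cases i <;> decide
        · exact i.1.elim
    · refine (node_Z _ (Sum.inl 1) (Empty.elim : Empty → _) ?_ ?_ ?_).trans
        (Finset.prod_empty)
      · decide
      · decide
      · rintro (i | i)
        · fin_cases i <;> decide
        · exact i.1.elim

/-- Bound variable `false` (or `0` on the right) is the negation of `x`. Thus `px` and `q¬x` are
never both active, which is why the sum over the shared sign variable factors into two sums. -/
theorem ortho_H (x p q : X) :
    sm Bool (hb (-1) ![Sum.inl p, Sum.inl x, Sum.inr true] *
      (hb (-1) ![Sum.inl q, Sum.inr false, Sum.inr true] * nt (Sum.inl x) (Sum.inr false))) =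
    sm (Fin 3) (hb (-1) ![Sum.inl p, Sum.inl x, Sum.inr 1] *
      (hb (-1) ![Sum.inl q, Sum.inr 0, Sum.inr 2] * nt (Sum.inl x) (Sum.inr 0))) * sc (1 / 2) := by
  have h := mk_rule Rule.O
  let σ : Fin 5 ≃ Bool ⊕ Fin 3 :=
    { toFun := ![Sum.inr 0, Sum.inr 1, Sum.inl false, Sum.inl true, Sum.inr 2]
      invFun := Sum.elim (fun t => bif t then 3 else 2) ![0, 1, 4]
      left_inv := by decide
      right_inv := by decide }
  let τ : Fin 5 ≃ Fin 3 ⊕ Fin 2 :=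
    { toFun := ![Sum.inr 0, Sum.inr 1, Sum.inl 0, Sum.inl 1, Sum.inl 2]
      invFun := Sum.elim ![2, 3, 4] ![0, 1]
      left_inv := by decide
      right_inv := by decide }
  rw [mk_scale, mk_graph ![dl (Sum.inl 0) (Sum.inr 0) * dl (Sum.inl 0) (Sum.inr 1),
      hb (-1) ![Sum.inl 1, Sum.inr 0, Sum.inr 3], hb (-1) ![Sum.inl 2, Sum.inr 2, Sum.inr 4],
      nt (Sum.inr 1) (Sum.inr 2), dl (Sum.inr 3) (Sum.inr 4)],
    mk_graph ![dl (Sum.inl 0) (Sum.inr 0) * dl (Sum.inl 0) (Sum.inr 1),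
      hb (-1) ![Sum.inl 1, Sum.inr 0, Sum.inr 3], hb (-1) ![Sum.inl 2, Sum.inr 2, Sum.inr 4],
      nt (Sum.inr 1) (Sum.inr 2), 1, 1], Fin.prod_univ_five, Fin.prod_univ_six] at h
  · have h1 := sm_subst σ ![Sum.inl 0, Sum.inl 0, Sum.inr true]
      (hb (-1) ![Sum.inl 1, Sum.inr 0, Sum.inr 3] * (hb (-1) ![Sum.inl 2, Sum.inr 2, Sum.inr 4] *
      nt (Sum.inr 1) (Sum.inr 2)) : Diag (Fin 3 ⊕ Fin 5))
    have h2 := sm_subst τ ![Sum.inl 0, Sum.inl 0]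
      (hb (-1) ![Sum.inl 1, Sum.inr 0, Sum.inr 3] * (hb (-1) ![Sum.inl 2, Sum.inr 2, Sum.inr 4] *
      nt (Sum.inr 1) (Sum.inr 2)) : Diag (Fin 3 ⊕ Fin 5))
    rw [Fin.prod_univ_three] at h1
    rw [Fin.prod_univ_two] at h2
    simp only [Matrix.cons_val, mul_one] at h
    have h3 : ∀ p q t u v : Diag (Fin 3 ⊕ Fin 5), p * q * t * u * v = t * (u * v) * (p * q) := by
      intro p q t u v
      ac_rfl
    have h4 : ∀ p q t u v w : Diag (Fin 3 ⊕ Fin 5), p * q * t * u * v * w =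
        t * (u * v) * (p * q * w) := by
      intro p q t u v w
      ac_rfl
    rw [h4, h3] at h
    have h5 := h1.symm.trans (h.trans (congrArg (· * sc (1 / 2)) h2))
    simp only [sub_mul, sub_hb, sub_nt] at h5
    have h6 := congrArg (sub ![x, p, q]) h5
    simp only [sub_mul, sub_hb, sub_nt, sub_sm, sub_sc] at h6
    refine Eq.trans ?_ (h6.trans ?_)
    · congr 2
      · congr 1
        funext i
        fin_cases i <;> rfl
      · congr 2
        funext i
        fin_cases i <;> rfl
    · congr 3
      · congr 1
        funext i
        fin_cases i <;> rfl
      · congr 2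
        funext i
        fin_cases i <;> rfl
  · intro i
    fin_cases i
    · refine (node_Z _ (Sum.inl 0) (![Sum.inr (0, false), Sum.inr (1, false)]) ?_ ?_ ?_).trans
        (Fin.prod_univ_two _) <;> decide
    · refine (node_H (-1) _ ![Sum.inl 1, Sum.inr (0, true), Sum.inr (3, true)] ?_ ?_).trans ?_
      · decide
      · decide
      · congr 1
        funext t
        fin_cases t <;> rfl
    · refine (node_H (-1) _ ![Sum.inl 2, Sum.inr (2, true), Sum.inr (4, true)] ?_ ?_).trans ?_
      · decide
      · decide
      · congr 1
        funext t
        fin_cases t <;> rfl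
    · refine node_not _ (fun t : Bool => bif t then Sum.inr (2, false) else Sum.inr (1, true)) ?_ ?_ <;>
        decide
    · refine (node_Z _ (Sum.inr (3, false)) (Empty.elim : Empty → _) ?_ ?_ ?_).trans
        Finset.prod_empty <;> decide
    · refine (node_Z _ (Sum.inr (4, false)) (Empty.elim : Empty → _) ?_ ?_ ?_).trans
        Finset.prod_empty <;> decide
  · intro i
    fin_cases i
    · refine (node_Z _ (Sum.inl 0) (![Sum.inr (0, false), Sum.inr (1, false)]) ?_ ?_ ?_).trans
        (Fin.prod_univ_two _) <;> decide
    · refine (node_H (-1) _ ![Sum.inl 1, Sum.inr (0, true), Sum.inr (3, true)] ?_ ?_).trans ?_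
      · decide
      · decide
      · congr 1
        funext t
        fin_cases t <;> rfl
    · refine (node_H (-1) _ ![Sum.inl 2, Sum.inr (2, true), Sum.inr (4, true)] ?_ ?_).trans ?_
      · decide
      · decide
      · congr 1
        funext t
        fin_cases t <;> rfl
    · refine node_not _ (fun t : Bool => bif t then Sum.inr (2, false) else Sum.inr (1, true)) ?_ ?_ <;>
        decide
    · refine (node_Z _ (Sum.inr (3, false)) (fun _ : Unit => Sum.inr (4, false)) ?_ ?_ ?_).trans
        (Fintype.prod_unique _) <;> decide
end

/-! ### Exclusive or, and conjunction -/

section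
variable {L V X K N : Type} [Finite V] [Finite X] [Fintype L] [Fintype K] [Fintype N]

theorem prod_sm_unit (q : K → Diag (X ⊕ Unit)) :
    ∏ k, sm Unit (q k) = sm K (∏ k, sub (Sum.map id fun _ => k) (q k)) := by
  rw [prod_sm, ← sm_equiv (Equiv.sigmaPUnit K), sub_prod]
  simp only [sub_sub]
  congr 1
  refine Finset.prod_congr rfl fun a _ => ?_
  congr 1
  funext x
  rcases x with _ | _ <;> rfl

theorem sm_bool (q : Diag (X ⊕ Bool)) : sm Bool q = sm Unit (sm Unit
    (sub (Sum.elim (fun x => Sum.inl (Sum.inl x)) fun b => bif b then Sum.inr () else Sum.inl (Sum.inr ()))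
      q)) := by
  rw [← sm_equiv Equiv.boolEquivPUnitSumPUnit, sm_sm, sub_sub]
  congr 2
  funext x
  rcases x with _ | _ | _ <;> rfl

theorem sm_xb (f : L → X) :
    sm Unit (xb (Sum.elim (fun l => Sum.inl (f l)) fun _ : Unit => Sum.inr ())) = 1 := by
  have h := congrArg (sub (Sum.elim f Empty.elim)) (bialg_grey (M := L) (N := Empty))
  simp only [Finset.univ_eq_empty, Finset.prod_empty, mul_one] at h
  rw [sub_one, sub_sm, sub_xb] at h
  rw [← h]
  congr 2
  funext x
  rcases x with _ | _ <;> rfl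

theorem xb_pair (x y : X) : xb (Sum.elim (fun _ : Unit => x) fun _ : Unit => y) =
    dl x y * (sc (1 / 2) * sc 2) := by
  rw [xb, Fintype.prod_sum_type, Fintype.prod_unique, Fintype.prod_unique]
  simp only [Sum.elim_inl, Sum.elim_inr]
  rw [ed_comm, sm_ed_ed, mul_left_comm]

/-- No rule multiplies these scalars directly. The binary grey spider is a delta times this product,
and both the spider and the delta have sum 1 over their last leg. -/
theorem sc_half_two : sc (1 / 2) * sc 2 = (1 : Diag X) := by
  have h1 : sc (1 / 2) * sc 2 = (1 : Diag Unit) := by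
    have h := sm_xb (fun _ : Unit => ())
    rw [xb_pair, ← sub_sc (X := Unit) (1 / 2) Sum.inl, ← sub_sc (X := Unit) 2 Sum.inl, ← sub_mul,
      ← sm_mul, sm_dl, one_mul] at h
    exact h
  have h2 : sc (1 / 2) * sc 2 = (1 : Diag Empty) := by
    have h := congrArg (sub (Sum.inr : Unit → Empty ⊕ Unit)) h1
    rw [sub_mul, sub_sc, sub_sc, sub_one] at h
    -- The argument above needs a free variable. Without one, the diagram `1` is written as a sum
    -- over a new variable, and `h` applies inside.
    rw [← one_mul (sc (1 / 2) * sc 2 : Diag Empty), ← sm_xb (Empty.elim : Empty → Empty), sm_mul,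
      sub_mul, sub_sc, sub_sc, h, mul_one]
  have h := congrArg (sub (Empty.elim : Empty → X)) h2
  rwa [sub_mul, sub_sc, sub_sc, sub_one] at h

theorem xb_copy (f : L → X) (y z : X) :
    xb (Sum.elim f fun _ : Unit => y) * xb (Sum.elim f fun _ : Unit => z) =
      xb (Sum.elim f fun _ : Unit => y) * dl y z := by
  have h := bialg_grey (M := L) (N := Bool)
  have h2 := sm_mul_dl (fun _ : Unit => (Sum.inr false : L ⊕ Bool))
    (xb (Sum.elim (fun l => Sum.inl (Sum.inl l)) fun _ : Unit => Sum.inr ()) *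
      dl (Sum.inr ()) (Sum.inl (Sum.inr true)))
  rw [Fintype.prod_unique, dl_comm (Sum.inl _), sub_mul, sub_xb, sub_dl] at h2
  rw [Fintype.prod_bool, Fintype.prod_bool, ← mul_assoc] at h
  have h3 := congrArg (sub (Sum.elim f fun t => bif t then z else y)) (h2.symm.trans h)
  rw [sub_mul, sub_mul, sub_xb, sub_xb, sub_xb, sub_dl, mul_comm (xb _) (xb _)] at h3
  have e : ∀ t : Bool, xb (fun l => (Sum.elim f fun t => bif t then z else y : L ⊕ Bool → X)
      ((Sum.elim (fun m => Sum.inl m) fun _ : Unit => Sum.inr t : L ⊕ Unit → L ⊕ Bool) l)) =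
      xb (Sum.elim f fun _ : Unit => bif t then z else y) := by
    intro t
    congr 1
    funext x
    rcases x with _ | _ <;> rfl
  rw [e, e] at h3
  refine h3.symm.trans ?_
  congr 2
  funext x
  rcases x with _ | _ <;> rfl

variable (L) in
/-- The exclusive or of the variables in `L`. -/
noncomputable def xorG : Term L where
  val := xb (Sum.elim Sum.inl fun _ : Unit => Sum.inr ())
  copy := by
    have e : ∀ t : Bool, sub (Sum.map (id : L → L) fun _ : Unit => t)
        (xb (Sum.elim Sum.inl fun _ : Unit => (Sum.inr () : L ⊕ Unit))) =
        xb (Sum.elim (Sum.inl : L → L ⊕ Bool) fun _ : Unit => Sum.inr t) := by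
      intro t
      rw [sub_xb]
      congr 1
      funext x
      rcases x with _ | _ <;> rfl
    rw [e, e, xb_copy]
  discard := sm_xb id

/-- The Hadamard transform with respect to the last variable. -/
noncomputable def had (q : Diag (V ⊕ Unit)) : Diag (V ⊕ Unit) :=
  sm Unit (sub (Sum.map Sum.inl id) q * ed (Sum.inl (Sum.inr ())) (Sum.inr ()))

/-- By (HS2), two consecutive Hadamard edges make a delta and the factor 2. -/
theorem had_had (q : Diag (V ⊕ Unit)) : had (had q) = q * sc 2 := by
  rw [had, had, sub_sm, sm_mul, sm_comm]
  simp only [sub_mul, sub_sub, sub_ed, Sum.map_inl, Sum.map_inr, Sum.elim_inl, Sum.elim_inr, id]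
  have h : ∀ q' : Diag ((V ⊕ Unit) ⊕ Unit), sm Unit (sub Sum.inl q' *
      (ed (Sum.inl (Sum.inr ())) (Sum.inr ()) * ed (Sum.inr ()) (Sum.inl (Sum.inl (Sum.inr ()))))) =
      q' * sc 2 * ∏ _i : Unit, dl (Sum.inl (Sum.inr ())) (Sum.inr ()) := by
    intro q'
    rw [mul_comm, ← sm_mul, sm_ed_ed, Fintype.prod_unique, dl_comm, mul_comm, mul_assoc,
      mul_comm (sc 2)]
  have h2 := h (sub (Sum.map Sum.inl id) q)
  rw [sub_sub] at h2
  rw [mul_assoc]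
  refine (congrArg (sm Unit) (Eq.trans ?_ h2)).trans ((sm_mul_dl _ _).trans ?_)
  · rw [ed_comm (Sum.inl (Sum.inl (Sum.inr ()))), ed_comm (Sum.inr ())]
    congr 2
    · congr 1
      funext x
      rcases x with _ | _ <;> rfl
  · rw [sub_mul, sub_sub, sub_sc]
    conv_rhs => rw [← sub_id q]
    congr 2
    funext x
    rcases x with _ | _ <;> rfl

theorem had_inj {q r : Diag (V ⊕ Unit)} (h : had q = had r) : q = r := by
  have h2 := congrArg had h
  rw [had_had, had_had] at h2
  have h3 : q * sc 2 * sc (1 / 2) = r * sc 2 * sc (1 / 2) := by rw [h2]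
  rwa [mul_assoc, mul_assoc, mul_comm (sc 2), sc_half_two, mul_one, mul_one] at h3

theorem had_mul (q : Diag (V ⊕ Unit)) (r : Diag V) : had (q * sub Sum.inl r) = had q * sub Sum.inl r := by
  rw [had, had, sm_mul, sub_mul, sub_sub, sub_sub, mul_right_comm]
  rfl

theorem sub_had (g : V → X) (q : Diag (V ⊕ Unit)) :
    sub (Sum.map g id) (had q) = had (sub (Sum.map g id) q) := by
  rw [had, had, sub_sm, sub_mul, sub_ed, sub_sub, sub_sub]
  congr 3
  funext x
  rcases x with _ | _ <;> rfl

/-- The Hadamard transform has a symmetric kernel, hence is self-adjoint for the summation pairing.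
-/
theorem sm_had (q r : Diag (V ⊕ Unit)) : sm Unit (had q * r) = sm Unit (q * had r) := by
  rw [had, had, sm_mul, mul_comm q, sm_mul, sm_comm]
  have e1 : ∀ {f g : V ⊕ Unit → (V ⊕ Unit) ⊕ Unit}, (∀ x, f x = g x) → ∀ q, sub f q = sub g q :=
    fun h q => by rw [funext h]
  simp only [sub_mul, sub_sub, sub_ed, Sum.map_inr, Sum.elim_inl, Sum.elim_inr, id]
  rw [e1 (g := Sum.inl) (by rintro (_ | _) <;> rfl) q,
    e1 (g := Sum.map Sum.inl id) (by rintro (_ | _) <;> rfl) r, mul_right_comm, mul_comm (sub _ q),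
    mul_right_comm, ed_comm]

theorem had_prod_ed (f : N → V) : had (∏ n, ed (Sum.inr ()) (Sum.inl (f n))) * sc (1 / 2) =
    xb (Sum.elim (fun n => Sum.inl (f n)) fun _ : Unit => Sum.inr ()) := by
  rw [had, sub_prod, xb, Fintype.prod_sum_type, Fintype.prod_unique (ι := Unit), mul_comm]
  simp only [sub_ed, Sum.elim_inl, Sum.elim_inr]
  rw [ed_comm (Sum.inl (Sum.inr ()))]
  rfl

variable (L) in
/-- The diagram for the conjunction of the variables in `L`. -/
noncomputable def andD : Diag (L ⊕ Unit) := had (hb (-1) id) * sc (1 / 2)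

theorem had_andD : had (andD L) = hb (-1) id := by
  rw [andD, ← sub_sc (X := L) _ Sum.inl, had_mul, had_had, sub_sc, mul_assoc, mul_comm (sc 2),
    sc_half_two, mul_one]

/-- This is (BA2) with the Hadamard transform moved by self-adjointness: the grey spider is, up to
½, the transform of the product of edges, and `andD` that of the H-box. -/
theorem sm_andD : sm Unit (sub (Sum.map Sum.inl id) (andD L) *
      ∏ n : N, ed (Sum.inr ()) (Sum.inl (Sum.inr n))) =
    ∏ n : N, hb (-1) (Sum.elim (fun l : L => Sum.inl l) fun _ : Unit => Sum.inr n) := by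
  have e : (fun l : L ⊕ Unit => (Sum.map Sum.inl id (id l) : (L ⊕ N) ⊕ Unit)) =
      Sum.elim (fun l => Sum.inl (Sum.inl l)) fun _ : Unit => Sum.inr () := by
    funext x
    rcases x with _ | _ <;> rfl
  refine Eq.trans ?_ bialg_H
  rw [andD, ← had_prod_ed fun n : N => (Sum.inr n : L ⊕ N), sub_mul, sub_had, sub_sc, mul_right_comm,
    ← mul_assoc, ← sub_sc (X := L ⊕ N) _ Sum.inl, ← sm_mul, ← sm_mul, sm_had, sub_hb, e]

theorem dl_eq (x y : X) :
    dl x y = sm Unit (ed (Sum.inl x) (Sum.inr ()) * ed (Sum.inr ()) (Sum.inl y)) * sc (1 / 2) := by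
  rw [sm_ed_ed, mul_assoc, mul_comm (sc 2), sc_half_two, mul_one]

/-- Copying for conjunctions. Each factor and each delta carries a Hadamard edge to `s k`; without
these edges the claim is `sm_andD`, and the powers of ½ agree. -/
theorem prod_andD (s : K → X) (f : L → X) : ∏ k, sub (Sum.elim f fun _ : Unit => s k) (andD L) =
    sm Unit (sub (Sum.elim (fun l => Sum.inl (f l)) fun _ => Sum.inr ()) (andD L) *
      ∏ k, dl (Sum.inl (s k)) (Sum.inr ())) := by
  have h1 : ∀ k, sub (Sum.elim f fun _ : Unit => s k) (andD L) =
      sm Unit (hb (-1) (Sum.elim (fun l => Sum.inl (f l)) fun _ : Unit => Sum.inr ()) *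
        ed (Sum.inl (s k)) (Sum.inr ())) * sc (1 / 2) := by
    intro k
    have e : (fun l : L ⊕ Unit => Sum.map (Sum.elim f fun _ : Unit => s k) (id : Unit → Unit)
        ((Sum.map Sum.inl id : L ⊕ Unit → (L ⊕ Unit) ⊕ Unit) (id l))) =
        Sum.elim (fun l => Sum.inl (f l)) fun _ : Unit => Sum.inr () := by
      funext x
      rcases x with _ | _ <;> rfl
    rw [andD, had, sub_mul, sub_sc, sub_sm, sub_mul, sub_ed, sub_hb, sub_hb, e]
    rfl
  simp only [h1, dl_eq]
  rw [Finset.prod_mul_distrib, Finset.prod_mul_distrib, prod_sm_unit, prod_sm_unit, Finset.prod_const,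
    Finset.prod_const, ← sub_sc (X := X) (1 / 2) (Sum.inl : X → X ⊕ Unit)]
  simp only [sub_mul, sub_hb, sub_ed]
  rw [Finset.prod_mul_distrib]
  have h2 := congrArg (sub (Sum.elim (fun l => Sum.inl (f l)) Sum.inr : L ⊕ K → X ⊕ K))
    (sm_andD (L := L) (N := K))
  rw [sub_prod] at h2
  simp only [sub_hb] at h2
  have e : ∀ k : K, hb (-1) (fun l : L ⊕ Unit => Sum.map id (fun _ : Unit => k)
      ((Sum.elim (fun l => Sum.inl (f l)) fun _ : Unit => Sum.inr ()) l)) =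
      hb (-1) fun l : L ⊕ Unit => (Sum.elim (fun l => Sum.inl (f l)) Sum.inr : L ⊕ K → X ⊕ K)
        ((Sum.elim (fun l => Sum.inl l) fun _ : Unit => Sum.inr k) l) := by
    intro k
    congr 1
    funext x
    rcases x with _ | _ <;> rfl
  simp only [e]
  have hc : (sub Sum.inl (sc (1 / 2)) : Diag (X ⊕ Unit)) ^ Finset.univ.card (α := K) =
      sub Sum.inl (sc (1 / 2) ^ Finset.univ.card (α := K)) := (map_pow (subHom _) _ _).symm
  rw [hc, ← mul_assoc, ← sm_mul]
  congr 1
  rw [← h2, sub_sm, sm_mul, sm_comm,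
    mul_comm (sub _ (andD L)) (sm _ _), sm_mul]
  congr 2
  simp only [sub_mul, sub_sub, sub_prod, sub_ed, Sum.map_inl, Sum.map_inr, Sum.elim_inr, Sum.elim_inl, id]
  rw [mul_assoc, ← Finset.prod_mul_distrib, mul_comm]
  congr 1
  · refine Finset.prod_congr rfl fun k _ => ?_
    rw [mul_comm, ed_comm (Sum.inr k)]
  · congr 1
    funext x
    rcases x with _ | _ <;> rfl

variable (L) in
/-- The conjunction of the variables in `L`. -/
noncomputable def andG : Term L where
  val := andD L
  copy := by
    have h := prod_andD (fun t : Bool => (Sum.inr t : L ⊕ Bool)) Sum.inl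
    have e : ∀ t : Bool, (Sum.map id fun _ : Unit => t : L ⊕ Unit → L ⊕ Bool) =
        Sum.elim Sum.inl fun _ => Sum.inr t := by
      intro t
      funext x
      rcases x with _ | _ <;> rfl
    have h2 := sm_mul_dl (fun _ : Unit => (Sum.inr false : L ⊕ Bool))
      (sub (Sum.elim (fun l => Sum.inl (Sum.inl l)) fun _ => Sum.inr ()) (andD L) *
        dl (Sum.inl (Sum.inr true)) (Sum.inr ()))
    rw [Fintype.prod_unique, sub_mul, sub_dl, sub_sub] at h2
    rw [Fintype.prod_bool, Fintype.prod_bool, ← mul_assoc, h2, mul_comm] at h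
    rw [e, e, h, dl_comm]
    congr 2
    funext x
    rcases x with _ | _ <;> rfl
  discard := by
    -- With no recipient, the identity says that the value of the conjunction is discarded.
    have h := congrArg (sub (Sum.elim id Empty.elim)) (sm_andD (L := L) (N := Empty))
    simp only [Finset.univ_eq_empty, Finset.prod_empty, mul_one] at h
    rw [sub_one, sub_sm, sub_sub] at h
    rw [← h]
    congr 1
    conv_lhs => rw [← sub_id (andD L)]
    congr 1
    funext x
    rcases x with _ | _ <;> rfl

/-! ### Terms in H-boxes -/

/-- The H-box with label `a`, with terms on its legs. -/
noncomputable def hm (a : ℂ) (t : L → Term V) : Diag V := ev ⟦H a L⟧ t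

theorem ev_hb (a : ℂ) (f : L → K) (t : K → Term V) : ev (hb a f) t = hm a fun l => t (f l) :=
  ev_sub f _ t

theorem ev_hb_id (a : ℂ) (t : L → Term V) : ev (hb a id) t = hm a t := ev_hb a id t

theorem ev_ed (x y : K) (t : K → Term V) : ev (ed x y) t = hm (-1) fun b : Bool => bif b then t y else t x := by
  rw [ed, ev_hb]
  congr 1
  funext b
  cases b <;> rfl

theorem hm_var (a : ℂ) (f : L → V) : hm a (fun l => var (f l)) = hb a f := ev_var _ _

theorem hm_equiv (a : ℂ) (e : L ≃ K) (t : K → Term V) : hm a (fun l => t (e l)) = hm a t := by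
  rw [← ev_hb, ← ev_hb_id, ← hb_equiv a e]
  rfl

theorem ev_sc (a : ℂ) (t : L → Term V) : ev (sc a) t = sc a := by
  rw [sc, ev_hb, ← sc_eq a (Empty.elim : Empty → V), ← hm_var]
  congr 1
  funext x
  exact x.elim

/-- The character of a term. -/
noncomputable def eps (t : Term V) : Diag (V ⊕ Unit) := had t.val

/-- The means of proving every ring identity between terms: characters are easier to compute than
the terms. -/
theorem eps_inj {t s : Term V} (h : eps t = eps s) : t = s := Term.ext' (had_inj h)

theorem ev_had (q : Diag (L ⊕ Unit)) (s : L → Term V) : ev (had q) (ext s) = had (ev q (ext s)) := by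
  have e : ∀ x : L ⊕ Unit, ext (K := Unit) (ext (K := Unit) s) (Sum.map Sum.inl id x) =
      (ext (K := Unit) s x).map (Sum.map Sum.inl id) := by
    rintro (l | _)
    · simp only [ext, Sum.map_inl, Sum.elim_inl, map_map]
    · simp only [ext, Sum.map_inr, Sum.elim_inr, map_var]
  have e2 : ev (ed (Sum.inl (Sum.inr ())) (Sum.inr ())) (ext (K := Unit) (ext (K := Unit) s)) =
      ed (Sum.inl (Sum.inr ())) (Sum.inr ()) := by
    rw [ev_ed, ed, ← hm_var]
    congr 1
    funext b
    cases b
    · exact map_var _ _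
    · rfl
  rw [had, had, ev_sm, ev_mul, ev_sub, e2]
  simp only [e]
  rw [← sub_ev]

theorem eps_comp (f : Term L) (s : L → Term V) : eps (f.comp s) = ev (eps f) (ext s) :=
  (ev_had f.val s).symm

theorem eps_eq (t : Term V) :
    eps t = hm (-1) fun b => bif b then t.map Sum.inl else var (Sum.inr ()) := by
  have : Fintype V := Fintype.ofFinite V
  have h := sm_mul_ats (V := V ⊕ Unit) (K := Unit) (ed (Sum.inl (Sum.inr ())) (Sum.inr ()))
    fun _ => t.map Sum.inl
  rw [ev_ed, ats, Fintype.prod_unique, map_at] at h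
  rw [eps, had, mul_comm]
  refine Eq.trans ?_ h
  congr 2

/-- The exclusive or of terms. -/
noncomputable def xorT (s : L → Term V) : Term V := (xorG L).comp s

/-- The conjunction of terms. -/
noncomputable def andT (s : L → Term V) : Term V := (andG L).comp s

/-- The transform in the definition of conjunction cancels that of the character, leaving one H-box
whose legs are the conjuncts and the new variable. -/
theorem eps_andT (s : L → Term V) : eps (andT s) = hm (-1) (ext s) := by
  rw [andT, eps_comp, ← ev_hb_id]
  exact congrArg (fun q => ev q (ext s)) had_andD

theorem eps_xorG : eps (xorG L) = ∏ l, ed (Sum.inr ()) (Sum.inl l) := by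
  have h := had_prod_ed (fun l : L => l)
  have h2 : had (xorG L).val = had (had (∏ l : L, ed (Sum.inr ()) (Sum.inl l)) * sub Sum.inl (sc (1 / 2))) := by
    rw [sub_sc, h]
    rfl
  rw [eps, h2, had_mul, had_had, sub_sc, mul_assoc, mul_comm (sc 2), sc_half_two, mul_one]

theorem eps_xorT (s : L → Term V) : eps (xorT s) = ∏ l, eps (s l) := by
  have h : ∀ q : L → Diag (L ⊕ Unit), ev (∏ l, q l) (ext (K := Unit) s) = ∏ l, ev (q l) (ext s) :=
    fun q => map_prod (⟨⟨fun q => ev q (ext s), ev_one _⟩, fun q r => ev_mul q r _⟩ :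
      Diag (L ⊕ Unit) →* Diag (V ⊕ Unit)) q _
  rw [xorT, eps_comp, eps_xorG, h]
  refine Finset.prod_congr rfl fun l _ => ?_
  rw [eps_eq, ev_ed]
  rfl

/-- An H-box depends only on the product of its legs, so a conjunction on a leg can be spread out.
This is fusion (HS1): the Hadamard edge of the conjunction is the connecting binary H-box, and its ½
cancels the 2. -/
theorem hm_andT (a : ℂ) (t : K → Term V) (s : L → Term V) :
    hm a (Sum.elim t fun _ : Unit => andT s) = hm a (Sum.elim t s) := by
  rw [hm, andT, ev_elim_comp]
  refine (congrArg (fun q => ev q _) ?_).trans (ev_hb_id a _)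
  have h := fuse_H (M := K) (N := L) a
  have e1 : sub (Sum.map Sum.inl id) (⟦H a (K ⊕ Unit)⟧ : Diag (K ⊕ Unit)) =
      hb a (Sum.elim (fun k => Sum.inl (Sum.inl k)) fun _ => Sum.inr () :
        K ⊕ Unit → (K ⊕ L) ⊕ Unit) := by
    exact sub_congr (by rintro (_ | _) <;> rfl) _
  have e2 : sub (Sum.map Sum.inr id : L ⊕ Unit → (K ⊕ L) ⊕ Unit) (andG L).val =
      sm Unit (hb (-1) (Sum.elim (fun l => Sum.inl (Sum.inl (Sum.inr l))) fun _ : Unit => Sum.inr ()) *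
        ed (Sum.inl (Sum.inr ())) (Sum.inr ())) * sc (1 / 2) := by
    change sub _ (andD L) = _
    rw [andD, had, sub_mul, sub_sc, sub_sm, sub_mul, sub_ed, sub_hb, sub_hb]
    refine congrArg (fun q => sm Unit (q * _) * _) (hb_congr (-1) ?_)
    rintro (_ | _) <;> rfl
  rw [e1, e2, ← mul_assoc, ← sub_sc (X := K ⊕ L) (1 / 2) Sum.inl, ← sm_mul]
  rw [sm_bool] at h
  rw [← mul_one (hb a id), ← sc_half_two, mul_comm (sc (1 / 2)), ← mul_assoc, ← h]
  refine congrArg (fun q => sm Unit q * _) ?_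
  rw [mul_comm (hb _ _), sm_mul, sub_mul, sub_mul,
    sub_hb, sub_hb, sub_hb, sub_ed, mul_right_comm, mul_comm (hb a _)]
  have e3 : hb a (fun l : K ⊕ Unit => (Sum.elim (fun x => Sum.inl (Sum.inl x))
      fun b => bif b then Sum.inr () else Sum.inl (Sum.inr ()) : (K ⊕ L) ⊕ Bool → ((K ⊕ L) ⊕ Unit) ⊕ Unit)
      ((Sum.elim (fun m : K => Sum.inl (Sum.inl m)) fun _ : Unit => Sum.inr false) l)) =
      hb a fun l => Sum.inl (Sum.elim (fun k => Sum.inl (Sum.inl k)) (fun _ => Sum.inr ()) l) :=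
    hb_congr a (by rintro (_ | _) <;> rfl)
  have e4 : hb (-1) (fun l : L ⊕ Unit => (Sum.elim (fun x => Sum.inl (Sum.inl x))
      fun b => bif b then Sum.inr () else Sum.inl (Sum.inr ()) : (K ⊕ L) ⊕ Bool → ((K ⊕ L) ⊕ Unit) ⊕ Unit)
      ((Sum.elim (fun n : L => Sum.inl (Sum.inr n)) fun _ : Unit => Sum.inr true) l)) =
      hb (-1) (Sum.elim (fun l => Sum.inl (Sum.inl (Sum.inr l))) fun _ : Unit => Sum.inr ()) :=
    hb_congr _ (by rintro (_ | _) <;> rfl)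
  rw [e3, e4, mul_assoc (hb (-1) _), mul_comm (hb (-1) _),
    mul_comm (hb a _)]
  rfl

/-- The H-box for `-1` is a sign, additive modulo 2 in each leg; this is (BA2) with terms
substituted. It becomes distributivity in the ring of terms. -/
theorem hm_xorT (t : K → Term V) (s : L → Term V) :
    hm (-1) (Sum.elim t fun _ : Unit => xorT s) = ∏ l, hm (-1) (Sum.elim t fun _ : Unit => s l) := by
  have h : ∀ q : L → Diag (K ⊕ L), ev (∏ l, q l) (Sum.elim t s) = ∏ l, ev (q l) (Sum.elim t s) :=
    fun q => map_prod (⟨⟨fun q => ev q (Sum.elim t s), ev_one _⟩, fun q r => ev_mul q r _⟩ :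
      Diag (K ⊕ L) →* Diag V) q _
  have e1 : sub (Sum.map Sum.inl id) (⟦H (-1) (K ⊕ Unit)⟧ : Diag (K ⊕ Unit)) =
      hb (-1) (Sum.elim (fun k => Sum.inl (Sum.inl k)) fun _ => Sum.inr () :
        K ⊕ Unit → (K ⊕ L) ⊕ Unit) :=
    sub_congr (by rintro (_ | _) <;> rfl) _
  have e2 : sub (Sum.map Sum.inr id : L ⊕ Unit → (K ⊕ L) ⊕ Unit) (xorG L).val =
      xb (Sum.elim (fun n => Sum.inl (Sum.inr n)) fun _ : Unit => Sum.inr ()) := by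
    refine (sub_xb _ _).trans (congrArg xb ?_)
    funext x
    rcases x with _ | _ <;> rfl
  rw [hm, xorT, ev_elim_comp, e1, e2, bialg_H, h]
  refine Finset.prod_congr rfl fun l _ => ?_
  rw [ev_hb]
  congr 1
  funext x
  rcases x with _ | _ <;> rfl

end

/-! ### The Boolean ring of terms -/

section
variable {L V X K : Type} [Finite V] [Finite X] [Fintype L] [Fintype K]

theorem map_comp (f : Term L) (s : L → Term V) (g : V → X) :
    (f.comp s).map g = f.comp fun l => (s l).map g := by
  apply Term.ext'
  refine (comp_at f s _ _).trans ?_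
  change _ = ev f.val (ext fun l => (s l).map g)
  congr 1
  funext x
  rcases x with l | _
  · exact (map_map _ _ _).symm
  · rfl

/-- The H-box with label `a`, with a term on its leg. -/
noncomputable def hh (a : ℂ) (t : Term V) : Diag V := hm a fun _ : Unit => t

theorem hh_andT (a : ℂ) (s : L → Term V) : hh a (andT s) = hm a s := by
  have h := hm_andT a (Empty.elim : Empty → Term V) s
  rw [← hm_equiv a (Equiv.emptySum Empty Unit).symm, ← hm_equiv a (Equiv.emptySum Empty L).symm] at h
  exact h

theorem hh_mul_hh (a b : ℂ) (t : Term V) : hh a t * hh b t = hh (a * b) t := by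
  rw [hh, hh, ← ev_hb_id, ← ev_hb_id, ← ev_mul, hb_mul, ev_hb_id, hh]

theorem hh_one_left (t : Term V) : hh 1 t = 1 := by
  rw [hh, ← ev_hb_id, hb_one, ev_one]

noncomputable instance : Zero (Term V) := ⟨xorT (Empty.elim : Empty → Term V)⟩
noncomputable instance : One (Term V) := ⟨andT (Empty.elim : Empty → Term V)⟩
noncomputable instance : Add (Term V) := ⟨fun t s => xorT fun b : Bool => bif b then s else t⟩
noncomputable instance : Mul (Term V) := ⟨fun t s => andT fun b : Bool => bif b then s else t⟩
-- The ring has characteristic two.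
instance : Neg (Term V) := ⟨fun t => t⟩

theorem eps_zero : eps (0 : Term V) = 1 := (eps_xorT _).trans Finset.prod_empty

theorem eps_add (t s : Term V) : eps (t + s) = eps t * eps s := by
  refine (eps_xorT _).trans ?_
  rw [Fintype.prod_bool, mul_comm]
  rfl

theorem map_mul' (t s : Term V) (g : V → X) : (t * s).map g = t.map g * s.map g := by
  refine (map_comp _ _ _).trans ?_
  change (andG Bool).comp _ = (andG Bool).comp _
  congr 1
  funext b
  cases b <;> rfl

theorem map_add' (t s : Term V) (g : V → X) : (t + s).map g = t.map g + s.map g := by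
  refine (map_comp _ _ _).trans ?_
  change (xorG Bool).comp _ = (xorG Bool).comp _
  congr 1
  funext b
  cases b <;> rfl

theorem map_one' (g : V → X) : (1 : Term V).map g = 1 := by
  refine (map_comp _ _ _).trans ?_
  change (andG Empty).comp _ = (andG Empty).comp _
  congr 1
  funext b
  exact b.elim

theorem map_zero' (g : V → X) : (0 : Term V).map g = 0 := by
  refine (map_comp _ _ _).trans ?_
  change (xorG Empty).comp _ = (xorG Empty).comp _
  congr 1
  funext b
  exact b.elim

theorem eps_mul (t s : Term V) : eps (t * s) =
    hm (-1) (Sum.elim ![var (Sum.inr ()), s.map Sum.inl] fun _ : Unit => t.map Sum.inl) := by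
  let e : Bool ⊕ Unit ≃ Fin 2 ⊕ Unit :=
    { toFun := Sum.elim (fun b => bif b then Sum.inl 1 else Sum.inr ()) fun _ => Sum.inl 0
      invFun := Sum.elim ![Sum.inr (), Sum.inl true] fun _ => Sum.inl false
      left_inv := by decide
      right_inv := by decide }
  refine (eps_andT _).trans ?_
  rw [← hm_equiv _ e]
  congr 1
  funext x
  rcases x with (_ | _) | _ <;> rfl

theorem mul_comm' (t s : Term V) : t * s = s * t := by
  apply eps_inj
  refine (eps_andT _).trans (Eq.trans ?_ (eps_andT _).symm)
  rw [← hm_equiv _ (Equiv.sumCongr Equiv.boolNot (Equiv.refl Unit))]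
  congr 1
  funext x
  rcases x with (_ | _) | _ <;> rfl

/-- One H-box with four legs, insensitive to the order and bracketing of the three factors;
associativity is a permutation of its legs. -/
theorem eps_mul_mul (r s t : Term V) : eps (r * s * t) =
    hm (-1) ![var (Sum.inr ()), t.map Sum.inl, r.map Sum.inl, s.map Sum.inl] := by
  let e : Fin 2 ⊕ Bool ≃ Fin 4 :=
    { toFun := Sum.elim ![0, 1] fun b => bif b then 3 else 2
      invFun := ![Sum.inl 0, Sum.inl 1, Sum.inr false, Sum.inr true]
      left_inv := by decide
      right_inv := by decide }
  rw [eps_mul, map_mul']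
  refine (hm_andT _ _ _).trans ?_
  rw [← hm_equiv _ e]
  congr 1
  funext x
  rcases x with i | (_ | _)
  · fin_cases i <;> rfl
  · rfl
  · rfl

theorem eps_one_mul (t : Term V) : eps (1 * t) = eps t := by
  let e : Fin 2 ⊕ Empty ≃ Bool :=
    { toFun := Sum.elim ![false, true] Empty.elim
      invFun := fun b => bif b then Sum.inl 1 else Sum.inl 0
      left_inv := by decide
      right_inv := by decide }
  rw [eps_mul, map_one', eps_eq]
  refine (hm_andT _ _ _).trans ?_
  rw [← hm_equiv _ e]
  congr 1
  funext x
  rcases x with i | x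
  · fin_cases i <;> rfl
  · exact x.elim

theorem eps_mul_self (t : Term V) : eps t * eps t = 1 := by
  rw [eps_eq, ← hh_andT, hh_mul_hh, neg_mul_neg, one_mul, hh_one_left]

theorem eps_add_mul (r s t : Term V) : eps ((r + s) * t) = eps (r * t) * eps (s * t) := by
  rw [eps_mul, map_add', eps_mul, eps_mul]
  refine (hm_xorT _ _).trans ?_
  rw [Fintype.prod_bool, mul_comm]
  rfl

theorem eps_zero_mul (t : Term V) : eps (0 * t) = 1 := by
  rw [eps_mul, map_zero']
  exact (hm_xorT _ _).trans Finset.prod_empty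

theorem mul_assoc' (r s t : Term V) : r * s * t = r * (s * t) := by
  let e : Fin 4 ≃ Fin 4 :=
    { toFun := ![0, 2, 3, 1]
      invFun := ![0, 3, 1, 2]
      left_inv := by decide
      right_inv := by decide }
  apply eps_inj
  have h : ∀ a b c d : Term (V ⊕ Unit), (fun i => ![a, b, c, d] (e i)) = ![a, c, d, b] := by
    intro a b c d
    funext i
    fin_cases i <;> rfl
  rw [mul_comm' r (s * t), eps_mul_mul, eps_mul_mul, ← hm_equiv _ e, h]

/-- Each law is tested on characters, where addition becomes the product of diagrams; a character
squares to 1, whence the additive inverses. -/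
noncomputable instance : CommRing (Term V) where
  add_assoc r s t := eps_inj (by simp only [eps_add, mul_assoc])
  zero_add t := eps_inj (by rw [eps_add, eps_zero, one_mul])
  add_zero t := eps_inj (by rw [eps_add, eps_zero, mul_one])
  add_comm r s := eps_inj (by rw [eps_add, eps_add, mul_comm])
  nsmul := nsmulRec
  zsmul := zsmulRec
  neg_add_cancel t := eps_inj (by rw [eps_add, eps_zero]; exact eps_mul_self t)
  mul_assoc := mul_assoc'
  one_mul t := eps_inj (eps_one_mul t)
  mul_one t := by rw [mul_comm']; exact eps_inj (eps_one_mul t)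
  zero_mul t := eps_inj ((eps_zero_mul t).trans eps_zero.symm)
  mul_zero t := by rw [mul_comm']; exact eps_inj ((eps_zero_mul t).trans eps_zero.symm)
  mul_comm := mul_comm'
  right_distrib r s t := eps_inj (by rw [eps_add_mul, eps_add])
  left_distrib t r s := by
    rw [mul_comm', mul_comm' t, mul_comm' t]
    exact eps_inj (by rw [eps_add_mul, eps_add])

theorem add_self (t : Term V) : t + t = 0 := eps_inj (by rw [eps_add, eps_zero, eps_mul_self])

theorem xorT_eq_sum (s : L → Term V) : xorT s = ∑ l, s l := by
  classical
  have h : ∀ S : Finset L, eps (∑ l ∈ S, s l) = ∏ l ∈ S, eps (s l) := by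
    intro S
    induction S using Finset.induction_on with
    | empty => simp [eps_zero]
    | insert a S ha ih => rw [Finset.sum_insert ha, Finset.prod_insert ha, eps_add, ih]
  exact eps_inj (by rw [eps_xorT, h])

theorem andT_eq_prod (s : L → Term V) : andT s = ∏ l, s l := by
  refine Fintype.induction_empty_option (P := fun L _ => ∀ s : L → Term V, andT s = ∏ l, s l)
    ?_ ?_ ?_ L s
  · intro L K _ e ih s
    let _ : Fintype L := Fintype.ofEquiv K e.symm
    rw [← Equiv.prod_comp e, ← ih]
    apply eps_inj
    rw [eps_andT, eps_andT, ← hm_equiv _ (Equiv.sumCongr e (Equiv.refl Unit))]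
    congr 1
    funext x
    rcases x with _ | _ <;> rfl
  · intro s
    apply eps_inj
    rw [Finset.univ_eq_empty, Finset.prod_empty]
    refine (eps_andT _).trans (Eq.trans ?_ (eps_andT _).symm)
    rw [← hm_equiv _ (Equiv.sumCongr (Equiv.equivPEmpty Empty) (Equiv.refl Unit))]
    congr 1
    funext x
    rcases x with x | _
    · exact x.elim
    · rfl
  · intro L _ ih s
    rw [Fintype.prod_option, ← ih, mul_comm]
    apply eps_inj
    let e : Fin 2 ⊕ L ≃ Option L ⊕ Unit :=
      { toFun := Sum.elim ![Sum.inr (), Sum.inl none] fun l => Sum.inl (some l)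
        invFun := Sum.elim (fun x => x.elim (Sum.inl 1) Sum.inr) fun _ => Sum.inl 0
        left_inv := by
          rintro (i | l)
          · fin_cases i <;> rfl
          · rfl
        right_inv := by rintro ((_ | _) | _) <;> rfl }
    have h : (andT fun l => s (some l)).map (Sum.inl : V → V ⊕ Unit) =
        andT fun l => (s (some l)).map Sum.inl := map_comp _ _ _
    rw [eps_mul, h, hm_andT, eps_andT, ← hm_equiv _ e]
    congr 1
    funext x
    rcases x with i | l
    · fin_cases i <;> rfl
    · rfl

theorem hm_eq_hh (a : ℂ) (s : L → Term V) : hm a s = hh a (∏ l, s l) := by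
  rw [← hh_andT, andT_eq_prod]

theorem eps_mul_eq (t s : Term V) : eps (t * s) = hm (-1) ![t.map Sum.inl, s.map Sum.inl, var (Sum.inr ())] := by
  rw [eps_mul, hm_eq_hh, hm_eq_hh]
  refine congrArg (hh (-1)) ?_
  rw [Fintype.prod_sum_type, Fin.prod_univ_two, Fin.prod_univ_three, Fintype.prod_unique]
  simp only [Sum.elim_inl, Sum.elim_inr, Matrix.cons_val]
  ring

theorem eps_one : eps (1 : Term V) = hb (-1) fun _ : Unit => Sum.inr () := by
  refine (eps_andT _).trans ?_
  rw [← hm_var, hm_eq_hh, hm_eq_hh, Fintype.prod_sum_type, Finset.univ_eq_empty, Finset.prod_empty, one_mul]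
  rfl

/-- The additional unary H-box in the NOT gate is the character of the term `1`, and characters
multiply when terms are added. -/
theorem ev_nt (x : K) (s : K → Term V) : ev (nt (Sum.inl x) (Sum.inr ())) (ext s) = (s x + 1).val := by
  have h1 : nt (Sum.inl x : K ⊕ Unit) (Sum.inr ()) =
      had (hb (-1) (fun _ : Unit => Sum.inr ()) * ed (Sum.inr ()) (Sum.inl x)) * sc (1 / 2) := by
    rw [nt_eq, had, mul_comm, sub_mul, sub_hb, sub_ed, ed_comm _ (Sum.inl (Sum.inr ())), mul_assoc]
    rfl
  have h2 : (s x + 1).val = had (eps (s x + 1)) * sc (1 / 2) := by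
    rw [eps, had_had, mul_assoc, mul_comm (sc 2), sc_half_two, mul_one]
  have h3 : ev (ed (Sum.inr ()) (Sum.inl x)) (ext s) = eps (s x) := by
    rw [ev_ed, eps_eq]
    rfl
  rw [h1, h2, ev_mul, ev_sc, ev_had, ev_mul, h3, eps_add, eps_one, ev_hb, mul_comm (eps _), ← hm_var]
  rfl

theorem ev_sm_nt (q : Diag (K ⊕ Unit)) (x : K) (s : K → Term V) :
    ev (sm Unit (q * nt (Sum.inl x) (Sum.inr ()))) s = ev q (Sum.elim s fun _ => s x + 1) := by
  rw [ev_sm, ev_mul, ev_nt, ev_elim, ats, Fintype.prod_unique, Term.at_self]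

/-- Rule (I) with terms substituted: an H-box is distributed over the two cases for `s`. -/
theorem hh_split (a : ℂ) (t s : Term V) : hh a t = hh a (t * s) * hh a (t * (s + 1)) := by
  have h := congrArg (fun q => ev q fun b : Bool => bif b then s else t) (intro_H a false true)
  rw [ev_mul, ev_hb, ev_hb, ev_sm_nt, ev_hb, hm_eq_hh a fun l : Bool => _, hm_eq_hh a fun l : Bool => _,
    Fintype.prod_bool, Fintype.prod_bool] at h
  refine h.trans ?_
  rw [mul_comm t, mul_comm t]
  rfl

/-! ### Idempotence of terms, from the ortho rule. -/

theorem sm_one_zero : had (1 : Diag (V ⊕ Unit)) = (0 : Term V).val * sc 2 := by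
  rw [← eps_zero, eps, had_had]

/-- The scalar that tells whether a term vanishes. -/
noncomputable def zt (t : Term V) : Diag V := sm Unit (t.val * (0 : Term V).val)

theorem val_mul_val (t : Term V) : t.val * t.val = t.val := by
  rw [← t.at_self, t.at_mul_at, dl_self, mul_one]

theorem zt_zero : zt (0 : Term V) = 1 := by
  rw [zt, val_mul_val, Term.discard]

theorem zt_mul_zt (t : Term V) : zt t * zt t = zt t := by
  have : Fintype V := Fintype.ofFinite V
  have h : zt t = ev (0 : Term V).val (Sum.elim var fun _ => t) := by
    rw [← sm_mul_ats, ats, Fintype.prod_unique, Term.at_self, mul_comm, zt]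
  rw [h, ← ev_mul, val_mul_val]

/-- Summing `(-1)^(y t)` over `y` detects `t = 0`. This lets the sums in the ortho rule be read as
statements about vanishing terms. -/
theorem sm_eps (t : Term V) : sm Unit (eps t) = zt t * sc 2 := by
  rw [← mul_one (eps t), eps, sm_had, sm_one_zero, ← mul_assoc, ← sub_sc (X := V) 2 Sum.inl, ← sm_mul,
    zt]

theorem val_mul_sm (t s : Term V) : t.val * sub Sum.inl (sm Unit (t.val * s.val)) = t.val * s.val := by
  have e1 : sub (Sum.map Sum.inl id : V ⊕ Unit → (V ⊕ Unit) ⊕ Unit) t.val = t.at (fun v => Sum.inl (Sum.inl v)) (Sum.inr ()) :=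
    sub_congr (by rintro (_ | _) <;> rfl) _
  have e2 : sub (Sum.inl : V ⊕ Unit → (V ⊕ Unit) ⊕ Unit) t.val = t.at (fun v => Sum.inl (Sum.inl v)) (Sum.inl (Sum.inr ())) :=
    sub_congr (by rintro (_ | _) <;> rfl) _
  have h := sm_mul_dl (fun _ : Unit => (Sum.inr () : V ⊕ Unit)) (sub Sum.inl t.val * sub (Sum.map Sum.inl id) s.val)
  rw [Fintype.prod_unique, sub_mul, sub_sub, sub_sub] at h
  have e3 : sub (fun a => Sum.elim id (fun _ : Unit => (Sum.inr () : V ⊕ Unit)) (Sum.map Sum.inl id a)) s.val = s.val :=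
    (sub_congr (by rintro (_ | _) <;> rfl) _).trans (sub_id' _)
  have e4 : sub (fun a => Sum.elim id (fun _ : Unit => (Sum.inr () : V ⊕ Unit)) (Sum.inl a)) t.val = t.val :=
    sub_id' _
  rw [e3, e4] at h
  refine Eq.trans ?_ h
  rw [mul_comm, sub_sm, sm_mul, sub_mul, mul_right_comm, e1, e2, mul_comm (t.at _ _),
    t.at_mul_at, mul_right_comm]

/-- If the overlap of the graphs of `t` and `0` has sum 1, multiplying either graph by it changes
nothing; but by `val_mul_sm` both products are the intersection of the graphs. -/
theorem eq_zero_of_zt {t : Term V} (h : zt t = 1) : t = 0 := by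
  apply Term.ext'
  have h1 := val_mul_sm t 0
  have h2 := val_mul_sm 0 t
  rw [mul_comm (0 : Term V).val t.val] at h2
  change _ * sub Sum.inl (zt t) = _ at h1
  change _ * sub Sum.inl (zt t) = _ at h2
  rw [h, sub_one, mul_one] at h1 h2
  exact h1.trans h2.symm

/-- Nested sums, with the negation of `x` bound outermost, so that `ev_sm_nt` can replace it by a
term. -/
theorem ortho_H' (x p q : X) :
    sm Unit (sm Unit (hb (-1) ![Sum.inl (Sum.inl p), Sum.inl (Sum.inl x), Sum.inr ()] *
      hb (-1) ![Sum.inl (Sum.inl q), Sum.inl (Sum.inr ()), Sum.inr ()]) * nt (Sum.inl x) (Sum.inr ())) =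
    sm Unit (sm Unit (hb (-1) ![Sum.inl (Sum.inl p), Sum.inl (Sum.inl x), Sum.inr ()]) *
      sm Unit (hb (-1) ![Sum.inl (Sum.inl q), Sum.inl (Sum.inr ()), Sum.inr ()]) *
      nt (Sum.inl x) (Sum.inr ())) * sc (1 / 2) := by
  let e : Fin 3 ≃ Unit ⊕ Bool :=
    { toFun := ![Sum.inl (), Sum.inr false, Sum.inr true]
      invFun := Sum.elim (fun _ => 0) fun b => bif b then 2 else 1
      left_inv := by decide
      right_inv := by decide }
  have h := ortho_H x p q
  have h2 := prod_sm_unit (X := X ⊕ Unit) fun b : Bool => bif b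
    then hb (-1) ![Sum.inl (Sum.inl q), Sum.inl (Sum.inr ()), Sum.inr ()]
    else hb (-1) ![Sum.inl (Sum.inl p), Sum.inl (Sum.inl x), Sum.inr ()]
  rw [Fintype.prod_bool, Fintype.prod_bool] at h2
  simp only [cond_true, cond_false, sub_hb] at h2
  rw [sm_bool, ← sm_equiv e, sm_sum] at h
  simp only [sub_mul, sub_hb, sub_nt] at h
  rw [mul_comm (sm Unit (hb (-1) ![Sum.inl (Sum.inl p), _, _])), h2,
    sm_mul (K := Unit) _ (nt _ _), sm_mul (K := Bool) _ (nt _ _), sub_nt, sub_nt]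
  refine Eq.trans ?_ (h.trans ?_)
  · rw [mul_assoc]
    refine congrArg₂ (fun a b : Diag ((X ⊕ Unit) ⊕ Unit) => sm Unit (sm Unit (a * (b * _))))
      (hb_congr _ ?_) (hb_congr _ ?_) <;> (intro i; fin_cases i <;> rfl)
  · rw [mul_comm (hb _ _) (hb _ _), mul_assoc]
    refine congrArg₂ (fun a b : Diag ((X ⊕ Unit) ⊕ Bool) => sm Unit (sm Bool (a * (b * _))) *
      sc (1 / 2)) (hb_congr _ ?_) (hb_congr _ ?_) <;> (intro i; fin_cases i <;> rfl)

theorem ev_sm_hb (i j : K) (s : K → Term V) :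
    ev (hb (-1) ![Sum.inl i, Sum.inl j, Sum.inr ()]) (ext s) = eps (s i * s j) := by
  rw [ev_hb, eps_mul_eq]
  congr 1
  funext i
  fin_cases i <;> rfl

/-- Since `p x` and `q (x + 1)` are never both 1, their sum vanishes exactly when both do. The sums
in (O) become `zt` by `sm_eps`, and the factors 2 and ½ cancel. -/
theorem zt_ortho (x p q : Term V) :
    zt (p * x + q * (x + 1)) = zt (p * x) * zt (q * (x + 1)) := by
  have h := congrArg (fun r => ev r ![x, p, q]) (ortho_H' (0 : Fin 3) 1 2)
  let s : Fin 3 ⊕ Unit → Term V := Sum.elim ![x, p, q] fun _ => ![x, p, q] 0 + 1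
  have h1 := ev_sm_hb (K := Fin 3 ⊕ Unit) (Sum.inl 1) (Sum.inl 0) s
  have h2 := ev_sm_hb (K := Fin 3 ⊕ Unit) (Sum.inl 2) (Sum.inr ()) s
  simp only [ev_mul, ev_sc, ev_sm_nt] at h
  rw [ev_sm, ev_sm, ev_sm, ev_mul] at h
  change sm Unit (ev _ (ext s) * ev _ (ext s)) = sm Unit (ev _ (ext s)) * sm Unit (ev _ (ext s)) * _ at h
  rw [h1, h2, ← eps_add, sm_eps, sm_eps, sm_eps] at h
  have h3 : ∀ a b c u v : Diag V, v * u = 1 → a * u = b * u * (c * u) * v → a = b * c := by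
    intro a b c u v h1 h2
    calc a = a * u * v := by rw [mul_assoc, mul_comm u, h1, mul_one]
      _ = b * c * (v * u) * (v * u) := by rw [h2]; ac_rfl
      _ = b * c := by rw [h1, mul_one, mul_one]
  exact h3 _ _ _ _ _ sc_half_two h

theorem mul_self_add (t : Term V) : t * (t + 1) = 0 := by
  -- With `p = t + 1` and `q = t`, the two orthogonal terms coincide, both being `t * (t + 1)`.
  -- Their sum is `0`, so `zt` of this term, which is its own square, equals 1.
  have h := zt_ortho t (t + 1) t
  rw [mul_comm (t + 1) t, add_self, zt_zero, zt_mul_zt] at h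
  exact eq_zero_of_zt h.symm

theorem mul_self (t : Term V) : t * t = t := by
  have h := mul_self_add t
  rw [mul_add, mul_one] at h
  calc t * t = t * t + (t + t) := by rw [add_self, add_zero]
    _ = t * t + t + t := (add_assoc _ _ _).symm
    _ = t := by rw [h, zero_add]

theorem hh_one (a : ℂ) : hh a (1 : Term V) = sc a := by
  rw [← ev_sc a (Empty.elim : Empty → Term V), sc, ev_hb, hm_eq_hh, Finset.univ_eq_empty, Finset.prod_empty]

/-- Splitting `0` makes this diagram idempotent, and the label `a⁻¹` provides an inverse; an
invertible idempotent is 1. -/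
theorem hh_zero {a : ℂ} (ha : a ≠ 0) : hh a (0 : Term V) = 1 := by
  have h := hh_split a (0 : Term V) 0
  rw [zero_mul, zero_mul] at h
  have h2 := hh_mul_hh a a⁻¹ (0 : Term V)
  rw [mul_inv_cancel₀ ha, hh_one_left] at h2
  rw [← h2]
  conv_rhs => rw [h, mul_assoc, h2, mul_one]
end

/-! ### The two diagrams as products of H-boxes -/

section
variable {L V X K S : Type} [Finite V] [Finite X] [Fintype L] [Fintype K] {n : ℕ}

/-- Substitution, as a homomorphism. -/
noncomputable def evHom (t : L → Term V) : Diag L →* Diag V where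
  toFun q := ev q t
  map_one' := ev_one t
  map_mul' q r := ev_mul q r t

theorem mk_sideBySide {ι : Type} {L : ι → Type} [Fintype ι] [∀ i, Finite (L i)]
    (D : (i : ι) → ZH (L i)) :
    (⟦sideBySide D⟧ : Diag (Σ i, L i)) = ∏ i, sub (Sigma.mk i) (⟦D i⟧ : Diag (L i)) := by
  rw [prod_sub, bigten_mk]
  exact (sub_id' _).symm

theorem mk_strand : (⟦strand⟧ : Diag Bool) = (var ()).at (fun _ : Unit => false) true := by
  rw [var_at, dl]
  conv_lhs => rw [← sub_id (⟦strand⟧ : Diag Bool)]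
  exact sub_congr (by rintro (_ | _) <;> rfl) _

theorem mk_notGate : (⟦notGate⟧ : Diag Bool) = (var () + 1).at (fun _ : Unit => false) true := by
  have h := ev_nt () (var : Unit → Term Unit)
  rw [ext_var] at h
  rw [Term.at, ← h]
  have h2 : ev (nt (Sum.inl ()) (Sum.inr ())) var = nt (Sum.inl () : Unit ⊕ Unit) (Sum.inr ()) :=
    (ev_var _ id).trans (sub_id _)
  rw [h2, sub_nt, nt]
  conv_lhs => rw [← sub_id (⟦notGate⟧ : Diag Bool)]
  exact sub_congr (by rintro (_ | _) <;> rfl) _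

theorem val_zero : (0 : Term V).val = xb fun _ : Unit => Sum.inr () := by
  have h := had_prod_ed (Empty.elim : Empty → V)
  rw [Finset.univ_eq_empty, Finset.prod_empty, sm_one_zero, mul_assoc, mul_comm (sc 2), sc_half_two,
    mul_one] at h
  rw [h, ← xb_equiv (Equiv.emptySum Empty Unit).symm]
  rfl

/-- The unary white spider ignores its variable, and the unary grey spider forces the other one to
be `0`. -/
theorem mk_disconnectPiece :
    (⟦disconnectPiece⟧ : Diag Bool) = (0 : Term Unit).at (fun _ => false) true := by
  rw [Term.at, val_zero, sub_xb, disconnectPiece,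
    mk_graph fun t : Bool => bif t then xb fun _ : Unit => Sum.inl true else 1]
  · rw [Fintype.prod_bool]
    have h := sm_mul_dl (Empty.elim : Empty → Bool) (xb fun _ : Unit => Sum.inl true)
    rw [Finset.univ_eq_empty, Finset.prod_empty, sub_xb] at h
    exact h
  · rintro (_ | _)
    · refine (node_Z _ (Sum.inl false) (Empty.elim : Empty → _) ?_ ?_ ?_).trans Finset.prod_empty
      · intro x
        exact x.elim
      · intro x
        exact x.elim
      · rintro ((_ | _) | x)
        · simp
        · simp
        · exact x.1.elim
    · refine node_X _ (fun _ : Unit => Sum.inl true) ?_ ?_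
      · intro _ _ _
        rfl
      · rintro ((_ | _) | x)
        · simp
        · simp
        · exact x.1.elim

/-- If every box acts on each wire by a term, the !-box is a product over `S` of the top diagrams
with these terms on their legs. Both diagrams of the theorem are instances. -/
theorem mk_bangBox [Fintype S] (box : S → Fin n → ZH Bool) (top : S → ZH (Fin n))
    (τ : S → Fin n → Term Unit)
    (h : ∀ s i, (⟦box s i⟧ : Diag Bool) = (τ s i).at (fun _ => false) true) :
    (⟦bangBox (fun s => sideBySide (box s)) top⟧ : Diag (Fin n)) =
      ∏ s, ev ⟦top s⟧ fun i => (τ s i).map fun _ => i := by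
  -- The wires below the boxes equal open ends, by the white spiders, and go first; the wires above
  -- are given by terms and are eliminated by `sm_mul_ats`.
  let σ : (S × Fin n) × Bool ≃ (S × Fin n) ⊕ (S × Fin n) :=
    { toFun := fun p => bif p.2 then Sum.inl p.1 else Sum.inr p.1
      invFun := Sum.elim (fun p => (p, true)) fun p => (p, false)
      left_inv := by rintro ⟨_, _ | _⟩ <;> rfl
      right_inv := by rintro (_ | _) <;> rfl }
  have : ∀ j, Finite (bangLegs n S j) := by
    rintro (_ | _ | _) <;> (simp only [bangLegs]; infer_instance)
  rw [bangBox, net_eq, Fintype.prod_sum_type, Fintype.prod_sum_type]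
  have hZ : ∀ i : Fin n, sub (fun l : bangLegs n S (Sum.inl i) =>
      Sum.map id Prod.fst (bangWiring n S ⟨Sum.inl i, l⟩)) (⟦Z (Option S)⟧ : Diag (Option S)) =
      ∏ s, dl (Sum.inl i) (Sum.inr ((s, i), false)) := fun i => sub_Z_none _
  have hB : ∀ s : S, sub (fun l : bangLegs n S (Sum.inr (Sum.inl s)) =>
      Sum.map id Prod.fst (bangWiring n S ⟨Sum.inr (Sum.inl s), l⟩))
      (⟦sideBySide (box s)⟧ : Diag (Σ _ : Fin n, Bool)) =
      ∏ i, (τ s i).at (fun _ => Sum.inr ((s, i), false)) (Sum.inr ((s, i), true)) := by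
    intro s
    rw [mk_sideBySide]
    refine (sub_prod (A := Σ _ : Fin n, Bool) _ _).trans (Finset.prod_congr rfl fun i _ => ?_)
    rw [h, sub_at]
    exact sub_at _ _ _ _
  have hT : ∀ s : S, sub (fun l : bangLegs n S (Sum.inr (Sum.inr s)) =>
      Sum.map id Prod.fst (bangWiring n S ⟨Sum.inr (Sum.inr s), l⟩))
      (⟦top s⟧ : Diag (Fin n)) = sub (fun i => Sum.inr ((s, i), true)) ⟦top s⟧ := fun s => rfl
  refine (congrArg (sm _) (congrArg₂ (· * ·) (Finset.prod_congr rfl fun i _ => hZ i)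
    (congrArg₂ (· * ·) (Finset.prod_congr rfl fun s _ => hB s) (Finset.prod_congr rfl fun s _ => hT s)))).trans ?_
  have h2 := sm_subst σ (fun p : S × Fin n => (Sum.inl p.2 : Fin n ⊕ (S × Fin n)))
    ((∏ s, ∏ i, (τ s i).at (fun _ => Sum.inr ((s, i), false)) (Sum.inr ((s, i), true))) *
      ∏ s, sub (fun i => Sum.inr ((s, i), true)) (⟦top s⟧ : Diag (Fin n)))
  rw [Fintype.prod_prod_type_right, mul_comm] at h2
  refine h2.trans ?_
  rw [sub_mul, sub_prod, sub_prod]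
  simp only [sub_prod, sub_at, sub_sub]
  have h3 := sm_mul_ats (∏ s, sub (fun i => (Sum.inr (s, i) : Fin n ⊕ (S × Fin n))) (⟦top s⟧ : Diag (Fin n)))
    fun p : S × Fin n => (τ p.1 p.2).map fun _ => p.2
  rw [ats, Fintype.prod_prod_type] at h3
  simp only [map_at] at h3
  rw [mul_comm]
  refine h3.trans ((map_prod (evHom _) _ _).trans (Finset.prod_congr rfl fun s _ => ?_))
  exact ev_sub _ _ _

theorem mk_zPhase (α : ℂ) (l₀ : L) (hl : ∀ l, l = l₀) :
    (⟦zPhase α L⟧ : Diag L) = hb (Complex.exp (Complex.I * α)) fun _ : Unit => l₀ := by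
  rw [zPhase, mk_graph fun t => bif t then hb (Complex.exp (Complex.I * α)) fun _ : Unit => Sum.inr ()
    else ∏ _u : Unit, dl (Sum.inl l₀) (Sum.inr ()), Fintype.prod_bool]
  · refine (sm_mul_dl (fun _ : Unit => l₀) _).trans ?_
    rw [cond_true, sub_hb]
    rfl
  · rintro (_ | _)
    · refine node_Z _ (Sum.inl l₀) (fun _ : Unit => Sum.inr ((), false)) ?_ ?_ ?_
      · intro _ _ _
        rfl
      · simp
      · rintro (l | ⟨_, _ | _⟩)
        · simp [hl l]
        · simp
        · simp
    · refine node_H _ _ (fun _ : Unit => Sum.inr ((), true)) ?_ ?_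
      · intro _ _ _
        rfl
      · rintro (l | ⟨_, _ | _⟩) <;> simp

theorem mk_phaseGadget (n : ℕ) (α : ℂ) : (⟦phaseGadget n α⟧ : Diag (Fin n)) =
    sm Unit (hb (Complex.exp (Complex.I * α)) (fun _ : Unit => Sum.inr ()) * (xorG (Fin n)).val) := by
  rw [phaseGadget, mk_graph fun t => bif t
    then hb (Complex.exp (Complex.I * α)) fun _ : Unit => Sum.inr () else (xorG (Fin n)).val,
    Fintype.prod_bool]
  · rfl
  · rintro (_ | _)
    · refine (node_X _ (Sum.elim Sum.inl fun _ : Unit => Sum.inr ((), false)) ?_ ?_).trans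
        (congrArg xb ?_)
      · rintro (_ | _) (_ | _) h <;> simp at h <;> simp [h]
      · rintro (_ | ⟨_, _ | _⟩) <;> simp
      · funext x
        rcases x with _ | _ <;> rfl
    · have hP : ∀ p : Fin n ⊕ Unit × Bool, Sum.elim (fun _ : Fin n => false)
          (fun p : Unit × Bool => bif p.2 then true else false) p = true ↔ p = Sum.inr ((), true) := by
        rintro (_ | ⟨_, _ | _⟩) <;> simp
      let P := {p : Fin n ⊕ Unit × Bool // Sum.elim (fun _ : Fin n => false)
          (fun p : Unit × Bool => bif p.2 then true else false) p = true}
      have : Fintype P := Fintype.ofFinite P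
      have h := mk_zPhase α (⟨Sum.inr ((), true), rfl⟩ : P) fun l => Subtype.ext ((hP l.1).1 l.2)
      refine (congrArg (sub fun l : P => Sum.map id Prod.fst l.1) h).trans ?_
      rw [sub_hb]
      rfl

/-- The grey spider defines the wire to the phase as the sum of its other legs, so the phase is an
H-box on that sum. -/
theorem ev_phaseGadget (α : ℂ) (t : Fin n → Term V) :
    ev ⟦phaseGadget n α⟧ t = hh (Complex.exp (Complex.I * α)) (∑ i, t i) := by
  have : Fintype V := Fintype.ofFinite V
  rw [mk_phaseGadget, ev_sm, ev_mul, ← xorT_eq_sum]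
  have h : ev (xorG (Fin n)).val (ext t) = ats fun _ : Unit => xorT t := by
    rw [ats, Fintype.prod_unique, Term.at_self]
    rfl
  have h2 : ev (hb (Complex.exp (Complex.I * α)) fun _ : Unit => Sum.inr ()) (ext t) =
      hb (Complex.exp (Complex.I * α)) fun _ : Unit => (Sum.inr () : V ⊕ Unit) := by
    rw [ev_hb, ← hm_var]
    rfl
  rw [h, h2, sm_mul_ats, ev_hb]
  rfl

theorem mk_expNormalForm (α : (Fin n → Bool) → ℂ) : (⟦expNormalForm α⟧ : Diag (Fin n)) =
    ∏ b : Fin n → Bool, hh (Complex.exp (Complex.I * α b)) (∏ i, bif b i then var i else var i + 1) := by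
  have h := mk_bangBox (fun (b : Fin n → Bool) i => power notGate (!b i))
    (fun b => expH (α b) (Fin n)) (fun b i => bif b i then var () else var () + 1) (by
      intro b i
      cases b i
      · exact mk_notGate
      · exact mk_strand)
  refine h.trans (Finset.prod_congr rfl fun b _ => ?_)
  refine (hm_eq_hh _ _).trans (congrArg _ (Finset.prod_congr rfl fun i _ => ?_))
  cases b i
  · exact (map_add' _ _ _).trans (congrArg₂ _ (map_var _ _) (map_one' _))
  · exact map_var _ _

theorem mk_gadgetForm (β : (Fin n → Bool) → ℂ) : (⟦gadgetForm β⟧ : Diag (Fin n)) =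
    ∏ c : Fin n → Bool, hh (Complex.exp (Complex.I * β c)) (∑ i, bif c i then var i else 0) := by
  have h := mk_bangBox (fun (c : Fin n → Bool) i => power disconnectPiece (!c i))
    (fun c => phaseGadget n (β c)) (fun c i => bif c i then var () else 0) (by
      intro c i
      cases c i
      · exact mk_disconnectPiece
      · exact mk_strand)
  refine h.trans (Finset.prod_congr rfl fun c _ => ?_)
  refine (ev_phaseGadget _ _).trans (congrArg _ (Finset.sum_congr rfl fun i _ => ?_))
  cases c i
  · exact map_zero' _
  · exact map_var _ _
end

/-! ### The Fourier transform -/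

section
variable {V : Type} [Finite V] {n : ℕ}

theorem Omega_succ (b c : Fin (n + 1) → Bool) :
    Omega b c = Bool.xor (b 0 && c 0) (Omega (Fin.tail b) (Fin.tail c)) := by
  rw [Omega, List.ofFn_succ, List.foldr_cons]
  rfl

/-- Modulo the minterm of `b`, each `x i` may be replaced by the bit `b i`, and the linear form
takes the value `Omega b c` because `m + m = 0`. -/
theorem linear_mul_minterm (b c : Fin n → Bool) (x : Fin n → Term V) (m : Term V)
    (hm : ∀ i, x i * m = bif b i then m else 0) :
    (∑ i, bif c i then x i else 0) * m = bif Omega b c then m else 0 := by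
  induction n with
  | zero => simp [Omega]
  | succ n ih =>
    rw [Fin.sum_univ_succ, add_mul, Omega_succ]
    have h := ih (Fin.tail b) (Fin.tail c) (Fin.tail x) fun i => hm i.succ
    refine (congrArg _ h).trans ?_
    have h0 : (bif c 0 then x 0 else 0) * m = bif b 0 && c 0 then m else 0 := by
      cases hc : c 0
      · simp
      · simpa using hm 0
    rw [h0]
    cases b 0 && c 0 <;> cases Omega (Fin.tail b) (Fin.tail c) <;> simp [add_self]

theorem mul_minterm (b : Fin n → Bool) (x : Fin n → Term V) (i : Fin n) :
    x i * (∏ i, bif b i then x i else x i + 1) =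
      bif b i then ∏ i, (bif b i then x i else x i + 1) else 0 := by
  rw [← Finset.mul_prod_erase _ _ (Finset.mem_univ i), ← mul_assoc]
  cases b i
  · rw [cond_false, mul_self_add, zero_mul, cond_false]
  · rw [cond_true, mul_self, cond_true]

/-- Shannon expansion: splitting along `x 0`, ..., `x (n - 1)` in turn, where each bit of `b`
records the chosen case. -/
theorem hh_expand (a : ℂ) (t : Term V) (x : Fin n → Term V) :
    hh a t = ∏ b : Fin n → Bool, hh a (t * ∏ i, bif b i then x i else x i + 1) := by
  induction n generalizing t with
  | zero => simp
  | succ n ih =>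
    rw [← Equiv.prod_comp (Fin.consEquiv fun _ => Bool), Fintype.prod_prod_type, Fintype.prod_bool,
      hh_split a t (x 0), ih (t * x 0) (Fin.tail x), ih (t * (x 0 + 1)) (Fin.tail x)]
    simp only [Fin.prod_univ_succ, ← mul_assoc]
    rfl

theorem hh_prod {ι : Type} (S : Finset ι) (a : ι → ℂ) (t : Term V) :
    ∏ i ∈ S, hh (a i) t = hh (∏ i ∈ S, a i) t := by
  classical
  induction S using Finset.induction_on with
  | empty => simp [hh_one_left]
  | insert i S hi ih => rw [Finset.prod_insert hi, Finset.prod_insert hi, ih, hh_mul_hh]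

/-- The graphical Fourier transform. On the minterm of `b`, the gadget `c` contributes its phase if
`Omega b c` is true and otherwise disappears by `hh_zero`; exchanging the products collects the
phases of each minterm. -/
theorem prod_hh_linear (β : (Fin n → Bool) → ℂ) (x : Fin n → Term V) :
    ∏ c : Fin n → Bool, hh (Complex.exp (Complex.I * β c)) (∑ i, bif c i then x i else 0) =
      ∏ b : Fin n → Bool, hh (Complex.exp (Complex.I * ∑ c, β c * ((Omega b c).toNat : ℂ)))
        (∏ i, bif b i then x i else x i + 1) := by
  have h : ∀ c : Fin n → Bool, hh (Complex.exp (Complex.I * β c)) (∑ i, bif c i then x i else 0) =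
      ∏ b : Fin n → Bool, hh (Complex.exp (Complex.I * (β c * ((Omega b c).toNat : ℂ))))
        (∏ i, bif b i then x i else x i + 1) := by
    intro c
    rw [hh_expand _ _ x]
    refine Finset.prod_congr rfl fun b _ => ?_
    rw [linear_mul_minterm b c x _ fun i => mul_minterm b x i]
    cases Omega b c
    · simp [hh_zero, hh_one_left]
    · simp
  simp only [h]
  rw [Finset.prod_comm]
  refine Finset.prod_congr rfl fun b _ => ?_
  rw [hh_prod, ← Complex.exp_sum, Finset.mul_sum]

theorem equal_of_expansion (α β : (Fin n → Bool) → ℂ) (γ : ℂ)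
    (h : ∀ b, α b = γ + ∑ c, β c * ((Omega b c).toNat : ℂ)) :
    ZHEqUpToScalar (expNormalForm α) (gadgetForm β) := by
  suffices key : (⟦expNormalForm α⟧ : Diag (Fin n)) =
      ⟦scale (Complex.exp (Complex.I * γ)) (gadgetForm β)⟧ from
    ⟨_, Complex.exp_ne_zero _, Quotient.exact key⟩
  -- The scalar is an H-box on the term `1`, whose expansion gives every minterm the additional
  -- phase `γ`.
  rw [mk_scale, mk_expNormalForm, mk_gadgetForm, prod_hh_linear, ← hh_one,
    hh_expand _ 1 (var : Fin n → Term (Fin n)), ← Finset.prod_mul_distrib]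
  refine Finset.prod_congr rfl fun b _ => ?_
  rw [one_mul, hh_mul_hh, ← Complex.exp_add, h, mul_add, add_comm]

/-! ### Orthogonality of characters and inversion of the coefficients. -/

theorem chi_eq_prod (b c : Fin n → Bool) : chi b c = ∏ i, (-1 : ℂ) ^ ((b i).toNat * (c i).toNat) :=
  (Finset.prod_pow_eq_pow_sum _ _ _).symm

theorem chi_comm (b c : Fin n → Bool) : chi b c = chi c b := by
  simp only [chi, mul_comm]

theorem chi_zero_left (c : Fin n → Bool) : chi (fun _ => false) c = 1 := by
  simp [chi]

/-- Since `χ = (-1)^Ω`, the parity is an affine function of the character; the induction peels off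
one coordinate. -/
theorem Omega_eq (b c : Fin n → Bool) : ((Omega b c).toNat : ℂ) = (1 - chi b c) / 2 := by
  induction n with
  | zero => simp [Omega, chi]
  | succ n ih =>
    have h := ih (Fin.tail b) (Fin.tail c)
    have h2 : chi b c = (-1) ^ ((b 0).toNat * (c 0).toNat) * chi (Fin.tail b) (Fin.tail c) := by
      rw [chi_eq_prod, chi_eq_prod, Fin.prod_univ_succ]
      rfl
    have h3 : chi (Fin.tail b) (Fin.tail c) = 1 - 2 * ((Omega (Fin.tail b) (Fin.tail c)).toNat : ℂ) := by
      rw [h]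
      ring
    rw [Omega_succ, h2, h3]
    cases b 0 <;> cases c 0 <;> cases Omega (Fin.tail b) (Fin.tail c) <;> norm_num

/-- The sum factors over coordinates. A coordinate contributes 2 where `c` and `d` agree and `1 - 1
= 0` where they differ. -/
theorem sum_chi_mul_chi (c d : Fin n → Bool) :
    ∑ b, chi b c * chi b d = if c = d then 2 ^ n else 0 := by
  have h : ∀ b : Fin n → Bool, chi b c * chi b d =
      ∏ i, (-1 : ℂ) ^ ((b i).toNat * (c i).toNat) * (-1) ^ ((b i).toNat * (d i).toNat) := by
    intro b
    rw [chi_eq_prod, chi_eq_prod, Finset.prod_mul_distrib]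
  have h2 := Finset.prod_univ_sum (fun _ : Fin n => (Finset.univ : Finset Bool))
    fun i t => (-1 : ℂ) ^ (t.toNat * (c i).toNat) * (-1) ^ (t.toNat * (d i).toNat)
  rw [Fintype.piFinset_univ] at h2
  simp only [h]
  rw [← h2]
  split_ifs with hcd
  · subst hcd
    rw [Finset.prod_congr rfl (g := fun _ => (2 : ℂ))]
    · simp
    · intro i _
      cases c i <;> norm_num
  · obtain ⟨i, hi⟩ := Function.ne_iff.1 hcd
    refine Finset.prod_eq_zero (Finset.mem_univ i) ?_
    revert hi
    cases c i <;> cases d i <;> norm_num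

theorem sum_Omega_mul_chi (c d : Fin n → Bool) :
    ∑ b, ((Omega b c).toNat : ℂ) * chi b d =
      ((if d = fun _ => false then 2 ^ n else 0) - if c = d then 2 ^ n else 0) / 2 := by
  have h := sum_chi_mul_chi (fun _ => false) d
  simp only [chi_comm _ (fun _ : Fin n => false), chi_zero_left, one_mul] at h
  simp only [Omega_eq, div_mul_eq_mul_div, _root_.sub_mul, one_mul]
  rw [← Finset.sum_div, Finset.sum_sub_distrib, sum_chi_mul_chi, h]
  simp only [eq_comm]

/-- The exponent is an integer so that `n = 0` gives `2⁻¹`. -/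
theorem coefficient_eq (n : ℕ) : -1 / (2 : ℂ) ^ ((n : ℤ) - 1) = -2 / 2 ^ n := by
  rw [zpow_sub_one₀ two_ne_zero, zpow_natCast]
  field_simp

theorem transform_of_expansion {α β : (Fin n → Bool) → ℂ} (h : IsFourierExpansion α β)
    (d : Fin n → Bool) (hd : d ≠ fun _ => false) :
    β d = -1 / (2 : ℂ) ^ ((n : ℤ) - 1) * ∑ b, α b * chi b d := by
  have h1 : ∑ b, α b * chi b d = ∑ c, β c * ∑ b, ((Omega b c).toNat : ℂ) * chi b d := by
    simp only [h _, Finset.sum_mul, Finset.mul_sum, mul_assoc]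
    exact Finset.sum_comm
  rw [h1, coefficient_eq]
  -- The hypothesis `d ≠ 0` removes the contribution of the constant ½ in `Ω = (1 - χ)/2`; only `c =
  -- d` survives.
  simp only [sum_Omega_mul_chi, hd, if_false]
  rw [Finset.sum_eq_single d]
  · rw [if_pos rfl]
    field_simp
    ring
  · intro c _ hc
    simp [hc]
  · simp

theorem expansion_of_transform {α β : (Fin n → Bool) → ℂ} (h : IsFourierTransform α β)
    (b : Fin n → Bool) :
    α b = α (fun _ => false) + ∑ c, β c * ((Omega b c).toNat : ℂ) := by
  have h1 : ∑ c, β c * ((Omega b c).toNat : ℂ) =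
      -2 / 2 ^ n * ∑ d, α d * ∑ c, ((Omega c b).toNat : ℂ) * chi c d := by
    simp only [h _, coefficient_eq, Finset.sum_mul, Finset.mul_sum, Omega_eq]
    rw [Finset.sum_comm]
    refine Finset.sum_congr rfl fun d _ => Finset.sum_congr rfl fun c _ => ?_
    rw [chi_comm b c, chi_comm d c]
    ring
  -- The constant part of `Ω` selects `d = 0` and the character part selects `d = b`; this is the
  -- origin of the term `α 0`.
  have h2 : ∀ d, α d * ∑ c, ((Omega c b).toNat : ℂ) * chi c d =
      2 ^ n / 2 * ((if d = fun _ => false then α d else 0) - if b = d then α d else 0) := by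
    intro d
    rw [sum_Omega_mul_chi]
    split_ifs <;> ring
  rw [h1]
  simp only [h2]
  rw [← Finset.mul_sum, Finset.sum_sub_distrib, Finset.sum_ite_eq', Finset.sum_ite_eq,
    if_pos (Finset.mem_univ _), if_pos (Finset.mem_univ _)]
  field_simp
  ring
end

end ZHCalculus

theorem mainTheorem1 (n : ℕ) (α αt : (Fin n → Bool) → ℂ) :
    ((ZHCalculus.IsFourierExpansion α αt ∨ ZHCalculus.IsFourierTransform α αt) →
      ZHCalculus.ZHEqUpToScalar (ZHCalculus.expNormalForm α) (ZHCalculus.gadgetForm αt)) ∧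
    (ZHCalculus.IsFourierExpansion α αt →
      ∀ c : Fin n → Bool, c ≠ (fun _ => false) →
        αt c = -1 / (2 : ℂ) ^ ((n : ℤ) - 1) * ∑ b, α b * ZHCalculus.chi b c) ∧
    (ZHCalculus.IsFourierTransform α αt →
      ∀ b : Fin n → Bool,
        α b = α (fun _ => false) + ∑ c, αt c * ((ZHCalculus.Omega b c).toNat : ℂ)) := by
  refine ⟨?_, ZHCalculus.transform_of_expansion, ZHCalculus.expansion_of_transform⟩
  rintro (h | h)
  -- Relation (1) needs no correction, so `γ = 0`; relation (2) is an expansion with `γ = α 0`.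
  · exact ZHCalculus.equal_of_expansion α αt 0 fun b => by rw [zero_add, h b]
  · exact ZHCalculus.equal_of_expansion α αt _ (ZHCalculus.expansion_of_transform h)
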